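/- Let $\alpha,a_{uu},a_{uv},a_{vv},b_{uu},b_{uv},b_{vv}\in\mathbb R$ with $\alpha\ne0$, and consider, for real-valued $u,v$ of $x\in\mathbb R$ and $t\ge0$, the initial-value problem $$\begin{cases}u_{tt}=\alpha^2u_{xx}+u_{ttxx}+(f_1(u,v))_{xx},\\ v_{tt}=v_{xx}-v+f_2(u,v),\\ u(0)=u_0,\ u_t(0)=u_1,\ v(0)=v_0,\ v_t(0)=v_1,\end{cases}\qquad \begin{aligned}f_1(u,v)&=a_{uu}u^2+2a_{uv}uv+a_{vv}v^2,\\ f_2(u,v)&=b_{uu}u^2+2b_{uv}uv+b_{vv}v^2.\end{aligned}$$ Assume $a_{uu}=0$ and the Hamiltonian conditions $b_{uu}=-a_{uv}=:B$ and $b_{uv}=-a_{vv}=:C$. Put $X^r:=H^r(\mathbb R)\times(H^r(\mathbb R)\cap\dot H^{r-1}(\mathbb R))$ for the pair $(u,u_t)$ and $Y^s:=H^s(\mathbb R)\times H^{s-1}(\mathbb R)$ for the pair $(v,v_t)$. For an interval $I=[0,T)$, $0<T\le\infty$, a solution on $I$ is a pair $(u,v)$ with $(u,u_t)\in C^1(I;X^r)$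 and $(v,v_t)\in C(I;Y^s)$ which satisfies the two equations at every $t\in I$ in the sense of tempered distributions, the time derivatives $u_t,u_{tt}$ being taken in $H^r$, $v_t$ in $H^{s-1}$ and $v_{tt}$ in $H^{s-2}$, and which takes the initial data. **Theorem.** There is a constant $K_0>0$, depending only on the coefficients of the system, such that the following holds for all $r,s$ with $\tfrac12<r\le s\le r+1$. Let $(u_0,u_1)\in X^r$ and $(v_0,v_1)\in Y^s$ be real-valued and such that in addition $\partial_x^{-1}u_1\in L^2$ (that is, $u_1=\partial_x w_1$ for some $w_1=:\partial_x^{-1}u_1\in L^2$), $(v_0)_x\in L^2$ and $v_1\in L^2$, so that the energy $$E(0)=\frac12\int_{\mathbb R}\Big(u_1^2+\alpha^2u_0^2+(\partial_x^{-1}u_1)^2+v_0^2+(v_0)_x^2+v_1^2\Big)dx-\int_{\mathbb R}\Big(-\frac{a_{uu}}3u_0^3+\frac{b_{vv}}3v_0^3+Bu_0^2v_0+Cu_0v_0^2\Big)dx$$ is defined. If $$E(0)<\tfrac16K_0^{-6}\quad\text{and}\quad \|u_1\|_{L^2}^2+\alpha^2\|u_0\|_{L^2}^2+\|v_0\|_{L^2}^2+\|v_1\|_{L^2}^2+\|(v_0)_x\|_{L^2}^2<K_0^{-3},$$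 then the local solution of the initial-value problem extends to all times: there is a solution $(U,V)$ on $[0,\infty)$, and every solution on an interval $[0,T)$, $0<T<\infty$, is the restriction of $(U,V)$ to $[0,T)$. -/

import Mathlib

open MeasureTheory Set
open scoped SchwartzMap FourierTransform

noncomputable section

namespace KGB

/-- The real space `L²(ℝ; ℝ)`. -/
abbrev L2 : Type := Lp ℝ 2 (volume : Measure ℝ)

/-- The complex space `L²(ℝ; ℂ)`. -/
abbrev L2C : Type := Lp ℂ 2 (volume : Measure ℝ)

/-- The tempered distribution `φ ↦ ∫ φ f dx` given by a real-valued function `f ∈ Lᵖ(ℝ)`. -/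
def toDist {p : ENNReal} [Fact (1 ≤ p)] (f : Lp ℝ p (volume : Measure ℝ)) : 𝓢'(ℝ, ℂ) :=
  Lp.toTemperedDistribution (Complex.ofRealCLM.compLp f)

/-- The distributional derivative `∂ₓ` on `𝓢'(ℝ)`. -/
abbrev Dx (f : 𝓢'(ℝ, ℂ)) : 𝓢'(ℝ, ℂ) := TemperedDistribution.derivCLM ℂ f

/-! ### Sobolev spaces and curves in them

The Bessel potential of order `σ` identifies `H^σ` isometrically with `L²`, and the Fourier
multiplier `|2πξ|^σ` identifies `Ḣ^σ` isometrically with a subspace of `L²`; the norms, and hence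
continuity and differentiability of curves in these spaces, are those of the images in `L²`.
(Mathlib's Fourier transform is `∫ exp(-2πixξ) f(x) dx` and its Bessel potential has the symbol
`(1 + ξ²)^(σ/2)`; the other usual normalizations give equivalent norms on `H^σ`.) -/

/-- `f ∈ H^σ(ℝ)`, and `g` is the image of `f` under the isometry `H^σ → L²`. -/
def SobolevRep (σ : ℝ) (f : 𝓢'(ℝ, ℂ)) (g : L2C) : Prop :=
  TemperedDistribution.besselPotential ℝ ℂ σ f = Lp.toTemperedDistribution g

/-- `f ∈ Ḣ^σ(ℝ)`, and `g` is the image of `f` under the isometry `Ḣ^σ → L²`: the Fourier transform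
of `f` is a locally integrable function `k`, and `g = |2πξ|^σ k ∈ L²`. -/
def HomSobolevRep (σ : ℝ) (f : 𝓢'(ℝ, ℂ)) (g : L2C) : Prop :=
  ∃ k : ℝ → ℂ, LocallyIntegrable k volume ∧
    (∀ φ : 𝓢(ℝ, ℂ), Integrable (fun ξ => φ ξ * k ξ) volume ∧ (𝓕 f) φ = ∫ ξ, φ ξ * k ξ) ∧
    g =ᵐ[volume] fun ξ => ((|2 * Real.pi * ξ| ^ σ : ℝ) : ℂ) * k ξ

/-- `f ∈ Ḣ^σ(ℝ)`. -/
def MemHomSobolev (σ : ℝ) (f : 𝓢'(ℝ, ℂ)) : Prop := ∃ g : L2C, HomSobolevRep σ f g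

/-- `f ∈ C^m(I; H^σ)`. -/
def CmSobolev (m : ℕ) (σ : ℝ) (I : Set ℝ) (f : ℝ → 𝓢'(ℝ, ℂ)) : Prop :=
  ∃ g : ℝ → L2C, ContDiffOn ℝ m g I ∧ ∀ t ∈ I, SobolevRep σ (f t) (g t)

/-- `f ∈ C^m(I; Ḣ^σ)`. -/
def CmHomSobolev (m : ℕ) (σ : ℝ) (I : Set ℝ) (f : ℝ → 𝓢'(ℝ, ℂ)) : Prop :=
  ∃ g : ℝ → L2C, ContDiffOn ℝ m g I ∧ ∀ t ∈ I, HomSobolevRep σ (f t) (g t)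

/-- The curve `f : I → H^σ` is differentiable in the norm of `H^σ`, with derivative `f'`
(one-sided at an end point of `I` that belongs to `I`). -/
def HasTimeDeriv (σ : ℝ) (I : Set ℝ) (f f' : ℝ → 𝓢'(ℝ, ℂ)) : Prop :=
  ∃ g g' : ℝ → L2C, ∀ t ∈ I,
    SobolevRep σ (f t) (g t) ∧ SobolevRep σ (f' t) (g' t) ∧ HasDerivWithinAt g (g' t) I t

/-! ### The system -/

/-- The coefficients of the Klein-Gordon-Boussinesq system. -/
structure Coeffs where
  α : ℝ
  auu : ℝ
  auv : ℝ
  avv : ℝ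
  buu : ℝ
  buv : ℝ
  bvv : ℝ

/-- For `u, v ∈ L²` the function `a u² + 2 b u v + c v²` is integrable. -/
theorem integrable_quad (a b c : ℝ) (u v : L2) :
    Integrable (fun x => a * u x ^ 2 + 2 * b * (u x * v x) + c * v x ^ 2) volume :=
  (((Lp.memLp u).integrable_sq.const_mul a).add
    (((Lp.memLp u).integrable_mul (Lp.memLp v)).const_mul (2 * b))).add
    ((Lp.memLp v).integrable_sq.const_mul c)

/-- `a u² + 2 b u v + c v² ∈ L¹` for `u, v ∈ L²`. -/
def quad (a b c : ℝ) (u v : L2) : Lp ℝ 1 (volume : Measure ℝ) :=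
  (integrable_quad a b c u v).toL1 _

/-- The nonlinearity `f₁(u, v) = a_uu u² + 2 a_uv u v + a_vv v²`. -/
def f₁ (c : Coeffs) (u v : L2) : 𝓢'(ℝ, ℂ) := toDist (quad c.auu c.auv c.avv u v)

/-- The nonlinearity `f₂(u, v) = b_uu u² + 2 b_uv u v + b_vv v²`. -/
def f₂ (c : Coeffs) (u v : L2) : 𝓢'(ℝ, ℂ) := toDist (quad c.buu c.buv c.bvv u v)

/-- `(u, v)`, with velocities `(uₜ, vₜ)`, is a solution on the time interval `I` of
`u_tt = α² u_xx + u_ttxx + (f₁(u, v))_xx`, `v_tt = v_xx - v + f₂(u, v)` with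
`(u, u_t) ∈ C¹(I; H^r × (H^r ∩ Ḣ^(r-1)))` and `(v, v_t) ∈ C(I; H^s × H^(s-1))`. The time derivatives
`u_t`, `u_tt`, `v_t`, `v_tt` are taken in `H^r`, `H^r`, `H^(s-1)`, `H^(s-2)`, and the equations hold
at every time in the sense of tempered distributions. -/
structure IsSolution (c : Coeffs) (r s : ℝ) (I : Set ℝ)
    (u v : ℝ → L2) (ut vt : ℝ → 𝓢'(ℝ, ℂ)) : Prop where
  u_mem : CmSobolev 1 r I (fun t => toDist (u t))
  ut_mem : CmSobolev 1 r I ut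
  ut_mem_hom : CmHomSobolev 1 (r - 1) I ut
  v_mem : CmSobolev 0 s I (fun t => toDist (v t))
  vt_mem : CmSobolev 0 (s - 1) I vt
  u_deriv : HasTimeDeriv r I (fun t => toDist (u t)) ut
  v_deriv : HasTimeDeriv (s - 1) I (fun t => toDist (v t)) vt
  eq_u : ∃ utt : ℝ → 𝓢'(ℝ, ℂ), HasTimeDeriv r I ut utt ∧ ∀ t ∈ I,
    utt t = ((c.α ^ 2 : ℝ) : ℂ) • Dx (Dx (toDist (u t))) + Dx (Dx (utt t))
      + Dx (Dx (f₁ c (u t) (v t)))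
  eq_v : ∃ vtt : ℝ → 𝓢'(ℝ, ℂ), HasTimeDeriv (s - 2) I vt vtt ∧ ∀ t ∈ I,
    vtt t = Dx (Dx (toDist (v t))) - toDist (v t) + f₂ c (u t) (v t)

/-- `(u, v)`, with velocities `(uₜ, vₜ)`, takes the initial data `(u₀, u₁, v₀, v₁)`. -/
def HasData (u₀ u₁ v₀ v₁ : L2) (u v : ℝ → L2) (ut vt : ℝ → 𝓢'(ℝ, ℂ)) : Prop :=
  u 0 = u₀ ∧ ut 0 = toDist u₁ ∧ v 0 = v₀ ∧ vt 0 = toDist v₁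

/-- The primitive `𝔉(u, v) = -(a_uu / 3) u³ + (b_vv / 3) v³ + B u² v + C u v²`, where `B = b_uu` and
`C = b_uv`. -/
def potential (c : Coeffs) (u v : ℝ) : ℝ :=
  -(c.auu / 3) * u ^ 3 + c.bvv / 3 * v ^ 3 + c.buu * u ^ 2 * v + c.buv * u * v ^ 2

/-- The energy
`½ ∫ (u_t² + α² u² + (∂ₓ⁻¹ u_t)² + v² + v_x² + v_t²) dx - ∫ 𝔉(u, v) dx` of the state
`(u, u_t, v, v_t) = (u, p, v, q)`, where `w = ∂ₓ⁻¹ p` and `vx = ∂ₓ v`. -/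
def energy (c : Coeffs) (u p w v vx q : L2) : ℝ :=
  (1 / 2) * (∫ x, (p x ^ 2 + c.α ^ 2 * u x ^ 2 + w x ^ 2 + v x ^ 2 + vx x ^ 2 + q x ^ 2))
    - ∫ x, potential c (u x) (v x)

end KGB

end

/-!
The problem is solved on the Fourier side. Write `ω = (1 + 4π²ξ²)^(1/2)` for the frequency of the
Klein-Gordon equation. Since `u_tt - u_ttxx = ∂ₓ² (α² u + f₁(u, v))`, and `∂ₓ² (1 - ∂ₓ²)⁻¹` has order
zero, the equation for `u` is an ordinary differential equation in `H^r`. The linear part of the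
equation for `v` is removed by passing to the profiles `exp(±itω) (v̂ ± i ω⁻¹ ∂ₜ v̂)` of the two
half-waves. As `H^r` is an algebra for `r > 1/2`, and as `(1 - ∂ₓ²)^(-1/2)` gains the one derivative
which separates `H^r` from `H^s` for `s ≤ r + 1`, the system becomes an ordinary differential
equation `y' = F(t, y)` on a power of `L²`, with `F` Lipschitz on bounded sets (`Sys.field`,
`Sys.isLocLipField`). Such an equation has a global solution once its norm is bounded a priori on
bounded time intervals (`exists_global_ODESol`).

* *Energy.* The equation for `u` is also the first-order system `uₜ = m x`, `xₜ = m (α² u + f₁)`,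
  where `x = (1 - ∂ₓ²)^(1/2) ∂ₓ⁻¹ uₜ` and `m = ∂ₓ (1 - ∂ₓ²)^(-1/2)` is skew-adjoint, and
  `‖x‖² = ‖uₜ‖² + ‖∂ₓ⁻¹ uₜ‖²`. Under the Hamiltonian conditions `(-f₁, f₂)` is the gradient of the
  cubic potential, so that the energy of real-valued solutions is conserved
  (`Sys.hasDerivWithinAt_en`). Real data have real solutions since the complex conjugate of a
  solution is a solution (`Sys.conjSt_eq_of_isODESol`).
* *Potential well.* With `ρ = α² ‖u‖² + ‖v‖²_{H¹} + ‖vₜ‖²` the cubic part of the energy is at most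
  `K ρ^(3/2)`, where `K` depends only on the coefficients. Hence `E ≥ ρ / 6` when `ρ` equals
  `ρ⋆ = (3K)⁻²`, and `ρ` cannot reach `ρ⋆` if initially `ρ < ρ⋆` and `E < ρ⋆ / 6` (`Sys.rho_lt`).
* *Bounds for the full norm.* The well bounds `v` in `H¹`, hence in the algebra `𝓕 L¹` of functions
  with integrable Fourier transform. As `a_uu = 0`, the equation for `u` is linear in `u`, and
  Gronwall's inequality bounds `u` in `𝓕 L¹` (`Sys.exists_l1_bound`). The product in `H^r` obeys the
  tame estimate `‖f g‖_{H^r} ≤ C (‖f̂‖₁ ‖g‖_{H^r} + ‖f‖_{H^r} ‖ĝ‖₁)` (`eLpNorm_wt_conv_le`), so that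
  `F` now grows at most linearly along the solution, and Gronwall's inequality applies to the norm of
  `y` (`Sys.exists_bound_of_l1_bound`).

For `s < 1` the assumptions on the data put `(v₀, v₁)` into `H¹ × L²`, and the argument is run with
`s = 1`. Conversely, every solution in the sense of distributions yields a solution of the
first-order system with the auxiliary unknown `x = uₜ` (`Sys.exists_isODESol_of_isSolution`), for
which no primitive of `uₜ` is needed, and uniqueness for ordinary differential equations gives
uniqueness for the original problem (`IsSolution.unique`).
-/

noncomputable section

namespace KGB

/-! ### Global solutions of locally Lipschitz ordinary differential equations -/

section ODE

open Metric Filter Topology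
open scoped NNReal

variable {E : Type*} [NormedAddCommGroup E] [NormedSpace ℝ E]

/-- The radial retraction of a normed space onto the closed ball of radius `R` about `0`. -/
def radialProj (R : ℝ) (x : E) : E := (R / max R ‖x‖) • x

theorem radialProj_of_norm_le {R : ℝ} (hR : 0 < R) {x : E} (hx : ‖x‖ ≤ R) :
    radialProj R x = x := by
  rw [radialProj, max_eq_left hx, div_self hR.ne', one_smul]

theorem norm_radialProj_le {R : ℝ} (hR : 0 < R) (x : E) : ‖radialProj R x‖ ≤ R := by
  have h : 0 < max R ‖x‖ := lt_max_of_lt_left hR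
  rw [radialProj, norm_smul, Real.norm_of_nonneg (by positivity), div_mul_eq_mul_div, div_le_iff₀ h]
  exact mul_le_mul_of_nonneg_left (le_max_right _ _) hR.le

theorem lipschitzWith_radialProj {R : ℝ} (hR : 0 < R) :
    LipschitzWith 2 (radialProj R : E → E) := by
  refine LipschitzWith.of_dist_le_mul fun x y => ?_
  rw [dist_eq_norm, dist_eq_norm]
  set a := max R ‖x‖ with ha
  set b := max R ‖y‖ with hb
  have ha0 : 0 < a := lt_max_of_lt_left hR
  have hb0 : 0 < b := lt_max_of_lt_left hR
  have hab : |b - a| ≤ ‖x - y‖ := by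
    refine (abs_max_sub_max_le_max R ‖y‖ R ‖x‖).trans ?_
    rw [sub_self, abs_zero, max_eq_right (abs_nonneg _), abs_sub_comm]
    exact abs_norm_sub_norm_le x y
  have e : radialProj R x - radialProj R y = (R / a) • (x - y) + (R * (b - a) / (a * b)) • y := by
    have : R / b = R / a - R * (b - a) / (a * b) := by field_simp; ring
    rw [radialProj, radialProj, ← ha, ← hb, this, sub_smul, smul_sub]; abel
  have h1 : R / a ≤ 1 := (div_le_one ha0).2 (le_max_left _ _)
  have h2 : ‖(R * (b - a) / (a * b)) • y‖ ≤ |b - a| := by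
    rw [norm_smul, Real.norm_eq_abs, abs_div, abs_mul, abs_of_pos hR, abs_of_pos (mul_pos ha0 hb0),
      div_mul_eq_mul_div, div_le_iff₀ (mul_pos ha0 hb0)]
    have : R * ‖y‖ ≤ a * b := mul_le_mul (le_max_left _ _) (le_max_right _ _) (norm_nonneg _) ha0.le
    nlinarith [abs_nonneg (b - a)]
  rw [e]
  refine (norm_add_le _ _).trans ?_
  rw [norm_smul, Real.norm_of_nonneg (by positivity)]
  have := mul_le_mul_of_nonneg_right h1 (norm_nonneg (x - y))
  simp only [NNReal.coe_ofNat]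
  linarith

/-- A time-dependent vector field which vanishes at the origin, is continuous in time, and is
Lipschitz on bounded sets, uniformly in time. -/
structure IsLocLipField (F : ℝ → E → E) : Prop where
  cont : ∀ x, Continuous fun t => F t x
  lip : ∀ R : ℝ, ∃ L : ℝ≥0, ∀ t, LipschitzOnWith L (F t) (closedBall 0 R)
  zero : ∀ t, F t 0 = 0

/-- `y` solves `y' = F(t, y)` on `[0, T]`. -/
def IsODESol (F : ℝ → E → E) (T : ℝ) (y : ℝ → E) : Prop :=
  ∀ t ∈ Icc 0 T, HasDerivWithinAt y (F t (y t)) (Icc 0 T) t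

theorem IsODESol.continuousOn {F : ℝ → E → E} {T : ℝ} {y : ℝ → E} (h : IsODESol F T y) :
    ContinuousOn y (Icc 0 T) := fun t ht => (h t ht).continuousWithinAt

theorem IsODESol.mono {F : ℝ → E → E} {T T' : ℝ} {y : ℝ → E} (h : IsODESol F T y) (hT : T' ≤ T) :
    IsODESol F T' y := fun t ht =>
  (h t ⟨ht.1, ht.2.trans hT⟩).mono (Icc_subset_Icc_right hT)

theorem hasDerivWithinAt_Ici_of_Icc {y : ℝ → E} {y' : E} {T t : ℝ} (ht : t ∈ Ico 0 T)
    (h : HasDerivWithinAt y y' (Icc 0 T) t) : HasDerivWithinAt y y' (Ici t) t := by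
  refine (h.mono (Icc_subset_Icc_left ht.1)).mono_of_mem_nhdsWithin ?_
  exact Icc_mem_nhdsGE ht.2

theorem IsODESol.unique {F : ℝ → E → E} (hF : IsLocLipField F) {T : ℝ} {y z : ℝ → E}
    (hy : IsODESol F T y) (hz : IsODESol F T z) (h0 : y 0 = z 0) : EqOn y z (Icc 0 T) := by
  obtain ⟨R₁, hR₁⟩ := isCompact_Icc.exists_bound_of_continuousOn hy.continuousOn
  obtain ⟨R₂, hR₂⟩ := isCompact_Icc.exists_bound_of_continuousOn hz.continuousOn
  obtain ⟨L, hL⟩ := hF.lip (max R₁ R₂)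
  refine ODE_solution_unique_of_mem_Icc_right (v := F) (s := fun _ => closedBall 0 (max R₁ R₂))
    (fun t _ => hL t) hy.continuousOn
    (fun t ht => hasDerivWithinAt_Ici_of_Icc ht (hy t (Ico_subset_Icc_self ht))) (fun t ht => ?_)
    hz.continuousOn
    (fun t ht => hasDerivWithinAt_Ici_of_Icc ht (hz t (Ico_subset_Icc_self ht))) (fun t ht => ?_) h0
  · rw [mem_closedBall_zero_iff]
    exact (hR₁ t (Ico_subset_Icc_self ht)).trans (le_max_left _ _)
  · rw [mem_closedBall_zero_iff]
    exact (hR₂ t (Ico_subset_Icc_self ht)).trans (le_max_right _ _)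

/-- A solution of the ODE on `[0, T]` exists as soon as all solutions on shorter intervals obey a
common bound: the field, cut off outside a larger ball, is bounded and globally Lipschitz, and its
solution never reaches the region of the cut-off. -/
theorem exists_isODESol [CompleteSpace E] {F : ℝ → E → E} (hF : IsLocLipField F) {T R : ℝ}
    (hT : 0 ≤ T) (x₀ : E)
    (hR : ∀ τ ∈ Icc 0 T, ∀ y : ℝ → E, y 0 = x₀ → IsODESol F τ y → ∀ t ∈ Icc 0 τ, ‖y t‖ ≤ R) :
    ∃ y : ℝ → E, y 0 = x₀ ∧ IsODESol F T y := by
  set ρ := max R ‖x₀‖ + 1 with hρ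
  have hρ0 : 0 < ρ := by have := (norm_nonneg x₀).trans (le_max_right R ‖x₀‖); positivity
  obtain ⟨L, hL⟩ := hF.lip ρ
  have hmem : ∀ x : E, radialProj ρ x ∈ closedBall (0 : E) ρ := fun x => by
    rw [mem_closedBall_zero_iff]; exact norm_radialProj_le hρ0 x
  set M : ℝ≥0 := L * ⟨ρ, hρ0.le⟩ with hM
  have hbd : ∀ t x, ‖F t (radialProj ρ x)‖ ≤ M := fun t x => by
    have := (hL t).dist_le_mul _ (hmem x) 0 (mem_closedBall_self hρ0.le)
    rw [hF.zero, dist_zero_right, dist_zero_right] at this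
    exact this.trans (mul_le_mul_of_nonneg_left (norm_radialProj_le hρ0 x) L.2)
  have hPL : IsPicardLindelof (fun t x => F t (radialProj ρ x)) (tmin := 0) (tmax := T)
      ⟨0, left_mem_Icc.2 hT⟩ x₀ (M * ⟨T, hT⟩) 0 M (L * 2) := by
    refine ⟨fun t _ => ?_, fun x _ => (hF.cont _).continuousOn, fun t _ x _ => hbd t x, ?_⟩
    · exact ((hL t).comp (lipschitzWith_radialProj hρ0).lipschitzOnWith
        (fun x _ => hmem x))
    · simp only [sub_zero, sub_self, max_eq_left hT, NNReal.coe_zero]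
      exact le_rfl
  obtain ⟨y, hy0, hy⟩ := hPL.exists_eq_forall_mem_Icc_hasDerivWithinAt₀
  have hyc : ContinuousOn y (Icc 0 T) := fun t ht => (hy t ht).continuousWithinAt
  have key : ∀ t ∈ Icc 0 T, ‖y t‖ ≤ ρ := by
    by_contra! hcon
    obtain ⟨t₁, ht₁, h₁⟩ := hcon
    -- the first time at which the norm equals `ρ`
    set S := Icc 0 t₁ ∩ (fun t => ‖y t‖) ⁻¹' Ici ρ with hS
    have hc1 : ContinuousOn (fun t => ‖y t‖) (Icc 0 t₁) :=
      (hyc.mono (Icc_subset_Icc_right ht₁.2)).norm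
    have hSc : IsClosed S := hc1.preimage_isClosed_of_isClosed isClosed_Icc isClosed_Ici
    have hSne : S.Nonempty := ⟨t₁, ⟨ht₁.1, le_rfl⟩, h₁.le⟩
    have hSbd : BddBelow S := ⟨0, fun t ht => ht.1.1⟩
    have hτ := hSc.csInf_mem hSne hSbd
    set τ := sInf S
    have hlt : ∀ t ∈ Ico 0 τ, ‖y t‖ < ρ := fun t ht => by
      by_contra! h
      exact (notMem_of_lt_csInf ht.2 hSbd) ⟨⟨ht.1, (ht.2.trans_le hτ.1.2).le⟩, h⟩
    have hτT : τ ≤ T := hτ.1.2.trans ht₁.2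
    have hτ0 : 0 < τ := by
      rcases hτ.1.1.eq_or_lt with h | h
      · exfalso
        have h2 : ρ ≤ ‖y τ‖ := hτ.2
        rw [← h, hy0] at h2
        have := le_max_right R ‖x₀‖
        linarith
      · exact h
    have hle : ∀ t ∈ Icc 0 τ, ‖y t‖ ≤ ρ := by
      have hcl : closure (Ico 0 τ) = Icc 0 τ := closure_Ico hτ0.ne
      intro t ht
      refine le_on_closure (s := Ico 0 τ) (f := fun t => ‖y t‖) (g := fun _ => ρ)
        (fun t ht => (hlt t ht).le) ?_ continuousOn_const (hcl ▸ ht)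
      rw [hcl]
      exact (hyc.mono (Icc_subset_Icc_right hτT)).norm
    have hsol : IsODESol F τ y := fun t ht => by
      have := (hy t ⟨ht.1, ht.2.trans hτT⟩).mono (Icc_subset_Icc_right hτT)
      rwa [radialProj_of_norm_le hρ0 (hle t ht)] at this
    have h3 := hR τ ⟨hτ0.le, hτT⟩ y hy0 hsol τ ⟨hτ0.le, le_rfl⟩
    have h2 : ρ ≤ ‖y τ‖ := hτ.2
    have := le_max_left R ‖x₀‖
    linarith
  refine ⟨y, hy0, fun t ht => ?_⟩
  have := hy t ht
  rwa [radialProj_of_norm_le hρ0 (key t ht)] at this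

/-- Global existence under an a priori bound on every bounded time interval. -/
theorem exists_global_ODESol [CompleteSpace E] {F : ℝ → E → E} (hF : IsLocLipField F) (x₀ : E)
    (hR : ∀ T : ℝ, ∃ R : ℝ, ∀ τ ∈ Icc 0 T, ∀ y : ℝ → E, y 0 = x₀ → IsODESol F τ y →
      ∀ t ∈ Icc 0 τ, ‖y t‖ ≤ R) :
    ∃ y : ℝ → E, y 0 = x₀ ∧ ∀ t ∈ Ici (0 : ℝ), HasDerivWithinAt y (F t (y t)) (Ici 0) t := by
  have hex : ∀ n : ℕ, ∃ y : ℝ → E, y 0 = x₀ ∧ IsODESol F n y := fun n => by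
    obtain ⟨R, hR⟩ := hR n
    exact exists_isODESol hF n.cast_nonneg x₀ hR
  choose y hy0 hy using hex
  have hag : ∀ m n : ℕ, m ≤ n → EqOn (y m) (y n) (Icc 0 m) := fun m n hmn =>
    (hy m).unique hF ((hy n).mono (by exact_mod_cast hmn)) ((hy0 m).trans (hy0 n).symm)
  set z : ℝ → E := fun t => y (⌈t⌉₊ + 1) t with hz
  have hzy : ∀ n : ℕ, EqOn z (y n) (Icc 0 n) := fun n t ht => by
    rcases le_total (⌈t⌉₊ + 1) n with h | h
    · exact hag _ _ h ⟨ht.1, by push_cast; linarith [Nat.le_ceil t]⟩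
    · exact (hag _ _ h ht).symm
  refine ⟨z, by simp [hz, hy0], fun t ht => ?_⟩
  set n := ⌈t⌉₊ + 1 with hn
  have htn : t < n := by rw [hn]; push_cast; linarith [Nat.le_ceil t]
  have ht' : t ∈ Icc (0 : ℝ) n := ⟨ht, htn.le⟩
  have h1 : HasDerivWithinAt z (F t (z t)) (Icc 0 n) t := by
    rw [hzy n ht']
    exact (hy n t ht').congr_of_mem (fun s hs => hzy n hs) ht'
  refine h1.mono_of_mem_nhdsWithin ?_
  have : Iio (n : ℝ) ∈ 𝓝 t := Iio_mem_nhds htn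
  filter_upwards [self_mem_nhdsWithin, mem_nhdsWithin_of_mem_nhds this] with s h1 h2
  exact ⟨h1, le_of_lt h2⟩

end ODE

/-! ### Multiplication operators on `L²` -/

section Mult

open Filter Topology

/-- `m` is a bounded measurable function, that is, the symbol of a bounded Fourier multiplier. -/
def IsMult (m : ℝ → ℂ) : Prop := Measurable m ∧ ∃ C : ℝ, ∀ ξ, ‖m ξ‖ ≤ C

theorem IsMult.mul {m n : ℝ → ℂ} (hm : IsMult m) (hn : IsMult n) :
    IsMult fun ξ => m ξ * n ξ := by
  obtain ⟨hm, C, hC⟩ := hm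
  obtain ⟨hn, D, hD⟩ := hn
  refine ⟨hm.mul hn, C * D, fun ξ => ?_⟩
  rw [norm_mul]
  exact mul_le_mul (hC ξ) (hD ξ) (norm_nonneg _) ((norm_nonneg _).trans (hC ξ))

theorem IsMult.const (c : ℂ) : IsMult fun _ => c := ⟨measurable_const, ‖c‖, fun _ => le_rfl⟩

theorem IsMult.star {m : ℝ → ℂ} (hm : IsMult m) : IsMult fun ξ => starRingEnd ℂ (m ξ) := by
  obtain ⟨hm, C, hC⟩ := hm
  exact ⟨Complex.continuous_conj.measurable.comp hm, C, fun ξ => by simpa using hC ξ⟩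

theorem IsMult.memLp {m : ℝ → ℂ} (hm : IsMult m) (f : L2C) :
    MemLp (fun ξ => m ξ * f ξ) 2 volume := by
  obtain ⟨hm, C, hC⟩ := hm
  refine MemLp.of_le_mul (c := C) (Lp.memLp f)
    (hm.aestronglyMeasurable.mul (Lp.aestronglyMeasurable f)) (ae_of_all _ fun ξ => ?_)
  rw [norm_mul]
  exact mul_le_mul_of_nonneg_right (hC ξ) (norm_nonneg _)

open Classical in
/-- Multiplication by a bounded measurable function `m`, as an operator on `L²`. (It is `0` if `m`
is not bounded or not measurable.) -/
def mulOp (m : ℝ → ℂ) : L2C →L[ℂ] L2C :=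
  if hm : IsMult m then
    LinearMap.mkContinuous
      { toFun := fun f => (hm.memLp f).toLp _
        map_add' := fun f g => by
          refine Lp.ext ?_
          filter_upwards [(hm.memLp (f + g)).coeFn_toLp, (hm.memLp f).coeFn_toLp,
            (hm.memLp g).coeFn_toLp, Lp.coeFn_add f g,
            Lp.coeFn_add ((hm.memLp f).toLp _) ((hm.memLp g).toLp _)] with ξ h1 h2 h3 h4 h5
          rw [h1, h5, Pi.add_apply, h2, h3, h4, Pi.add_apply, mul_add]
        map_smul' := fun c f => by
          refine Lp.ext ?_
          filter_upwards [(hm.memLp (c • f)).coeFn_toLp, (hm.memLp f).coeFn_toLp,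
            Lp.coeFn_smul c f, Lp.coeFn_smul c ((hm.memLp f).toLp _)] with ξ h1 h2 h3 h4
          simp only [RingHom.id_apply]
          rw [h1, h4, Pi.smul_apply, h2, h3, Pi.smul_apply, smul_eq_mul, smul_eq_mul]
          ring }
      (Classical.choose hm.2) (fun f => by
        refine Lp.norm_le_mul_norm_of_ae_le_mul ?_
        filter_upwards [(hm.memLp f).coeFn_toLp] with ξ h1
        simp only [LinearMap.coe_mk, AddHom.coe_mk]
        rw [h1, norm_mul]
        exact mul_le_mul_of_nonneg_right (Classical.choose_spec hm.2 ξ) (norm_nonneg _))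
  else 0

theorem coeFn_mulOp {m : ℝ → ℂ} (hm : IsMult m) (f : L2C) :
    mulOp m f =ᵐ[volume] fun ξ => m ξ * f ξ := by
  rw [mulOp, dif_pos hm]
  exact (hm.memLp f).coeFn_toLp

theorem norm_mulOp_le {m : ℝ → ℂ} (hm : IsMult m) {C : ℝ} (hC : ∀ ξ, ‖m ξ‖ ≤ C) (f : L2C) :
    ‖mulOp m f‖ ≤ C * ‖f‖ := by
  refine Lp.norm_le_mul_norm_of_ae_le_mul ?_
  filter_upwards [coeFn_mulOp hm f] with ξ h
  rw [h, norm_mul]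
  exact mul_le_mul_of_nonneg_right (hC ξ) (norm_nonneg _)

theorem norm_mulOp_eq {m : ℝ → ℂ} (hm : IsMult m) (h1 : ∀ ξ, ‖m ξ‖ = 1) (f : L2C) :
    ‖mulOp m f‖ = ‖f‖ := by
  rw [Lp.norm_def, Lp.norm_def]
  congr 1
  refine eLpNorm_congr_norm_ae ?_
  filter_upwards [coeFn_mulOp hm f] with ξ h
  rw [h, norm_mul, h1, one_mul]

theorem mulOp_eq_iff {m : ℝ → ℂ} (hm : IsMult m) (f g : L2C) :
    mulOp m f = g ↔ g =ᵐ[volume] fun ξ => m ξ * f ξ := by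
  constructor
  · rintro rfl; exact coeFn_mulOp hm f
  · intro h; exact Lp.ext ((coeFn_mulOp hm f).trans h.symm)

theorem mulOp_mulOp {m n : ℝ → ℂ} (hm : IsMult m) (hn : IsMult n) (f : L2C) :
    mulOp m (mulOp n f) = mulOp (fun ξ => m ξ * n ξ) f := by
  rw [mulOp_eq_iff hm]
  filter_upwards [coeFn_mulOp (hm.mul hn) f, coeFn_mulOp hn f] with ξ h1 h2
  rw [h1, h2, mul_assoc]

theorem mulOp_comm {m n : ℝ → ℂ} (hm : IsMult m) (hn : IsMult n) (f : L2C) :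
    mulOp m (mulOp n f) = mulOp n (mulOp m f) := by
  rw [mulOp_mulOp hm hn, mulOp_mulOp hn hm]
  simp_rw [mul_comm]

theorem mulOp_eq_smul {m : ℝ → ℂ} (c : ℂ) (h : ∀ ξ, m ξ = c) (f : L2C) : mulOp m f = c • f := by
  have hm : m = fun _ => c := funext h
  rw [hm, mulOp_eq_iff (IsMult.const c)]
  filter_upwards [Lp.coeFn_smul c f] with ξ h
  rw [h, Pi.smul_apply, smul_eq_mul]

theorem mulOp_smul_symbol {m n : ℝ → ℂ} (hn : IsMult n) (c : ℂ) (h : ∀ ξ, m ξ = c * n ξ)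
    (f : L2C) : mulOp m f = c • mulOp n f := by
  rw [← mulOp_eq_smul (m := fun _ => c) c (fun _ => rfl), mulOp_mulOp (IsMult.const c) hn]
  congr 2; exact funext h

theorem inner_mulOp {m : ℝ → ℂ} (hm : IsMult m) (f g : L2C) :
    inner ℂ (mulOp m f) g = inner ℂ f (mulOp (fun ξ => starRingEnd ℂ (m ξ)) g) := by
  rw [L2.inner_def, L2.inner_def]
  refine integral_congr_ae ?_
  filter_upwards [coeFn_mulOp hm f, coeFn_mulOp hm.star g] with ξ h1 h2
  simp only [RCLike.inner_apply, h1, h2, map_mul]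
  ring

theorem mulOp_injective {m : ℝ → ℂ} (hm : IsMult m) (h0 : ∀ ξ, m ξ ≠ 0) :
    Function.Injective (mulOp m) := by
  intro f g hfg
  refine Lp.ext ?_
  filter_upwards [coeFn_mulOp hm f, coeFn_mulOp hm g] with ξ h1 h2
  rw [hfg, h2] at h1
  exact (mul_left_cancel₀ (h0 ξ) h1).symm

/-- Dominated convergence for multiplication operators. -/
theorem tendsto_mulOp {ι : Type*} {l : Filter ι} [l.IsCountablyGenerated] {m : ι → ℝ → ℂ}
    {m₀ : ℝ → ℂ} {C : ℝ} (hm : ∀ i, IsMult (m i)) (hm₀ : IsMult m₀) (hC : ∀ i ξ, ‖m i ξ‖ ≤ C)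
    (hC₀ : ∀ ξ, ‖m₀ ξ‖ ≤ C) (hlim : ∀ ξ, Tendsto (fun i => m i ξ) l (𝓝 (m₀ ξ))) (f : L2C) :
    Tendsto (fun i => mulOp (m i) f) l (𝓝 (mulOp m₀ f)) := by
  rw [Lp.tendsto_Lp_iff_tendsto_eLpNorm']
  have hsq : ∀ i, eLpNorm (⇑(mulOp (m i) f) - ⇑(mulOp m₀ f)) 2 volume
      = (∫⁻ ξ, ‖(m i ξ - m₀ ξ) * f ξ‖ₑ ^ (2 : ℝ)) ^ (1 / 2 : ℝ) := fun i => by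
    rw [eLpNorm_eq_lintegral_rpow_enorm_toReal (by norm_num) (by norm_num)]
    simp only [ENNReal.toReal_ofNat]
    congr 1
    refine lintegral_congr_ae ?_
    filter_upwards [coeFn_mulOp (hm i) f, coeFn_mulOp hm₀ f] with ξ h1 h2
    rw [Pi.sub_apply, h1, h2, sub_mul]
  simp_rw [hsq]
  have key : Tendsto (fun i => ∫⁻ ξ, ‖(m i ξ - m₀ ξ) * f ξ‖ₑ ^ (2 : ℝ)) l (𝓝 0) := by
    have h0 : (0 : ENNReal) = ∫⁻ _ : ℝ, 0 := by simp
    rw [h0]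
    refine tendsto_lintegral_filter_of_dominated_convergence
      (fun ξ => (ENNReal.ofReal (2 * C) * ‖f ξ‖ₑ) ^ (2 : ℝ)) ?_ ?_ ?_ ?_
    · refine Eventually.of_forall fun i => ?_
      exact (((hm i).1.sub hm₀.1).mul (Lp.stronglyMeasurable f).measurable).enorm.pow_const _
    · refine Eventually.of_forall fun i => ae_of_all _ fun ξ => ?_
      refine ENNReal.rpow_le_rpow ?_ (by norm_num)
      rw [enorm_mul]
      gcongr
      rw [← ofReal_norm]
      refine ENNReal.ofReal_le_ofReal ((norm_sub_le _ _).trans ?_)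
      linarith [hC i ξ, hC₀ ξ]
    · simp_rw [ENNReal.mul_rpow_of_nonneg _ _ (show (0:ℝ) ≤ 2 by norm_num)]
      rw [lintegral_const_mul' _ _ (by finiteness)]
      have := (lintegral_rpow_enorm_lt_top_of_eLpNorm_lt_top (p := 2) (by norm_num) (by norm_num)
        (Lp.memLp f).2).ne
      simp only [ENNReal.toReal_ofNat] at this
      exact ENNReal.mul_ne_top (by finiteness) this
    · refine ae_of_all _ fun ξ => ?_
      have h1 : Tendsto (fun i => (m i ξ - m₀ ξ) * f ξ) l (𝓝 0) := by
        have := ((hlim ξ).sub_const (m₀ ξ)).mul_const (f ξ)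
        simpa using this
      have h2 := (ENNReal.continuous_rpow_const (y := 2)).tendsto 0 |>.comp
        ((continuous_enorm.tendsto (0:ℂ)).comp h1 |>.trans (by simp))
      simpa [Function.comp_def] using h2
  have := (ENNReal.continuous_rpow_const (y := 1 / 2)).tendsto 0 |>.comp key
  simpa [Function.comp_def] using this

theorem hasDerivWithinAt_mulOp (m : ℝ → ℂ) {f : ℝ → L2C} {f' : L2C} {I : Set ℝ} {t : ℝ}
    (hf : HasDerivWithinAt f f' I t) :
    HasDerivWithinAt (fun τ => mulOp m (f τ)) (mulOp m f') I t :=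
  ((mulOp m).restrictScalars ℝ).hasFDerivAt.comp_hasDerivWithinAt t hf

end Mult

theorem coe_smul_eq (c : ℝ) (f : L2C) : (c : ℂ) • f = c • f := by
  refine Lp.ext ?_
  filter_upwards [Lp.coeFn_smul (c : ℂ) f, Lp.coeFn_smul c f] with ξ h1 h2
  rw [h1, h2, Pi.smul_apply, Pi.smul_apply, Complex.real_smul, smul_eq_mul]

/-! ### The weights -/

section Weights

/-- The symbol `(1 + ξ²)^(σ/2)` of the Bessel potential of order `σ`. -/
def wt (σ ξ : ℝ) : ℂ := ((1 + ‖ξ‖ ^ 2) ^ (σ / 2) : ℝ)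

/-- The frequency `ω(ξ) = √(1 + 4π²ξ²)` of the Klein-Gordon equation. -/
def om (ξ : ℝ) : ℝ := √(1 + (2 * Real.pi * ξ) ^ 2)

theorem wt_ne_zero (σ ξ : ℝ) : wt σ ξ ≠ 0 := by
  rw [wt, Complex.ofReal_ne_zero]; positivity

theorem wt_zero (ξ : ℝ) : wt 0 ξ = 1 := by simp [wt]

theorem norm_wt (σ ξ : ℝ) : ‖wt σ ξ‖ = (1 + ‖ξ‖ ^ 2) ^ (σ / 2) := by
  rw [wt, Complex.norm_real, Real.norm_of_nonneg (by positivity)]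

theorem wt_add (σ τ ξ : ℝ) : wt (σ + τ) ξ = wt σ ξ * wt τ ξ := by
  rw [wt, wt, wt, ← Complex.ofReal_mul, ← Real.rpow_add (by positivity), add_div]

theorem wt_neg_mul (σ ξ : ℝ) : wt (-σ) ξ * wt σ ξ = 1 := by
  rw [← wt_add, neg_add_cancel, wt_zero]

theorem wt_mul_neg (σ ξ : ℝ) : wt σ ξ * wt (-σ) ξ = 1 := by
  rw [← wt_add, add_neg_cancel, wt_zero]

theorem wt_neg_arg (σ ξ : ℝ) : wt σ (-ξ) = wt σ ξ := by simp [wt]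

theorem conj_wt (σ ξ : ℝ) : starRingEnd ℂ (wt σ ξ) = wt σ ξ := Complex.conj_ofReal _

theorem norm_wt_le_norm_wt {σ τ : ℝ} (h : σ ≤ τ) (ξ : ℝ) : ‖wt σ ξ‖ ≤ ‖wt τ ξ‖ := by
  rw [norm_wt, norm_wt]
  exact Real.rpow_le_rpow_of_exponent_le (by nlinarith [sq_nonneg ‖ξ‖]) (by linarith)

theorem norm_wt_le_one {σ : ℝ} (h : σ ≤ 0) (ξ : ℝ) : ‖wt σ ξ‖ ≤ 1 := by
  have := norm_wt_le_norm_wt h ξ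
  rwa [wt_zero, norm_one] at this

theorem continuous_wt (σ : ℝ) : Continuous (wt σ) := by
  unfold wt
  refine Complex.continuous_ofReal.comp (Continuous.rpow_const (by fun_prop) fun ξ => Or.inl ?_)
  positivity

theorem measurable_wt (σ : ℝ) : Measurable (wt σ) := (continuous_wt σ).measurable

theorem isMult_wt {σ : ℝ} (h : σ ≤ 0) : IsMult (wt σ) := ⟨measurable_wt σ, 1, norm_wt_le_one h⟩

theorem one_le_om (ξ : ℝ) : 1 ≤ om ξ := by
  rw [om, Real.one_le_sqrt]; nlinarith [sq_nonneg (2 * Real.pi * ξ)]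

theorem om_pos (ξ : ℝ) : 0 < om ξ := zero_lt_one.trans_le (one_le_om ξ)

theorem om_ne_zero (ξ : ℝ) : (om ξ : ℂ) ≠ 0 := Complex.ofReal_ne_zero.2 (om_pos ξ).ne'

theorem om_sq (ξ : ℝ) : om ξ ^ 2 = 1 + (2 * Real.pi * ξ) ^ 2 := Real.sq_sqrt (by positivity)

theorem om_neg (ξ : ℝ) : om (-ξ) = om ξ := by simp [om]

theorem norm_om (ξ : ℝ) : ‖(om ξ : ℂ)‖ = om ξ := by
  rw [Complex.norm_real, Real.norm_of_nonneg (om_pos ξ).le]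

theorem continuous_om : Continuous om := by unfold om; fun_prop

theorem measurable_om : Measurable fun ξ => (om ξ : ℂ) :=
  (Complex.continuous_ofReal.comp continuous_om).measurable

theorem norm_wt_one (ξ : ℝ) : ‖wt 1 ξ‖ = √(1 + ξ ^ 2) := by
  rw [norm_wt, Real.sqrt_eq_rpow, Real.norm_eq_abs, sq_abs]

theorem norm_wt_one_le_om (ξ : ℝ) : ‖wt 1 ξ‖ ≤ om ξ := by
  rw [norm_wt_one, om]
  refine Real.sqrt_le_sqrt ?_
  have h : 1 ≤ 2 * Real.pi := by linarith [Real.pi_gt_three]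
  have : ξ ^ 2 ≤ (2 * Real.pi * ξ) ^ 2 := by
    rw [mul_pow]; nlinarith [sq_nonneg ξ, one_le_pow₀ h (n := 2)]
  linarith

theorem om_le_norm_wt_one (ξ : ℝ) : om ξ ≤ 2 * Real.pi * ‖wt 1 ξ‖ := by
  rw [norm_wt_one, om]
  have h : 1 ≤ 2 * Real.pi := by linarith [Real.pi_gt_three]
  refine Real.sqrt_le_iff.2 ⟨by positivity, ?_⟩
  rw [mul_pow _ √_, Real.sq_sqrt (by positivity), mul_pow]
  nlinarith [one_le_pow₀ h (n := 2)]

theorem isMult_wt_mul_om {σ : ℝ} (h : σ ≤ -1) : IsMult fun ξ => wt σ ξ * (om ξ : ℂ) := by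
  refine ⟨(measurable_wt σ).mul measurable_om, 2 * Real.pi, fun ξ => ?_⟩
  rw [norm_mul, norm_om]
  calc ‖wt σ ξ‖ * om ξ ≤ ‖wt (-1) ξ‖ * (2 * Real.pi * ‖wt 1 ξ‖) :=
        mul_le_mul (norm_wt_le_norm_wt h ξ) (om_le_norm_wt_one ξ) (om_pos ξ).le (norm_nonneg _)
    _ = 2 * Real.pi * ‖wt (-1) ξ * wt 1 ξ‖ := by rw [norm_mul]; ring
    _ = 2 * Real.pi := by rw [wt_neg_mul, norm_one, mul_one]

theorem isMult_wt_div_om {σ : ℝ} (h : σ ≤ 1) : IsMult fun ξ => wt σ ξ / (om ξ : ℂ) := by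
  refine ⟨(measurable_wt σ).div measurable_om, 1, fun ξ => ?_⟩
  rw [norm_div, norm_om, div_le_one (om_pos ξ)]
  exact (norm_wt_le_norm_wt h ξ).trans (norm_wt_one_le_om ξ)

theorem isMult_inv_om : IsMult fun ξ => 1 / (om ξ : ℂ) := by
  have := isMult_wt_div_om (σ := 0) zero_le_one
  simpa only [wt_zero] using this

/-- The symbol `2πiξ / ω(ξ)` of `∂ₓ (1 - ∂ₓ²)^(-1/2)`. -/
def rz (ξ : ℝ) : ℂ := (2 * Real.pi * ξ : ℝ) * Complex.I / om ξ

theorem norm_rz_le (ξ : ℝ) : ‖rz ξ‖ ≤ 1 := by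
  rw [rz, norm_div, norm_om, div_le_one (om_pos ξ), norm_mul, Complex.norm_I, mul_one,
    Complex.norm_real, Real.norm_eq_abs, om]
  exact Real.abs_le_sqrt (by linarith)

theorem isMult_rz : IsMult rz := by
  refine ⟨?_, 1, norm_rz_le⟩
  unfold rz
  exact ((Complex.continuous_ofReal.comp (by fun_prop)).measurable.mul_const _).div measurable_om

theorem conj_rz (ξ : ℝ) : starRingEnd ℂ (rz ξ) = -rz ξ := by
  rw [rz, map_div₀, map_mul, Complex.conj_ofReal, Complex.conj_ofReal, Complex.conj_I, mul_neg,
    neg_div]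

theorem rz_neg (ξ : ℝ) : rz (-ξ) = -rz ξ := by
  simp [rz, om_neg, neg_div]

end Weights

/-! ### The half-wave group -/

section Group

open Filter Topology

/-- The symbol `exp(itω(ξ))`. -/
def ph (t ξ : ℝ) : ℂ := Complex.exp ((t * om ξ : ℝ) * Complex.I)

theorem norm_ph (t ξ : ℝ) : ‖ph t ξ‖ = 1 := Complex.norm_exp_ofReal_mul_I _

theorem continuous_ph (ξ : ℝ) : Continuous fun t => ph t ξ := by unfold ph; fun_prop

theorem isMult_ph (t : ℝ) : IsMult (ph t) := by
  refine ⟨?_, 1, fun ξ => (norm_ph t ξ).le⟩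
  have := continuous_om
  unfold ph
  fun_prop

theorem ph_zero (ξ : ℝ) : ph 0 ξ = 1 := by simp [ph]

theorem ph_add (s t ξ : ℝ) : ph (s + t) ξ = ph s ξ * ph t ξ := by
  rw [ph, ph, ph, ← Complex.exp_add]; congr 1; push_cast; ring

theorem conj_ph (t ξ : ℝ) : starRingEnd ℂ (ph t ξ) = ph (-t) ξ := by
  rw [ph, ph, ← Complex.exp_conj]; simp

theorem ph_neg_arg (t ξ : ℝ) : ph t (-ξ) = ph t ξ := by rw [ph, ph, om_neg]

theorem hasDerivAt_ph (t ξ : ℝ) :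
    HasDerivAt (fun τ => ph τ ξ) (Complex.I * om ξ * ph t ξ) t := by
  unfold ph
  have h : HasDerivAt (fun τ : ℝ => ((τ * om ξ : ℝ) : ℂ) * Complex.I) ((om ξ : ℂ) * Complex.I) t := by
    have := ((hasDerivAt_id t).mul_const (om ξ)).ofReal_comp.mul_const Complex.I
    simpa using this
  convert h.cexp using 1
  ring

/-- The unitary group `exp(it(1 - ∂ₓ²)^(1/2))` on the Fourier side. -/
def grp (t : ℝ) : L2C →L[ℂ] L2C := mulOp (ph t)

theorem norm_grp (t : ℝ) (f : L2C) : ‖grp t f‖ = ‖f‖ := norm_mulOp_eq (isMult_ph t) (norm_ph t) f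

theorem grp_zero (f : L2C) : grp 0 f = f := by
  rw [grp, mulOp_eq_smul 1 ph_zero, one_smul]

theorem grp_grp (s t : ℝ) (f : L2C) : grp s (grp t f) = grp (s + t) f := by
  rw [grp, grp, grp, mulOp_mulOp (isMult_ph s) (isMult_ph t)]
  congr 2; exact funext fun ξ => (ph_add s t ξ).symm

theorem grp_neg_grp (t : ℝ) (f : L2C) : grp (-t) (grp t f) = f := by
  rw [grp_grp, neg_add_cancel, grp_zero]

theorem grp_grp_neg (t : ℝ) (f : L2C) : grp t (grp (-t) f) = f := by
  rw [grp_grp, add_neg_cancel, grp_zero]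

theorem inner_grp (t : ℝ) (f g : L2C) : inner ℂ (grp t f) g = inner ℂ f (grp (-t) g) := by
  rw [grp, inner_mulOp (isMult_ph t), grp]
  congr 3; exact funext fun ξ => conj_ph t ξ

theorem continuous_grp_apply (f : L2C) : Continuous fun t => grp t f := by
  rw [continuous_iff_continuousAt]
  intro t
  exact tendsto_mulOp (C := 1) isMult_ph (isMult_ph t) (fun i ξ => (norm_ph i ξ).le)
    (fun ξ => (norm_ph t ξ).le) (fun ξ => (continuous_ph ξ).continuousAt) f

theorem tendsto_grp {ι : Type*} {l : Filter ι} {τ : ι → ℝ} {t : ℝ} {f : ι → L2C} {f₀ : L2C}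
    (hτ : Tendsto τ l (𝓝 t)) (hf : Tendsto f l (𝓝 f₀)) :
    Tendsto (fun i => grp (τ i) (f i)) l (𝓝 (grp t f₀)) := by
  have h1 : Tendsto (fun i => grp (τ i) (f i - f₀)) l (𝓝 0) := by
    rw [tendsto_zero_iff_norm_tendsto_zero]
    simp_rw [norm_grp]
    have := (hf.sub_const f₀).norm
    simpa using this
  have h2 := ((continuous_grp_apply f₀).tendsto t).comp hτ
  have := h1.add h2
  simpa [Function.comp_def, map_sub] using this

theorem continuousOn_grp {I : Set ℝ} {f : ℝ → L2C} {θ : ℝ → ℝ} (hθ : Continuous θ)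
    (hf : ContinuousOn f I) : ContinuousOn (fun t => grp (θ t) (f t)) I := fun t ht =>
  tendsto_grp (hθ.continuousWithinAt) (hf t ht)

/-- On the range of a multiplier of order `-1` the group is strongly differentiable. -/
theorem hasDerivAt_grp_mulOp {n : ℝ → ℂ} (hn : IsMult n) (hn' : IsMult fun ξ => om ξ * n ξ)
    (f : L2C) (t : ℝ) :
    HasDerivAt (fun τ => grp τ (mulOp n f))
      (Complex.I • grp t (mulOp (fun ξ => om ξ * n ξ) f)) t := by
  rw [hasDerivAt_iff_tendsto_slope]
  obtain ⟨C, hC⟩ := hn'.2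
  have e0 : Complex.I • grp t (mulOp (fun ξ => om ξ * n ξ) f)
      = mulOp (fun ξ => Complex.I * (ph t ξ * (om ξ * n ξ))) f := by
    rw [grp, mulOp_mulOp (isMult_ph t) hn']
    exact (mulOp_smul_symbol ((isMult_ph t).mul hn') Complex.I (fun ξ => rfl) f).symm
  have hm : ∀ τ, IsMult fun ξ => ((τ - t)⁻¹ : ℝ) * ((ph τ ξ - ph t ξ) * n ξ) := fun τ => by
    refine (IsMult.const _).mul (IsMult.mul ?_ hn)
    exact ⟨(isMult_ph τ).1.sub (isMult_ph t).1, 2, fun ξ => (norm_sub_le _ _).trans (by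
      rw [norm_ph, norm_ph]; norm_num)⟩
  have e1 : ∀ τ, slope (fun τ => grp τ (mulOp n f)) t τ
      = mulOp (fun ξ => ((τ - t)⁻¹ : ℝ) * ((ph τ ξ - ph t ξ) * n ξ)) f := fun τ => by
    rw [slope_def_module, eq_comm, mulOp_eq_iff (hm τ), grp, grp, mulOp_mulOp (isMult_ph τ) hn,
      mulOp_mulOp (isMult_ph t) hn]
    filter_upwards [Lp.coeFn_smul ((τ - t)⁻¹) (mulOp (fun ξ => ph τ ξ * n ξ) f -
        mulOp (fun ξ => ph t ξ * n ξ) f), Lp.coeFn_sub (mulOp (fun ξ => ph τ ξ * n ξ) f)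
        (mulOp (fun ξ => ph t ξ * n ξ) f), coeFn_mulOp ((isMult_ph τ).mul hn) f,
        coeFn_mulOp ((isMult_ph t).mul hn) f] with ξ h1 h2 h3 h4
    rw [h1, Pi.smul_apply, h2, Pi.sub_apply, h3, h4, Complex.real_smul]
    ring
  rw [e0]
  simp_rw [funext e1]
  refine tendsto_mulOp (C := C) hm ?_ ?_ ?_ ?_ f
  · exact (IsMult.const _).mul ((isMult_ph t).mul hn')
  · intro τ ξ
    have h1 : ‖ph τ ξ - ph t ξ‖ ≤ om ξ * |τ - t| := by
      have h := Convex.norm_image_sub_le_of_norm_hasDerivWithin_le (s := univ)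
        (f := fun τ => ph τ ξ) (f' := fun t => Complex.I * om ξ * ph t ξ) (C := om ξ)
        (fun x _ => (hasDerivAt_ph x ξ).hasDerivWithinAt)
        (fun x _ => by rw [norm_mul, norm_mul, Complex.norm_I, norm_ph, norm_om]; simp)
        convex_univ (mem_univ t) (mem_univ τ)
      simpa using h
    calc ‖(((τ - t)⁻¹ : ℝ) : ℂ) * ((ph τ ξ - ph t ξ) * n ξ)‖
        = |τ - t|⁻¹ * (‖ph τ ξ - ph t ξ‖ * ‖n ξ‖) := by
          rw [norm_mul, norm_mul, Complex.norm_real, Real.norm_eq_abs, abs_inv]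
      _ ≤ |τ - t|⁻¹ * ((om ξ * |τ - t|) * ‖n ξ‖) := by gcongr
      _ = (|τ - t|⁻¹ * |τ - t|) * ‖om ξ * n ξ‖ := by rw [norm_mul, norm_om]; ring
      _ ≤ 1 * ‖om ξ * n ξ‖ := by
          gcongr
          rcases eq_or_ne |τ - t| 0 with h | h
          · simp [h]
          · rw [inv_mul_cancel₀ h]
      _ ≤ C := by rw [one_mul]; exact hC ξ
  · intro ξ
    rw [norm_mul, norm_mul, Complex.norm_I, norm_ph, one_mul, one_mul]; exact hC ξ
  · intro ξ
    have := ((hasDerivAt_iff_tendsto_slope.1 (hasDerivAt_ph t ξ)).mul_const (n ξ))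
    convert this using 2
    · rw [slope_def_module, Complex.real_smul, mul_assoc]
    · ring

/-- Product rule for the group applied to a differentiable curve, at a time where the curve takes a
value in the domain of the generator. -/
theorem hasDerivWithinAt_grp {n : ℝ → ℂ} (hn : IsMult n) (hn' : IsMult fun ξ => om ξ * n ξ)
    (ε : ℝ) {h : ℝ → L2C} {h' f : L2C} {I : Set ℝ} {t : ℝ} (hh : HasDerivWithinAt h h' I t)
    (hf : h t = mulOp n f) :
    HasDerivWithinAt (fun τ => grp (ε * τ) (h τ))
      (grp (ε * t) h' + (ε * Complex.I) • grp (ε * t) (mulOp (fun ξ => om ξ * n ξ) f)) I t := by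
  have h2 : HasDerivWithinAt (fun τ => grp (ε * τ) (h t))
      ((ε * Complex.I) • grp (ε * t) (mulOp (fun ξ => om ξ * n ξ) f)) I t := by
    rw [hf]
    have := (hasDerivAt_grp_mulOp hn hn' f (ε * t)).scomp t ((hasDerivAt_id t).const_mul ε)
    rw [mul_one] at this
    rw [mul_smul, coe_smul_eq]
    exact this.hasDerivWithinAt
  rw [hasDerivWithinAt_iff_tendsto_slope] at hh h2 ⊢
  have hτ : Tendsto (fun τ => ε * τ) (𝓝[I \ {t}] t) (𝓝 (ε * t)) :=
    ((continuous_const.mul continuous_id).tendsto t).mono_left nhdsWithin_le_nhds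
  have := (tendsto_grp hτ hh).add h2
  refine this.congr fun τ => ?_
  simp only [slope_def_module]
  rw [ContinuousLinearMap.map_smul_of_tower, ← smul_add, map_sub, sub_add_sub_cancel]

end Group

/-! ### The reflection that encodes reality -/

section Reflection

/-- `(R f)(ξ) = conj (f (-ξ))`. A function is real-valued iff its Fourier transform is fixed
by `R`. -/
def refl : L2C →L[ℝ] L2C :=
  (ContinuousLinearMap.compLpL 2 volume (Complex.conjCLE : ℂ →L[ℝ] ℂ)).comp
    (Lp.compMeasurePreservingₗᵢ ℝ (fun ξ : ℝ => -ξ)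
      (Measure.measurePreserving_neg volume)).toContinuousLinearMap

theorem coeFn_refl (f : L2C) : refl f =ᵐ[volume] fun ξ => starRingEnd ℂ (f (-ξ)) := by
  have h1 := ContinuousLinearMap.coeFn_compLpL (p := 2) (μ := volume) (Complex.conjCLE : ℂ →L[ℝ] ℂ)
    (Lp.compMeasurePreserving (fun ξ : ℝ => -ξ) (Measure.measurePreserving_neg volume) f)
  have h2 := Lp.coeFn_compMeasurePreserving f (Measure.measurePreserving_neg (volume : Measure ℝ))
  filter_upwards [h1, h2] with ξ h1 h2
  refine h1.trans ?_
  rw [h2]; rfl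

theorem ae_neg {p : ℝ → Prop} (h : ∀ᵐ ξ, p ξ) : ∀ᵐ ξ : ℝ, p (-ξ) :=
  (Measure.measurePreserving_neg (volume : Measure ℝ)).quasiMeasurePreserving.ae h

theorem refl_mulOp {m : ℝ → ℂ} (hm : IsMult m) {n : ℝ → ℂ} (hn : IsMult n)
    (h : ∀ ξ, starRingEnd ℂ (m (-ξ)) = n ξ) (f : L2C) :
    refl (mulOp m f) = mulOp n (refl f) := by
  rw [eq_comm, mulOp_eq_iff hn]
  filter_upwards [coeFn_refl (mulOp m f), ae_neg (coeFn_mulOp hm f), coeFn_refl f] with ξ h1 h2 h3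
  rw [h1, h2, map_mul, h, h3]

theorem refl_smul (c : ℂ) (f : L2C) : refl (c • f) = starRingEnd ℂ c • refl f := by
  rw [← mulOp_eq_smul (m := fun _ => c) c (fun _ => rfl),
    ← mulOp_eq_smul (m := fun _ => starRingEnd ℂ c) _ (fun _ => rfl)]
  exact refl_mulOp (IsMult.const _) (IsMult.const _) (fun _ => rfl) f

theorem refl_grp (t : ℝ) (f : L2C) : refl (grp t f) = grp (-t) (refl f) :=
  refl_mulOp (isMult_ph t) (isMult_ph (-t)) (fun ξ => by rw [ph_neg_arg, conj_ph]) f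

end Reflection

/-! ### Convolution -/

section Convolution

open scoped ENNReal

/-- Young's inequality `L¹ * L² ⊆ L²` for nonnegative functions. -/
theorem lintegral_conv_sq_le {f g : ℝ → ℝ≥0∞} (hf : Measurable f) (hg : Measurable g) :
    ∫⁻ ξ, (∫⁻ η, f (ξ - η) * g η) ^ (2 : ℝ)
      ≤ (∫⁻ η, f η) ^ (2 : ℝ) * ∫⁻ η, g η ^ (2 : ℝ) := by
  have hfm : ∀ ξ : ℝ, Measurable fun η => f (ξ - η) := fun ξ => by fun_prop
  have hsub : ∀ ξ : ℝ, ∫⁻ η, f (ξ - η) = ∫⁻ η, f η := fun ξ =>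
    lintegral_sub_left_eq_self f ξ
  have hsub' : ∀ η : ℝ, ∫⁻ ξ, f (ξ - η) = ∫⁻ ξ, f ξ := fun η =>
    lintegral_sub_right_eq_self f η
  -- Cauchy-Schwarz with respect to the measure `f (ξ - η) dη`
  have h1 : ∀ ξ, (∫⁻ η, f (ξ - η) * g η) ^ (2 : ℝ)
      ≤ (∫⁻ η, f η) * ∫⁻ η, f (ξ - η) * g η ^ (2 : ℝ) := fun ξ => by
    have hCS := ENNReal.lintegral_mul_le_Lp_mul_Lq volume Real.HolderConjugate.two_two
      ((hfm ξ).pow_const (1 / 2 : ℝ)).aemeasurable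
      (((hfm ξ).pow_const (1 / 2 : ℝ)).mul hg).aemeasurable
    have e1 : ∀ η, (f (ξ - η) ^ (1 / 2 : ℝ)) * (f (ξ - η) ^ (1 / 2 : ℝ) * g η)
        = f (ξ - η) * g η := fun η => by
      rw [← mul_assoc, ← ENNReal.rpow_add_of_nonneg _ _ (by norm_num) (by norm_num)]
      norm_num
    have e2 : ∀ η, (f (ξ - η) ^ (1 / 2 : ℝ)) ^ (2 : ℝ) = f (ξ - η) := fun η => by
      rw [← ENNReal.rpow_mul]; norm_num
    simp only [Pi.mul_apply] at hCS
    simp only [e1, ENNReal.mul_rpow_of_nonneg _ _ (show (0 : ℝ) ≤ 2 by norm_num), e2, hsub] at hCS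
    refine (ENNReal.rpow_le_rpow hCS (by norm_num : (0 : ℝ) ≤ 2)).trans_eq ?_
    rw [ENNReal.mul_rpow_of_nonneg _ _ (by norm_num), ← ENNReal.rpow_mul, ← ENNReal.rpow_mul]
    norm_num
  calc ∫⁻ ξ, (∫⁻ η, f (ξ - η) * g η) ^ (2 : ℝ)
      ≤ ∫⁻ ξ, (∫⁻ η, f η) * ∫⁻ η, f (ξ - η) * g η ^ (2 : ℝ) := lintegral_mono h1
    _ = (∫⁻ η, f η) * ∫⁻ ξ, ∫⁻ η, f (ξ - η) * g η ^ (2 : ℝ) := by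
        rw [lintegral_const_mul]
        exact Measurable.lintegral_prod_right (by fun_prop)
    _ = (∫⁻ η, f η) * ∫⁻ η, ∫⁻ ξ, f (ξ - η) * g η ^ (2 : ℝ) := by
        rw [lintegral_lintegral_swap]
        exact Measurable.aemeasurable (by fun_prop)
    _ = (∫⁻ η, f η) * ∫⁻ η, (∫⁻ ξ, f ξ) * g η ^ (2 : ℝ) := by
        congr 1
        refine lintegral_congr fun η => ?_
        rw [lintegral_mul_const _ (by fun_prop), hsub']
    _ = _ := by
        rw [lintegral_const_mul _ (hg.pow_const _), ← mul_assoc]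
        congr 1
        rw [ENNReal.rpow_two, sq]

/-- Young's inequality `L¹ * L¹ ⊆ L¹` for nonnegative functions. -/
theorem lintegral_conv_eq {f g : ℝ → ℝ≥0∞} (hf : Measurable f) (hg : Measurable g) :
    ∫⁻ ξ, ∫⁻ η, f (ξ - η) * g η = (∫⁻ η, f η) * ∫⁻ η, g η := by
  rw [lintegral_lintegral_swap (Measurable.aemeasurable (by fun_prop)),
    ← lintegral_const_mul _ hg]
  refine lintegral_congr fun η => ?_
  rw [lintegral_mul_const _ (by fun_prop), lintegral_sub_right_eq_self f η]

/-- The convolution of two functions on the line. -/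
def conv (f g : ℝ → ℂ) (ξ : ℝ) : ℂ := ∫ η, f (ξ - η) * g η

theorem ae_sub_left {p : ℝ → Prop} (h : ∀ᵐ ξ, p ξ) (ξ : ℝ) : ∀ᵐ η : ℝ, p (ξ - η) :=
  (Measure.measurePreserving_sub_left (volume : Measure ℝ) ξ).quasiMeasurePreserving.ae h

theorem conv_congr {f f' g g' : ℝ → ℂ} (hf : f =ᵐ[volume] f') (hg : g =ᵐ[volume] g') :
    conv f g = conv f' g' := by
  funext ξ
  refine integral_congr_ae ?_
  filter_upwards [ae_sub_left hf ξ, hg] with η h1 h2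
  rw [h1, h2]

theorem conv_comm (f g : ℝ → ℂ) : conv f g = conv g f := by
  funext ξ
  rw [conv, ← integral_sub_left_eq_self _ volume ξ, conv]
  refine integral_congr_ae (ae_of_all _ fun η => ?_)
  simp only [sub_sub_cancel, mul_comm]

theorem integrable_conv (f g : L2C) (ξ : ℝ) : Integrable fun η => f (ξ - η) * g η :=
  ((Lp.memLp f).comp_measurePreserving (Measure.measurePreserving_sub_left volume ξ)).integrable_mul
    (Lp.memLp g)

theorem conv_add_left (f f' g : L2C) : conv ⇑(f + f') g = fun ξ => conv f g ξ + conv f' g ξ := by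
  funext ξ
  rw [conv, conv, conv, ← integral_add (integrable_conv f g ξ) (integrable_conv f' g ξ)]
  refine integral_congr_ae ?_
  filter_upwards [ae_sub_left (Lp.coeFn_add f f') ξ] with η h
  rw [h, Pi.add_apply, add_mul]

theorem conv_smul_left (c : ℂ) (f g : L2C) : conv ⇑(c • f) g = fun ξ => c * conv f g ξ := by
  funext ξ
  rw [conv, conv, ← integral_const_mul]
  refine integral_congr_ae ?_
  filter_upwards [ae_sub_left (Lp.coeFn_smul c f) ξ] with η h
  rw [h, Pi.smul_apply, smul_eq_mul, mul_assoc]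

theorem conv_add_right (f g g' : L2C) :
    conv f ⇑(g + g') = fun ξ => conv f g ξ + conv f g' ξ := by
  rw [conv_comm, conv_add_left, conv_comm g, conv_comm g']

theorem conv_smul_right (c : ℂ) (f g : L2C) : conv f ⇑(c • g) = fun ξ => c * conv f g ξ := by
  rw [conv_comm, conv_smul_left, conv_comm g]

theorem stronglyMeasurable_conv (f g : L2C) : StronglyMeasurable (conv f g) := by
  have hf := (Lp.stronglyMeasurable f).measurable
  have hg := (Lp.stronglyMeasurable g).measurable
  have : StronglyMeasurable fun p : ℝ × ℝ => f (p.1 - p.2) * g p.2 :=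
    Measurable.stronglyMeasurable (by fun_prop)
  exact this.integral_prod_right

theorem enorm_conv_le (f g : ℝ → ℂ) (ξ : ℝ) :
    ‖conv f g ξ‖ₑ ≤ ∫⁻ η, ‖f (ξ - η)‖ₑ * ‖g η‖ₑ := by
  refine (enorm_integral_le_lintegral_enorm _).trans_eq ?_
  simp_rw [enorm_mul]

theorem norm_conv_le (f g : L2C) (ξ : ℝ) : ‖conv f g ξ‖ ≤ ‖f‖ * ‖g‖ := by
  have h := enorm_conv_le f g ξ
  have hf := (Lp.stronglyMeasurable f).measurable
  have hg := (Lp.stronglyMeasurable g).measurable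
  have hCS := ENNReal.lintegral_mul_le_Lp_mul_Lq volume Real.HolderConjugate.two_two
    (f := fun η => ‖f (ξ - η)‖ₑ) (g := fun η => ‖g η‖ₑ)
    (Measurable.aemeasurable (by fun_prop)) (Measurable.aemeasurable (by fun_prop))
  rw [lintegral_sub_left_eq_self (fun η => ‖f η‖ₑ ^ (2 : ℝ)) ξ] at hCS
  have e : ∀ k : L2C, (∫⁻ η, ‖k η‖ₑ ^ (2 : ℝ)) ^ (1 / 2 : ℝ) = ENNReal.ofReal ‖k‖ := fun k => by
    rw [Lp.norm_def, ENNReal.ofReal_toReal (Lp.eLpNorm_ne_top k),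
      eLpNorm_eq_lintegral_rpow_enorm_toReal (by norm_num) (by norm_num)]
    simp
  rw [e, e, ← ENNReal.ofReal_mul (norm_nonneg _)] at hCS
  have := h.trans hCS
  rw [← ofReal_norm, ENNReal.ofReal_le_ofReal_iff (by positivity)] at this
  exact this

theorem eLpNorm_two_eq (f : ℝ → ℂ) :
    eLpNorm f 2 volume = (∫⁻ η, ‖f η‖ₑ ^ (2 : ℝ)) ^ (1 / 2 : ℝ) := by
  rw [eLpNorm_eq_lintegral_rpow_enorm_toReal (by norm_num) (by norm_num)]
  simp

/-- Young's inequality `L¹ * L² ⊆ L²` with a majorant in place of the convolution. -/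
theorem eLpNorm_le_of_enorm_le_conv {f g : ℝ → ℂ} (hf : Measurable f) (hg : Measurable g)
    {h : ℝ → ℂ} (hh : ∀ ξ, ‖h ξ‖ₑ ≤ ∫⁻ η, ‖f (ξ - η)‖ₑ * ‖g η‖ₑ) :
    eLpNorm h 2 volume ≤ eLpNorm f 1 volume * eLpNorm g 2 volume := by
  rw [eLpNorm_two_eq, eLpNorm_two_eq, eLpNorm_one_eq_lintegral_enorm]
  have h1 : ∫⁻ ξ, ‖h ξ‖ₑ ^ (2 : ℝ) ≤ (∫⁻ η, ‖f η‖ₑ) ^ (2 : ℝ) * ∫⁻ η, ‖g η‖ₑ ^ (2 : ℝ) :=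
    (lintegral_mono fun ξ => ENNReal.rpow_le_rpow (hh ξ) (by norm_num)).trans
      (lintegral_conv_sq_le (f := fun η => ‖f η‖ₑ) (g := fun η => ‖g η‖ₑ)
        hf.enorm hg.enorm)
  refine (ENNReal.rpow_le_rpow h1 (by norm_num)).trans_eq ?_
  rw [ENNReal.mul_rpow_of_nonneg _ _ (by norm_num), ← ENNReal.rpow_mul]
  norm_num

theorem eLpNorm_conv_le (f g : L2C) :
    eLpNorm (conv f g) 2 volume ≤ eLpNorm f 1 volume * eLpNorm g 2 volume :=
  eLpNorm_le_of_enorm_le_conv (Lp.stronglyMeasurable f).measurable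
    (Lp.stronglyMeasurable g).measurable (enorm_conv_le f g)

theorem eLpNorm_one_conv_le (f g : L2C) :
    eLpNorm (conv f g) 1 volume ≤ eLpNorm f 1 volume * eLpNorm g 1 volume := by
  simp_rw [eLpNorm_one_eq_lintegral_enorm]
  refine (lintegral_mono (enorm_conv_le f g)).trans_eq ?_
  exact lintegral_conv_eq (Lp.stronglyMeasurable f).measurable.enorm
    (Lp.stronglyMeasurable g).measurable.enorm

theorem conv_refl (f g : L2C) : conv (refl f) (refl g) = fun ξ => starRingEnd ℂ (conv f g (-ξ)) := by
  funext ξ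
  rw [conv, conv, ← integral_conj, ← integral_neg_eq_self]
  refine integral_congr_ae ?_
  filter_upwards [ae_neg (ae_sub_left (coeFn_refl f) ξ), ae_neg (coeFn_refl g)] with η h1 h2
  rw [h1, h2, ← map_mul]
  congr 3
  · ring
  · ring

/-- Convolution with the Fourier transform of a real-valued function is symmetric. -/
theorem integral_conj_mul_conv {f : L2C} (hf : refl f = f) (hf1 : eLpNorm f 1 volume ≠ ∞)
    (g h : L2C) :
    ∫ ξ, starRingEnd ℂ (h ξ) * conv f g ξ = ∫ ξ, starRingEnd ℂ (conv f h ξ) * g ξ := by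
  have hfm := (Lp.stronglyMeasurable f).measurable
  have hgm := (Lp.stronglyMeasurable g).measurable
  have hhm := (Lp.stronglyMeasurable h).measurable
  have hcm := Complex.continuous_conj.measurable
  have hint : Integrable (Function.uncurry fun ξ η : ℝ =>
      starRingEnd ℂ (h ξ) * (f (ξ - η) * g η)) (volume.prod volume) := by
    refine ⟨Measurable.aestronglyMeasurable (by unfold Function.uncurry; fun_prop), ?_⟩
    rw [HasFiniteIntegral, lintegral_prod _ (Measurable.aemeasurable (by
      unfold Function.uncurry; fun_prop))]
    simp only [Function.uncurry_apply_pair, enorm_mul, RCLike.enorm_conj]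
    have h1 : ∀ ξ, ∫⁻ η, ‖h ξ‖ₑ * (‖f (ξ - η)‖ₑ * ‖g η‖ₑ)
        = ‖h ξ‖ₑ * ∫⁻ η, ‖f (ξ - η)‖ₑ * ‖g η‖ₑ := fun ξ =>
      lintegral_const_mul _ (by fun_prop)
    simp_rw [h1]
    have hm2 : Measurable fun ξ => ∫⁻ η, ‖f (ξ - η)‖ₑ * ‖g η‖ₑ :=
      Measurable.lintegral_prod_right (by fun_prop)
    refine (ENNReal.lintegral_mul_le_Lp_mul_Lq volume Real.HolderConjugate.two_two
      (f := fun ξ => ‖h ξ‖ₑ) (g := fun ξ => ∫⁻ η, ‖f (ξ - η)‖ₑ * ‖g η‖ₑ)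
      hhm.enorm.aemeasurable hm2.aemeasurable).trans_lt ?_
    rw [← eLpNorm_two_eq]
    refine ENNReal.mul_lt_top (Lp.eLpNorm_lt_top h) ?_
    refine ENNReal.rpow_lt_top_of_nonneg (by norm_num) (ne_top_of_le_ne_top ?_
      (lintegral_conv_sq_le hfm.enorm hgm.enorm))
    have hg2 := (lintegral_rpow_enorm_lt_top_of_eLpNorm_lt_top (p := 2) (by norm_num) (by norm_num)
        (Lp.memLp g).2).ne
    simp only [ENNReal.toReal_ofNat] at hg2
    rw [eLpNorm_one_eq_lintegral_enorm] at hf1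
    exact ENNReal.mul_ne_top (by finiteness) hg2
  calc ∫ ξ, starRingEnd ℂ (h ξ) * conv f g ξ
      = ∫ ξ, ∫ η, starRingEnd ℂ (h ξ) * (f (ξ - η) * g η) := by
        simp_rw [conv, integral_const_mul]
    _ = ∫ η, ∫ ξ, starRingEnd ℂ (h ξ) * (f (ξ - η) * g η) := integral_integral_swap hint
    _ = ∫ η, starRingEnd ℂ (conv f h η) * g η := by
        congr 1; funext η
        rw [conv, ← integral_conj, ← integral_mul_const]
        refine integral_congr_ae ?_
        have h1 : ∀ᵐ ξ, f ξ = starRingEnd ℂ (f (-ξ)) := by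
          have := coeFn_refl f
          rwa [hf] at this
        filter_upwards [ae_sub_left h1 η] with ξ h1
        rw [h1, map_mul, Complex.conj_conj, neg_sub]
        ring

end Convolution

/-! ### The algebra `H^r` on the Fourier side -/

section Products

open scoped ENNReal

/-- The space `L¹(ℝ; ℂ)`. -/
abbrev L1C : Type := Lp ℂ 1 (volume : Measure ℝ)

variable {r : ℝ}

theorem memLp_wt (hr : 1 / 2 < r) : MemLp (wt (-r)) 2 volume := by
  refine ⟨(measurable_wt _).aestronglyMeasurable, ?_⟩
  rw [eLpNorm_two_eq]
  refine ENNReal.rpow_lt_top_of_nonneg (by norm_num) (ne_of_lt ?_)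
  have hi := integrable_rpow_neg_one_add_norm_sq (E := ℝ) (μ := volume) (r := 2 * r)
    (by simpa using by linarith)
  refine lt_of_eq_of_lt (lintegral_congr fun ξ => ?_) hi.lintegral_lt_top
  rw [← ofReal_norm, norm_wt, ENNReal.ofReal_rpow_of_nonneg (by positivity) (by norm_num),
    ← Real.rpow_mul (by positivity)]
  congr 2
  ring

/-- The `L²` norm of the weight `(1 + ξ²)^(-r/2)`. -/
def wtNorm (r : ℝ) : ℝ := (eLpNorm (wt (-r)) 2 volume).toReal

theorem wtNorm_nonneg (r : ℝ) : 0 ≤ wtNorm r := ENNReal.toReal_nonneg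

theorem eLpNorm_one_wt_mul_le (hr : 1 / 2 < r) (F : L2C) :
    eLpNorm (fun ξ => wt (-r) ξ * F ξ) 1 volume ≤ ENNReal.ofReal (wtNorm r * ‖F‖) := by
  have h := eLpNorm_smul_le_mul_eLpNorm (p := 2) (q := 2) (r := 1) (Lp.aestronglyMeasurable F)
    (memLp_wt hr).1
  rw [ENNReal.ofReal_mul (wtNorm_nonneg r), wtNorm, ENNReal.ofReal_toReal (memLp_wt hr).2.ne,
    Lp.norm_def, ENNReal.ofReal_toReal (Lp.eLpNorm_ne_top F)]
  exact h

theorem memLp_one_wt_mul (hr : 1 / 2 < r) (F : L2C) :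
    MemLp (fun ξ => wt (-r) ξ * F ξ) 1 volume :=
  ⟨(measurable_wt _).aestronglyMeasurable.mul (Lp.aestronglyMeasurable F),
    (eLpNorm_one_wt_mul_le hr F).trans_lt ENNReal.ofReal_lt_top⟩

/-- The embedding `H^r → 𝓕 L¹`, `r > 1/2`: the image of the representative `F = (1 + ξ²)^(r/2) f̂`
of `f` is `f̂`. -/
def l1Map (hr : 1 / 2 < r) : L2C →L[ℂ] L1C :=
  LinearMap.mkContinuous
    { toFun := fun F => (memLp_one_wt_mul hr F).toLp _
      map_add' := fun f g => by
        refine Lp.ext ?_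
        filter_upwards [(memLp_one_wt_mul hr (f + g)).coeFn_toLp,
          (memLp_one_wt_mul hr f).coeFn_toLp, (memLp_one_wt_mul hr g).coeFn_toLp,
          Lp.coeFn_add f g, Lp.coeFn_add ((memLp_one_wt_mul hr f).toLp _)
            ((memLp_one_wt_mul hr g).toLp _)] with ξ h1 h2 h3 h4 h5
        rw [h1, h5, Pi.add_apply, h2, h3, h4, Pi.add_apply, mul_add]
      map_smul' := fun c f => by
        refine Lp.ext ?_
        filter_upwards [(memLp_one_wt_mul hr (c • f)).coeFn_toLp,
          (memLp_one_wt_mul hr f).coeFn_toLp,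
          Lp.coeFn_smul c f, Lp.coeFn_smul c ((memLp_one_wt_mul hr f).toLp _)] with ξ h1 h2 h3 h4
        simp only [RingHom.id_apply]
        rw [h1, h4, Pi.smul_apply, h2, h3, Pi.smul_apply, smul_eq_mul, smul_eq_mul]
        ring }
    (wtNorm r) (fun F => by
      simp only [LinearMap.coe_mk, AddHom.coe_mk]
      rw [Lp.norm_toLp]
      exact ENNReal.toReal_le_of_le_ofReal (mul_nonneg (wtNorm_nonneg r) (norm_nonneg _))
        (eLpNorm_one_wt_mul_le hr F))

theorem coeFn_l1Map (hr : 1 / 2 < r) (F : L2C) :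
    l1Map hr F =ᵐ[volume] fun ξ => wt (-r) ξ * F ξ := (memLp_one_wt_mul hr F).coeFn_toLp

theorem norm_l1Map_le (hr : 1 / 2 < r) (F : L2C) : ‖l1Map hr F‖ ≤ wtNorm r * ‖F‖ :=
  LinearMap.mkContinuous_norm_le _ (wtNorm_nonneg r) _ |> fun h =>
    (ContinuousLinearMap.le_of_opNorm_le _ h F)

/-- The function `f̂` belonging to the representative `F = (1 + ξ²)^(r/2) f̂` of `f ∈ H^r`. -/
abbrev low (r : ℝ) (F : L2C) : L2C := mulOp (wt (-r)) F

theorem isMult_low (hr : 1 / 2 < r) : IsMult (wt (-r)) := isMult_wt (by linarith)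

theorem coeFn_low (hr : 1 / 2 < r) (F : L2C) : low r F =ᵐ[volume] fun ξ => wt (-r) ξ * F ξ :=
  coeFn_mulOp (isMult_low hr) F

theorem coeFn_l1Map_low (hr : 1 / 2 < r) (F : L2C) : l1Map hr F =ᵐ[volume] low r F :=
  (coeFn_l1Map hr F).trans (coeFn_low hr F).symm

theorem eLpNorm_low (hr : 1 / 2 < r) (F : L2C) :
    eLpNorm (low r F) 1 volume = ENNReal.ofReal ‖l1Map hr F‖ := by
  rw [Lp.norm_def, ENNReal.ofReal_toReal (Lp.eLpNorm_ne_top _)]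
  exact (eLpNorm_congr_ae (coeFn_l1Map_low hr F)).symm

theorem norm_l1Map_eq_of_low_eq {r' : ℝ} (hr : 1 / 2 < r) (hr' : 1 / 2 < r') {F G : L2C}
    (h : low r F = low r' G) : ‖l1Map hr F‖ = ‖l1Map hr' G‖ := by
  have h1 := eLpNorm_low hr F
  rw [h, eLpNorm_low hr'] at h1
  exact ((ENNReal.ofReal_eq_ofReal_iff (norm_nonneg _) (norm_nonneg _)).1 h1).symm

theorem norm_l1Map_mulOp_le (hr : 1 / 2 < r) {m : ℝ → ℂ} (hm : IsMult m) {C : ℝ}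
    (hC : ∀ ξ, ‖m ξ‖ ≤ C) (F : L2C) : ‖l1Map hr (mulOp m F)‖ ≤ C * ‖l1Map hr F‖ := by
  refine Lp.norm_le_mul_norm_of_ae_le_mul ?_
  filter_upwards [coeFn_l1Map hr (mulOp m F), coeFn_l1Map hr F, coeFn_mulOp hm F] with ξ h1 h2 h3
  rw [h1, h2, h3, mul_left_comm, norm_mul]
  exact mul_le_mul_of_nonneg_right (hC ξ) (norm_nonneg _)

theorem memLp_conv (hr : 1 / 2 < r) (F g : L2C) : MemLp (conv (low r F) g) 2 volume := by
  refine ⟨(stronglyMeasurable_conv _ g).aestronglyMeasurable,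
    (eLpNorm_conv_le _ g).trans_lt ?_⟩
  rw [eLpNorm_low hr]
  exact ENNReal.mul_lt_top ENNReal.ofReal_lt_top (Lp.eLpNorm_lt_top g)

theorem norm_toLp_conv_le (hr : 1 / 2 < r) (F g : L2C) :
    ‖(memLp_conv hr F g).toLp _‖ ≤ ‖l1Map hr F‖ * ‖g‖ := by
  rw [Lp.norm_toLp]
  refine ENNReal.toReal_le_of_le_ofReal (by positivity) ((eLpNorm_conv_le _ g).trans_eq ?_)
  rw [eLpNorm_low hr, ENNReal.ofReal_mul (norm_nonneg _), Lp.norm_def g,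
    ENNReal.ofReal_toReal (Lp.eLpNorm_ne_top g)]

/-- A bilinear map of pairs of `L²` functions, given by representatives which are pointwise
bilinear, and bounded. -/
def bilinOfFun (b : L2C → L2C → ℝ → ℂ) (hb : ∀ f g, MemLp (b f g) 2 volume)
    (ha : ∀ f f' g, b (f + f') g =ᵐ[volume] fun ξ => b f g ξ + b f' g ξ)
    (hs : ∀ (c : ℂ) f g, b (c • f) g =ᵐ[volume] fun ξ => c * b f g ξ)
    (ha' : ∀ f g g', b f (g + g') =ᵐ[volume] fun ξ => b f g ξ + b f g' ξ)
    (hs' : ∀ (c : ℂ) f g, b f (c • g) =ᵐ[volume] fun ξ => c * b f g ξ)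
    (C : ℝ) (hC : ∀ f g, ‖(hb f g).toLp _‖ ≤ C * ‖f‖ * ‖g‖) : L2C →L[ℂ] L2C →L[ℂ] L2C :=
  have add : ∀ f g h k l m : L2C, b f g =ᵐ[volume] (fun ξ => b h k ξ + b l m ξ) →
      (hb f g).toLp _ = (hb h k).toLp _ + (hb l m).toLp _ := fun f g h k l m H => by
    refine Lp.ext ?_
    filter_upwards [H, (hb f g).coeFn_toLp, (hb h k).coeFn_toLp, (hb l m).coeFn_toLp,
      Lp.coeFn_add ((hb h k).toLp _) ((hb l m).toLp _)] with ξ h0 h1 h2 h3 h4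
    rw [h1, h4, Pi.add_apply, h2, h3, h0]
  have smul : ∀ (c : ℂ) (f g h k : L2C), b f g =ᵐ[volume] (fun ξ => c * b h k ξ) →
      (hb f g).toLp _ = c • (hb h k).toLp _ := fun c f g h k H => by
    refine Lp.ext ?_
    filter_upwards [H, (hb f g).coeFn_toLp, (hb h k).coeFn_toLp,
      Lp.coeFn_smul c ((hb h k).toLp _)] with ξ h0 h1 h2 h4
    rw [h1, h4, Pi.smul_apply, h2, h0, smul_eq_mul]
  LinearMap.mkContinuous₂
    (LinearMap.mk₂ ℂ (fun f g => (hb f g).toLp _)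
      (fun f f' g => add _ _ _ _ _ _ (ha f f' g)) (fun c f g => smul _ _ _ _ _ (hs c f g))
      (fun f g g' => add _ _ _ _ _ _ (ha' f g g')) (fun c f g => smul _ _ _ _ _ (hs' c f g)))
    C hC

theorem low_add (r : ℝ) (F G : L2C) : low r (F + G) = low r F + low r G := map_add _ _ _

theorem low_smul (r : ℝ) (c : ℂ) (F : L2C) : low r (c • F) = c • low r F := map_smul _ _ _

/-- The product of `f ∈ H^r` and `g ∈ L²` on the Fourier side: `(F, ĝ) ↦ f̂ * ĝ`, where
`F = (1 + ξ²)^(r/2) f̂`. -/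
def prodL2 (hr : 1 / 2 < r) : L2C →L[ℂ] L2C →L[ℂ] L2C :=
  bilinOfFun (fun F g => conv (low r F) g) (memLp_conv hr)
    (fun F F' g => ae_of_all _ fun ξ => by rw [low_add, conv_add_left])
    (fun c F g => ae_of_all _ fun ξ => by rw [low_smul, conv_smul_left])
    (fun F g g' => ae_of_all _ fun ξ => by rw [conv_add_right])
    (fun c F g => ae_of_all _ fun ξ => by rw [conv_smul_right])
    (wtNorm r) (fun F g => (norm_toLp_conv_le hr F g).trans
      (mul_le_mul_of_nonneg_right (norm_l1Map_le hr F) (norm_nonneg _)))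

theorem coeFn_prodL2 (hr : 1 / 2 < r) (F g : L2C) :
    prodL2 hr F g =ᵐ[volume] conv (low r F) g := (memLp_conv hr F g).coeFn_toLp

theorem norm_prodL2_le (hr : 1 / 2 < r) (F g : L2C) :
    ‖prodL2 hr F g‖ ≤ ‖l1Map hr F‖ * ‖g‖ := norm_toLp_conv_le hr F g

theorem prodL2_low_comm (hr : 1 / 2 < r) (F G : L2C) :
    prodL2 hr F (low r G) = prodL2 hr G (low r F) :=
  Lp.ext (by
    filter_upwards [coeFn_prodL2 hr F (low r G), coeFn_prodL2 hr G (low r F)] with ξ h1 h2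
    rw [h1, h2, conv_comm])

theorem refl_low (hr : 1 / 2 < r) (F : L2C) : refl (low r F) = low r (refl F) :=
  refl_mulOp (isMult_low hr) (isMult_low hr) (fun ξ => by rw [wt_neg_arg, conj_wt]) F

theorem refl_prodL2 (hr : 1 / 2 < r) (F g : L2C) :
    refl (prodL2 hr F g) = prodL2 hr (refl F) (refl g) :=
  Lp.ext (by
    filter_upwards [coeFn_refl (prodL2 hr F g), ae_neg (coeFn_prodL2 hr F g),
      coeFn_prodL2 hr (refl F) (refl g)] with ξ h1 h2 h3
    rw [h1, h2, h3, ← refl_low hr, conv_refl])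

/-- Multiplication by a real-valued function is symmetric. -/
theorem inner_prodL2 (hr : 1 / 2 < r) {F : L2C} (hF : refl F = F) (g h : L2C) :
    inner ℂ h (prodL2 hr F g) = inner ℂ (prodL2 hr F h) g := by
  have h1 : refl (low r F) = low r F := by rw [refl_low hr, hF]
  have h2 : eLpNorm (low r F) 1 volume ≠ ∞ := by rw [eLpNorm_low hr]; exact ENNReal.ofReal_ne_top
  have := integral_conj_mul_conv h1 h2 g h
  rw [L2.inner_def, L2.inner_def]
  refine Eq.trans (integral_congr_ae ?_) (this.trans (integral_congr_ae ?_))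
  · filter_upwards [coeFn_prodL2 hr F g] with ξ h
    rw [RCLike.inner_apply, h, mul_comm]
  · filter_upwards [coeFn_prodL2 hr F h] with ξ h
    rw [RCLike.inner_apply, h, mul_comm]

theorem norm_wt_le_add (hr : 0 ≤ r) (ξ η : ℝ) :
    ‖wt r ξ‖ ≤ 2 ^ r * (‖wt r (ξ - η)‖ + ‖wt r η‖) := by
  have e : ∀ ξ, ‖wt r ξ‖ = √(1 + ξ ^ 2) ^ r := fun ξ => by
    rw [norm_wt, Real.sqrt_eq_rpow, ← Real.rpow_mul (by positivity), Real.norm_eq_abs, sq_abs]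
    congr 1; ring
  rw [e, e, e]
  set a := √(1 + (ξ - η) ^ 2)
  set b := √(1 + η ^ 2)
  have ha : 0 ≤ a := Real.sqrt_nonneg _
  have hb : 0 ≤ b := Real.sqrt_nonneg _
  have h1 : √(1 + ξ ^ 2) ≤ 2 * max a b := by
    refine Real.sqrt_le_iff.2 ⟨by positivity, ?_⟩
    have h2 : a ^ 2 ≤ max a b ^ 2 := pow_le_pow_left₀ ha (le_max_left _ _) 2
    have h3 : b ^ 2 ≤ max a b ^ 2 := pow_le_pow_left₀ hb (le_max_right _ _) 2
    rw [Real.sq_sqrt (by positivity)] at h2 h3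
    nlinarith [sq_nonneg (ξ - η - η)]
  calc √(1 + ξ ^ 2) ^ r ≤ (2 * max a b) ^ r := Real.rpow_le_rpow (Real.sqrt_nonneg _) h1 hr
    _ = 2 ^ r * max a b ^ r := Real.mul_rpow (by norm_num) (le_max_of_le_left ha)
    _ ≤ 2 ^ r * (a ^ r + b ^ r) := by
        gcongr
        rcases le_total a b with h | h
        · rw [max_eq_right h]; linarith [Real.rpow_nonneg ha r]
        · rw [max_eq_left h]; linarith [Real.rpow_nonneg hb r]

/-- The tame estimate for the product in `H^r`. It is elementary on the Fourier side, with the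
norm of `𝓕 L¹` in place of the supremum norm. -/
theorem eLpNorm_wt_conv_le (hr : 1 / 2 < r) (F G : L2C) :
    eLpNorm (fun ξ => wt r ξ * conv (low r F) (low r G) ξ) 2 volume
      ≤ ENNReal.ofReal (2 ^ r * (‖l1Map hr F‖ * ‖G‖ + ‖F‖ * ‖l1Map hr G‖)) := by
  have hr0 : 0 ≤ r := by linarith
  have hFm := (Lp.stronglyMeasurable F).measurable
  have hGm := (Lp.stronglyMeasurable G).measurable
  have hf := (Lp.stronglyMeasurable (low r F)).measurable
  have hg := (Lp.stronglyMeasurable (low r G)).measurable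
  -- the two majorants
  set P : ℝ → ℝ≥0∞ := fun ξ => ∫⁻ η, ‖low r F (ξ - η)‖ₑ * ‖G η‖ₑ with hP
  set Q : ℝ → ℝ≥0∞ := fun ξ => ∫⁻ η, ‖F (ξ - η)‖ₑ * ‖low r G η‖ₑ with hQ
  have hwF : ∀ᵐ η, ‖wt r η‖ₑ * ‖low r F η‖ₑ = ‖F η‖ₑ := by
    filter_upwards [coeFn_low hr F] with η h
    rw [h, ← enorm_mul, ← mul_assoc, wt_mul_neg, one_mul]
  have hwG : ∀ᵐ η, ‖wt r η‖ₑ * ‖low r G η‖ₑ = ‖G η‖ₑ := by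
    filter_upwards [coeFn_low hr G] with η h
    rw [h, ← enorm_mul, ← mul_assoc, wt_mul_neg, one_mul]
  have hPm : Measurable P := Measurable.lintegral_prod_right (by fun_prop)
  have hQm : Measurable Q := Measurable.lintegral_prod_right (by fun_prop)
  have hpt : ∀ ξ, ‖wt r ξ * conv (low r F) (low r G) ξ‖ₑ ≤ ENNReal.ofReal (2 ^ r) * (P ξ + Q ξ) := by
    intro ξ
    rw [enorm_mul]
    calc ‖wt r ξ‖ₑ * ‖conv (low r F) (low r G) ξ‖ₑ
        ≤ ‖wt r ξ‖ₑ * ∫⁻ η, ‖low r F (ξ - η)‖ₑ * ‖low r G η‖ₑ := by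
          gcongr; exact enorm_conv_le _ _ ξ
      _ = ∫⁻ η, ‖wt r ξ‖ₑ * (‖low r F (ξ - η)‖ₑ * ‖low r G η‖ₑ) :=
          (lintegral_const_mul _ (by fun_prop)).symm
      _ ≤ ∫⁻ η, ENNReal.ofReal (2 ^ r) * (‖low r F (ξ - η)‖ₑ * ‖G η‖ₑ
            + ‖F (ξ - η)‖ₑ * ‖low r G η‖ₑ) := by
          refine lintegral_mono_ae ?_
          filter_upwards [hwG, ae_sub_left hwF ξ] with η h1 h2
          have h3 : ‖wt r ξ‖ₑ ≤ ENNReal.ofReal (2 ^ r) * (‖wt r (ξ - η)‖ₑ + ‖wt r η‖ₑ) := by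
            simp_rw [← ofReal_norm]
            rw [← ENNReal.ofReal_add (norm_nonneg _) (norm_nonneg _),
              ← ENNReal.ofReal_mul (by positivity)]
            exact ENNReal.ofReal_le_ofReal (norm_wt_le_add hr0 ξ η)
          rw [← h1, ← h2]
          refine (mul_le_mul_left h3 _).trans_eq ?_
          ring
      _ = ENNReal.ofReal (2 ^ r) * (P ξ + Q ξ) := by
          rw [lintegral_const_mul _ (by fun_prop), lintegral_add_left (by fun_prop)]
  have hPn : (∫⁻ ξ, P ξ ^ (2 : ℝ)) ^ (1 / 2 : ℝ) ≤ ENNReal.ofReal (‖l1Map hr F‖ * ‖G‖) := by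
    refine (ENNReal.rpow_le_rpow (lintegral_conv_sq_le hf.enorm hGm.enorm)
      (by norm_num)).trans_eq ?_
    rw [ENNReal.mul_rpow_of_nonneg _ _ (by norm_num), ← eLpNorm_two_eq, ← ENNReal.rpow_mul,
      ← eLpNorm_one_eq_lintegral_enorm, eLpNorm_low hr, ENNReal.ofReal_mul (norm_nonneg _),
      Lp.norm_def G, ENNReal.ofReal_toReal (Lp.eLpNorm_ne_top G)]
    norm_num
  have hQn : (∫⁻ ξ, Q ξ ^ (2 : ℝ)) ^ (1 / 2 : ℝ) ≤ ENNReal.ofReal (‖F‖ * ‖l1Map hr G‖) := by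
    have e : Q = fun ξ => ∫⁻ η, ‖low r G (ξ - η)‖ₑ * ‖F η‖ₑ := by
      funext ξ
      rw [hQ]
      simp only
      rw [← lintegral_sub_left_eq_self _ ξ]
      refine lintegral_congr fun η => ?_
      rw [sub_sub_cancel, mul_comm]
    rw [e]
    refine (ENNReal.rpow_le_rpow (lintegral_conv_sq_le hg.enorm hFm.enorm)
      (by norm_num)).trans_eq ?_
    rw [ENNReal.mul_rpow_of_nonneg _ _ (by norm_num), ← eLpNorm_two_eq, ← ENNReal.rpow_mul,
      ← eLpNorm_one_eq_lintegral_enorm, eLpNorm_low hr, mul_comm ‖F‖,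
      ENNReal.ofReal_mul (norm_nonneg _),
      Lp.norm_def F, ENNReal.ofReal_toReal (Lp.eLpNorm_ne_top F)]
    norm_num
  rw [eLpNorm_two_eq]
  calc (∫⁻ ξ, ‖wt r ξ * conv (low r F) (low r G) ξ‖ₑ ^ (2 : ℝ)) ^ (1 / 2 : ℝ)
      ≤ (∫⁻ ξ, ENNReal.ofReal (2 ^ r) ^ (2 : ℝ) * (P ξ + Q ξ) ^ (2 : ℝ)) ^ (1 / 2 : ℝ) := by
        refine ENNReal.rpow_le_rpow (lintegral_mono fun ξ => ?_) (by norm_num)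
        rw [← ENNReal.mul_rpow_of_nonneg _ _ (by norm_num)]
        exact ENNReal.rpow_le_rpow (hpt ξ) (by norm_num)
    _ = ENNReal.ofReal (2 ^ r) * (∫⁻ ξ, (P ξ + Q ξ) ^ (2 : ℝ)) ^ (1 / 2 : ℝ) := by
        rw [lintegral_const_mul _ (by fun_prop), ENNReal.mul_rpow_of_nonneg _ _ (by norm_num),
          ← ENNReal.rpow_mul]
        norm_num
    _ ≤ ENNReal.ofReal (2 ^ r) * (ENNReal.ofReal (‖l1Map hr F‖ * ‖G‖)
          + ENNReal.ofReal (‖F‖ * ‖l1Map hr G‖)) := by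
        gcongr
        refine (ENNReal.lintegral_Lp_add_le hPm.aemeasurable hQm.aemeasurable
          (by norm_num : (1 : ℝ) ≤ 2)).trans ?_
        gcongr
    _ = _ := by
        rw [← ENNReal.ofReal_add (by positivity) (by positivity),
          ← ENNReal.ofReal_mul (by positivity)]

theorem memLp_wt_conv (hr : 1 / 2 < r) (F G : L2C) :
    MemLp (fun ξ => wt r ξ * conv (low r F) (low r G) ξ) 2 volume :=
  ⟨(measurable_wt r).aestronglyMeasurable.mul (stronglyMeasurable_conv _ _).aestronglyMeasurable,
    (eLpNorm_wt_conv_le hr F G).trans_lt ENNReal.ofReal_lt_top⟩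

theorem norm_toLp_wt_conv_le (hr : 1 / 2 < r) (F G : L2C) :
    ‖(memLp_wt_conv hr F G).toLp _‖ ≤ 2 ^ r * (‖l1Map hr F‖ * ‖G‖ + ‖F‖ * ‖l1Map hr G‖) := by
  rw [Lp.norm_toLp]
  exact ENNReal.toReal_le_of_le_ofReal (by positivity) (eLpNorm_wt_conv_le hr F G)

/-- The product in `H^r`, `r > 1/2`, on the Fourier side, in terms of the representatives
`(1 + ξ²)^(r/2) f̂` of the factors and of the product. -/
def prodHr (hr : 1 / 2 < r) : L2C →L[ℂ] L2C →L[ℂ] L2C :=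
  bilinOfFun (fun F G ξ => wt r ξ * conv (low r F) (low r G) ξ) (memLp_wt_conv hr)
    (fun F F' g => ae_of_all _ fun ξ => by rw [low_add, conv_add_left]; ring)
    (fun c F g => ae_of_all _ fun ξ => by rw [low_smul, conv_smul_left]; ring)
    (fun F g g' => ae_of_all _ fun ξ => by rw [low_add, conv_add_right]; ring)
    (fun c F g => ae_of_all _ fun ξ => by rw [low_smul, conv_smul_right]; ring)
    (2 ^ r * (2 * wtNorm r)) (fun F G => (norm_toLp_wt_conv_le hr F G).trans (by
      have h1 := mul_le_mul_of_nonneg_right (norm_l1Map_le hr F) (norm_nonneg G)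
      have h2 := mul_le_mul_of_nonneg_left (norm_l1Map_le hr G) (norm_nonneg F)
      have : (0 : ℝ) ≤ 2 ^ r := by positivity
      nlinarith))

theorem coeFn_prodHr (hr : 1 / 2 < r) (F G : L2C) :
    prodHr hr F G =ᵐ[volume] fun ξ => wt r ξ * conv (low r F) (low r G) ξ :=
  (memLp_wt_conv hr F G).coeFn_toLp

theorem norm_prodHr_le (hr : 1 / 2 < r) (F G : L2C) :
    ‖prodHr hr F G‖ ≤ 2 ^ r * (‖l1Map hr F‖ * ‖G‖ + ‖F‖ * ‖l1Map hr G‖) :=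
  norm_toLp_wt_conv_le hr F G

theorem low_prodHr (hr : 1 / 2 < r) (F G : L2C) :
    low r (prodHr hr F G) = prodL2 hr F (low r G) := by
  rw [low, mulOp_eq_iff (isMult_low hr)]
  filter_upwards [coeFn_prodL2 hr F (low r G), coeFn_prodHr hr F G] with ξ h1 h2
  rw [h1, h2, ← mul_assoc, wt_neg_mul, one_mul]

theorem norm_l1Map_prodHr_le (hr : 1 / 2 < r) (F G : L2C) :
    ‖l1Map hr (prodHr hr F G)‖ ≤ ‖l1Map hr F‖ * ‖l1Map hr G‖ := by
  have h := eLpNorm_one_conv_le (low r F) (low r G)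
  rw [eLpNorm_low hr, eLpNorm_low hr, ← ENNReal.ofReal_mul (norm_nonneg _)] at h
  rw [← ENNReal.ofReal_le_ofReal_iff (by positivity), ← eLpNorm_low hr, low_prodHr]
  rwa [eLpNorm_congr_ae (coeFn_prodL2 hr F (low r G))]

theorem refl_prodHr (hr : 1 / 2 < r) (F G : L2C) :
    refl (prodHr hr F G) = prodHr hr (refl F) (refl G) := by
  refine mulOp_injective (isMult_low hr) (wt_ne_zero _) ?_
  change low r (refl _) = low r _
  rw [← refl_low hr, low_prodHr, low_prodHr, refl_prodL2, refl_low hr]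

end Products

/-! ### The system as an ordinary differential equation -/

section System

open scoped NNReal

variable {r : ℝ}

/-- The quadratic expression `a u² + 2 b u v + c v²` in `H^r`, on the Fourier side, in terms of the
representatives `F`, `G` of `u`, `v`. -/
def quadHr (hr : 1 / 2 < r) (a b c : ℝ) (F G : L2C) : L2C :=
  (a : ℂ) • prodHr hr F F + (2 * b : ℂ) • prodHr hr F G + (c : ℂ) • prodHr hr G G

theorem continuous_quadHr (hr : 1 / 2 < r) (a b c : ℝ) :
    Continuous fun p : L2C × L2C => quadHr hr a b c p.1 p.2 := by
  unfold quadHr; fun_prop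

theorem refl_quadHr (hr : 1 / 2 < r) (a b c : ℝ) (F G : L2C) :
    refl (quadHr hr a b c F G) = quadHr hr a b c (refl F) (refl G) := by
  have : starRingEnd ℂ (2 * (b : ℂ)) = 2 * b := by
    rw [map_mul, Complex.conj_ofReal, map_ofNat]
  simp only [quadHr, map_add, refl_smul, refl_prodHr, Complex.conj_ofReal, this]

/-- The constant in the estimates of `quadHr`. -/
def quadConst (a b c : ℝ) : ℝ := |a| + 2 * |b| + |c|

theorem quadConst_nonneg (a b c : ℝ) : 0 ≤ quadConst a b c := by unfold quadConst; positivity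

theorem norm_two_mul_ofReal (b : ℝ) : ‖(2 * b : ℂ)‖ = 2 * |b| := by
  rw [norm_mul, Complex.norm_real, Real.norm_eq_abs]; norm_num

theorem norm_quadHr_le (hr : 1 / 2 < r) (a b c : ℝ) (F G : L2C) :
    ‖quadHr hr a b c F G‖ ≤ 2 ^ r * quadConst a b c * 2 *
      ((‖l1Map hr F‖ + ‖l1Map hr G‖) * (‖F‖ + ‖G‖)) := by
  unfold quadHr quadConst
  set p := ‖l1Map hr F‖ with hp
  set q := ‖l1Map hr G‖ with hq
  have hp0 : 0 ≤ p := norm_nonneg _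
  have hq0 : 0 ≤ q := norm_nonneg _
  have hF := norm_nonneg F
  have hG := norm_nonneg G
  have h2 : (0 : ℝ) ≤ 2 ^ r := by positivity
  have key : ∀ (k x : ℝ), 0 ≤ k → x ≤ 2 * ((p + q) * (‖F‖ + ‖G‖)) →
      k * (2 ^ r * x) ≤ k * (2 ^ r * (2 * ((p + q) * (‖F‖ + ‖G‖)))) := fun k x hk hx => by
    gcongr
  calc _ ≤ |a| * (2 ^ r * (p * ‖F‖ + ‖F‖ * p)) + 2 * |b| * (2 ^ r * (p * ‖G‖ + ‖F‖ * q))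
          + |c| * (2 ^ r * (q * ‖G‖ + ‖G‖ * q)) := by
        refine (norm_add₃_le).trans ?_
        rw [norm_smul, norm_smul, norm_smul, norm_two_mul_ofReal, Complex.norm_real,
          Complex.norm_real, Real.norm_eq_abs, Real.norm_eq_abs]
        gcongr
        · exact norm_prodHr_le hr F F
        · exact norm_prodHr_le hr F G
        · exact norm_prodHr_le hr G G
    _ ≤ |a| * (2 ^ r * (2 * ((p + q) * (‖F‖ + ‖G‖))))
          + 2 * |b| * (2 ^ r * (2 * ((p + q) * (‖F‖ + ‖G‖))))
          + |c| * (2 ^ r * (2 * ((p + q) * (‖F‖ + ‖G‖)))) := by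
        have h1 := mul_nonneg hp0 hG
        have h3 := mul_nonneg hq0 hF
        have h4 := mul_nonneg hp0 hF
        have h5 := mul_nonneg hq0 hG
        refine add_le_add (add_le_add (key _ _ (abs_nonneg a) ?_)
          (key _ _ (by positivity) ?_)) (key _ _ (abs_nonneg c) ?_) <;> nlinarith
    _ = _ := by ring

theorem norm_l1Map_quadHr_le (hr : 1 / 2 < r) (a b c : ℝ) (F G : L2C) :
    ‖l1Map hr (quadHr hr a b c F G)‖ ≤ |a| * (‖l1Map hr F‖ * ‖l1Map hr F‖)
      + 2 * |b| * (‖l1Map hr F‖ * ‖l1Map hr G‖) + |c| * (‖l1Map hr G‖ * ‖l1Map hr G‖) := by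
  unfold quadHr
  rw [map_add, map_add, map_smul, map_smul, map_smul]
  refine (norm_add₃_le).trans ?_
  rw [norm_smul, norm_smul, norm_smul, norm_two_mul_ofReal, Complex.norm_real,
    Complex.norm_real, Real.norm_eq_abs, Real.norm_eq_abs]
  gcongr
  · exact norm_l1Map_prodHr_le hr F F
  · exact norm_l1Map_prodHr_le hr F G
  · exact norm_l1Map_prodHr_le hr G G

theorem norm_quadHr_sub_le (hr : 1 / 2 < r) (a b c : ℝ) {R : ℝ} {F G F' G' : L2C} (hF : ‖F‖ ≤ R)
    (hG : ‖G‖ ≤ R) (hF' : ‖F'‖ ≤ R) (hG' : ‖G'‖ ≤ R) :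
    ‖quadHr hr a b c F G - quadHr hr a b c F' G'‖
      ≤ ‖prodHr hr‖ * quadConst a b c * 2 * R * (‖F - F'‖ + ‖G - G'‖) := by
  have hR : 0 ≤ R := (norm_nonneg F).trans hF
  have hB : ∀ f g f' g' : L2C, ‖g‖ ≤ R → ‖f'‖ ≤ R → ‖f - f'‖ ≤ ‖F - F'‖ + ‖G - G'‖ →
      ‖g - g'‖ ≤ ‖F - F'‖ + ‖G - G'‖ → ‖prodHr hr f g - prodHr hr f' g'‖
        ≤ ‖prodHr hr‖ * 2 * R * (‖F - F'‖ + ‖G - G'‖) := by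
    intro f g f' g' h1 h2 h3 h4
    have e : prodHr hr f g - prodHr hr f' g' = prodHr hr (f - f') g + prodHr hr f' (g - g') := by
      rw [map_sub, map_sub, sub_apply]; abel
    rw [e]
    calc _ ≤ ‖prodHr hr‖ * ‖f - f'‖ * ‖g‖ + ‖prodHr hr‖ * ‖f'‖ * ‖g - g'‖ :=
          (norm_add_le _ _).trans (add_le_add ((prodHr hr).le_opNorm₂ _ _)
            ((prodHr hr).le_opNorm₂ _ _))
      _ ≤ ‖prodHr hr‖ * (‖F - F'‖ + ‖G - G'‖) * R
          + ‖prodHr hr‖ * R * (‖F - F'‖ + ‖G - G'‖) := by gcongr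
      _ = _ := by ring
  have hd1 : ‖F - F'‖ ≤ ‖F - F'‖ + ‖G - G'‖ := by linarith [norm_nonneg (G - G')]
  have hd2 : ‖G - G'‖ ≤ ‖F - F'‖ + ‖G - G'‖ := by linarith [norm_nonneg (F - F')]
  have e : quadHr hr a b c F G - quadHr hr a b c F' G'
      = (a : ℂ) • (prodHr hr F F - prodHr hr F' F')
        + (2 * b : ℂ) • (prodHr hr F G - prodHr hr F' G')
        + (c : ℂ) • (prodHr hr G G - prodHr hr G' G') := by
    simp only [quadHr, smul_sub]; abel
  rw [e]
  refine (norm_add₃_le).trans ?_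
  rw [norm_smul, norm_smul, norm_smul, norm_two_mul_ofReal, Complex.norm_real,
    Complex.norm_real, Real.norm_eq_abs, Real.norm_eq_abs]
  calc _ ≤ |a| * (‖prodHr hr‖ * 2 * R * (‖F - F'‖ + ‖G - G'‖))
        + 2 * |b| * (‖prodHr hr‖ * 2 * R * (‖F - F'‖ + ‖G - G'‖))
        + |c| * (‖prodHr hr‖ * 2 * R * (‖F - F'‖ + ‖G - G'‖)) := by
        gcongr
        · exact hB _ _ _ _ hF hF' hd1 hd1
        · exact hB _ _ _ _ hG hF' hd1 hd2
        · exact hB _ _ _ _ hG hG' hd2 hd2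
    _ = _ := by unfold quadConst; ring

/-- The data of the first-order system
`∂ₜ u = m₁(D) x`, `∂ₜ x = m₂(D) (α² u + f₁(u, v))`, `∂ₜ² v = ∂ₓ² v - v + f₂(u, v)`
in `H^r × H^s`. With `m₁ = m₂ = ∂ₓ (1 - ∂ₓ²)^(-1/2)` the auxiliary unknown is
`x = (1 - ∂ₓ²)^(1/2) ∂ₓ⁻¹ uₜ`, and with `m₁ = 1`, `m₂ = ∂ₓ² (1 - ∂ₓ²)⁻¹` it is `x = uₜ`. -/
structure Sys where
  /-- the coefficients -/
  c : Coeffs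
  /-- the regularity of `u` -/
  r : ℝ
  /-- the regularity of `v` -/
  s : ℝ
  hr : 1 / 2 < r
  hrs : r ≤ s
  hsr : s ≤ r + 1
  m₁ : ℝ → ℂ
  m₂ : ℝ → ℂ
  hm₁ : IsMult m₁
  hm₂ : IsMult m₂
  /-- `m₁(D)` maps real-valued functions to real-valued functions -/
  symm₁ : ∀ ξ, starRingEnd ℂ (m₁ (-ξ)) = m₁ ξ
  /-- `m₂(D)` maps real-valued functions to real-valued functions -/
  symm₂ : ∀ ξ, starRingEnd ℂ (m₂ (-ξ)) = m₂ ξ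

/-- The state space. In the state `(U, X, Y₊, Y₋)`, `U` and `X` are the representatives
`(1 + ξ²)^(r/2) û`, `(1 + ξ²)^(r/2) x̂`, and `Y± = exp(±itω) (V ± iQ)`, where
`V = (1 + ξ²)^(s/2) v̂` and `Q = (1 + ξ²)^(s/2) ω⁻¹ ∂ₜ v̂`. -/
abbrev St : Type := L2C × L2C × L2C × L2C

namespace Sys

variable (P : Sys)

theorem isMult_down : IsMult (wt (P.r - P.s)) := isMult_wt (by linarith [P.hrs])

theorem isMult_up : IsMult fun ξ => wt (P.s - P.r) ξ / (om ξ : ℂ) :=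
  isMult_wt_div_om (by linarith [P.hsr])

/-- The component `V = (1 + ξ²)^(s/2) v̂` of the state. -/
def V (t : ℝ) (y : St) : L2C := (1 / 2 : ℂ) • (grp (-t) y.2.2.1 + grp t y.2.2.2)

/-- The component `Q = (1 + ξ²)^(s/2) ω⁻¹ ∂ₜ v̂` of the state. -/
def Q (t : ℝ) (y : St) : L2C := (-Complex.I / 2) • (grp (-t) y.2.2.1 - grp t y.2.2.2)

/-- The representative `(1 + ξ²)^(r/2) v̂` of `v` in `H^r`. -/
def Vr (t : ℝ) (y : St) : L2C := mulOp (wt (P.r - P.s)) (V t y)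

/-- The representative of `f₁(u, v)` in `H^r`. -/
def N₁ (t : ℝ) (y : St) : L2C := quadHr P.hr P.c.auu P.c.auv P.c.avv y.1 (P.Vr t y)

/-- The representative of `f₂(u, v)` in `H^r`. -/
def N₂ (t : ℝ) (y : St) : L2C := quadHr P.hr P.c.buu P.c.buv P.c.bvv y.1 (P.Vr t y)

/-- The representative of `(1 - ∂ₓ²)^(-1/2) f₂(u, v)` in `H^s`. -/
def G (t : ℝ) (y : St) : L2C := mulOp (fun ξ => wt (P.s - P.r) ξ / (om ξ : ℂ)) (P.N₂ t y)

/-- The vector field of the system. There is no unbounded operator in it, as the profiles `Y±` are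
constant along the free Klein-Gordon flow. -/
def field (t : ℝ) (y : St) : St :=
  (mulOp P.m₁ y.2.1, mulOp P.m₂ (((P.c.α ^ 2 : ℝ) : ℂ) • y.1 + P.N₁ t y),
    Complex.I • grp t (P.G t y), (-Complex.I) • grp (-t) (P.G t y))

theorem norm_V_le (t : ℝ) (y : St) : ‖V t y‖ ≤ ‖y‖ := by
  have h1 : ‖y.2.2.1‖ ≤ ‖y‖ := (norm_fst_le _).trans ((norm_snd_le _).trans (norm_snd_le _))
  have h2 : ‖y.2.2.2‖ ≤ ‖y‖ := (norm_snd_le _).trans ((norm_snd_le _).trans (norm_snd_le _))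
  rw [V, norm_smul]
  have h3 := norm_add_le (grp (-t) y.2.2.1) (grp t y.2.2.2)
  rw [norm_grp, norm_grp] at h3
  have : ‖(1 / 2 : ℂ)‖ = 1 / 2 := by norm_num
  rw [this]
  linarith

theorem norm_Vr_le (t : ℝ) (y : St) : ‖P.Vr t y‖ ≤ ‖y‖ := by
  have := norm_mulOp_le P.isMult_down (norm_wt_le_one (by linarith [P.hrs])) (V t y)
  rw [one_mul] at this
  exact this.trans (norm_V_le t y)

theorem V_sub (t : ℝ) (y z : St) : V t (y - z) = V t y - V t z := by
  simp only [V, Prod.fst_sub, Prod.snd_sub, map_sub, ← smul_sub]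
  congr 1; abel

theorem Vr_sub (t : ℝ) (y z : St) : P.Vr t (y - z) = P.Vr t y - P.Vr t z := by
  simp only [Vr, V_sub, map_sub]

theorem norm_up_le (f : L2C) :
    ‖mulOp (fun ξ => wt (P.s - P.r) ξ / (om ξ : ℂ)) f‖ ≤ ‖f‖ := by
  have := norm_mulOp_le P.isMult_up (C := 1) (fun ξ => by
    rw [norm_div, norm_om, div_le_one (om_pos ξ)]
    exact (norm_wt_le_norm_wt (by linarith [P.hsr]) ξ).trans (norm_wt_one_le_om ξ)) f
  rwa [one_mul] at this

/-- A bound for the two multipliers of the system. -/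
theorem exists_mult_bound :
    ∃ M : ℝ, 0 ≤ M ∧ (∀ ξ, ‖P.m₁ ξ‖ ≤ M) ∧ ∀ ξ, ‖P.m₂ ξ‖ ≤ M := by
  obtain ⟨C₁, h₁⟩ := P.hm₁.2
  obtain ⟨C₂, h₂⟩ := P.hm₂.2
  exact ⟨max C₁ C₂, ((norm_nonneg _).trans (h₁ 0)).trans (le_max_left _ _),
    fun ξ => (h₁ ξ).trans (le_max_left _ _), fun ξ => (h₂ ξ).trans (le_max_right _ _)⟩

theorem norm_field_le {M : ℝ} (hM : 0 ≤ M) (h₁ : ∀ ξ, ‖P.m₁ ξ‖ ≤ M) (h₂ : ∀ ξ, ‖P.m₂ ξ‖ ≤ M)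
    (t : ℝ) (y : St) {A D : ℝ} (hA : ‖P.N₁ t y‖ ≤ A) (hD : ‖P.N₂ t y‖ ≤ D) :
    ‖P.field t y‖ ≤ M * ((1 + P.c.α ^ 2) * ‖y‖ + A) + D := by
  have hU : ‖y.1‖ ≤ ‖y‖ := norm_fst_le _
  have hX : ‖y.2.1‖ ≤ ‖y‖ := (norm_fst_le _).trans (norm_snd_le _)
  have hA0 := (norm_nonneg _).trans hA
  have hD0 := (norm_nonneg _).trans hD
  have hy := norm_nonneg y
  have hα := sq_nonneg P.c.α
  have hG : ‖P.G t y‖ ≤ D := (P.norm_up_le _).trans hD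
  have hpos : 0 ≤ M * ((1 + P.c.α ^ 2) * ‖y‖ + A) := by positivity
  refine max_le ?_ (max_le ?_ (max_le ?_ ?_))
  · refine (norm_mulOp_le P.hm₁ h₁ _).trans ?_
    have : ‖y.2.1‖ ≤ (1 + P.c.α ^ 2) * ‖y‖ + A := by nlinarith
    nlinarith [mul_le_mul_of_nonneg_left this hM]
  · refine (norm_mulOp_le P.hm₂ h₂ _).trans ?_
    have h3 : ‖((P.c.α ^ 2 : ℝ) : ℂ) • y.1 + P.N₁ t y‖ ≤ (1 + P.c.α ^ 2) * ‖y‖ + A := by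
      refine (norm_add_le _ _).trans ?_
      rw [norm_smul, Complex.norm_real, Real.norm_of_nonneg hα]
      nlinarith [mul_le_mul_of_nonneg_left hU hα]
    nlinarith [mul_le_mul_of_nonneg_left h3 hM]
  · change ‖Complex.I • grp t (P.G t y)‖ ≤ _
    rw [norm_smul, Complex.norm_I, one_mul, norm_grp]; linarith
  · change ‖(-Complex.I) • grp (-t) (P.G t y)‖ ≤ _
    rw [norm_smul, norm_neg, Complex.norm_I, one_mul, norm_grp]; linarith

theorem continuous_V (y : St) : Continuous fun t => V t y := by
  have h1 := (continuous_grp_apply y.2.2.1).comp continuous_neg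
  have h2 := continuous_grp_apply y.2.2.2
  exact Continuous.const_smul (h1.add h2) (1 / 2 : ℂ)

theorem continuous_Vr (y : St) : Continuous fun t => P.Vr t y :=
  (mulOp _).continuous.comp (continuous_V y)

theorem continuous_N₁ (y : St) : Continuous fun t => P.N₁ t y :=
  (continuous_quadHr P.hr P.c.auu P.c.auv P.c.avv).comp
    (f := fun t => (y.1, P.Vr t y)) (continuous_const.prodMk (P.continuous_Vr y))

theorem continuous_G (y : St) : Continuous fun t => P.G t y :=
  (mulOp _).continuous.comp ((continuous_quadHr P.hr P.c.buu P.c.buv P.c.bvv).comp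
    (f := fun t => (y.1, P.Vr t y)) (continuous_const.prodMk (P.continuous_Vr y)))

theorem continuous_field (y : St) : Continuous fun t => P.field t y := by
  have hgrp : ∀ θ : ℝ → ℝ, Continuous θ → Continuous fun t => grp (θ t) (P.G t y) :=
    fun θ hθ => by
      rw [← continuousOn_univ]; exact continuousOn_grp hθ (P.continuous_G y).continuousOn
  have h1 : Continuous fun t => mulOp P.m₂ (((P.c.α ^ 2 : ℝ) : ℂ) • y.1 + P.N₁ t y) :=
    (mulOp P.m₂).continuous.comp (continuous_const.add (P.continuous_N₁ y))
  have h2 : Continuous fun t => Complex.I • grp t (P.G t y) :=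
    Continuous.const_smul (hgrp _ continuous_id) Complex.I
  have h3 : Continuous fun t => (-Complex.I) • grp (-t) (P.G t y) :=
    Continuous.const_smul (hgrp _ continuous_neg) (-Complex.I)
  exact continuous_const.prodMk (h1.prodMk (h2.prodMk h3))

theorem norm_quadHr_state_sub_le (a b c : ℝ) {R : ℝ} (t : ℝ) {y z : St} (hy : ‖y‖ ≤ R)
    (hz : ‖z‖ ≤ R) :
    ‖quadHr P.hr a b c y.1 (P.Vr t y) - quadHr P.hr a b c z.1 (P.Vr t z)‖
      ≤ 2 * (‖prodHr P.hr‖ * quadConst a b c * 2 * R) * ‖y - z‖ := by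
  have hR : 0 ≤ R := (norm_nonneg y).trans hy
  have hU : ‖y.1 - z.1‖ ≤ ‖y - z‖ := norm_fst_le (y - z)
  have hV : ‖P.Vr t y - P.Vr t z‖ ≤ ‖y - z‖ := by
    rw [← P.Vr_sub]; exact P.norm_Vr_le t _
  have hK : 0 ≤ ‖prodHr P.hr‖ * quadConst a b c * 2 * R := by
    have := quadConst_nonneg a b c
    positivity
  refine (norm_quadHr_sub_le P.hr a b c ((norm_fst_le _).trans hy)
    ((P.norm_Vr_le t y).trans hy) ((norm_fst_le _).trans hz)
    ((P.norm_Vr_le t z).trans hz)).trans ?_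
  refine (mul_le_mul_of_nonneg_left (add_le_add hU hV) hK).trans_eq ?_
  ring

theorem norm_field_sub_le {M : ℝ} (hM : 0 ≤ M) (h₁ : ∀ ξ, ‖P.m₁ ξ‖ ≤ M) (h₂ : ∀ ξ, ‖P.m₂ ξ‖ ≤ M)
    (t : ℝ) (y z : St) {A D : ℝ} (hA : ‖P.N₁ t y - P.N₁ t z‖ ≤ A)
    (hD : ‖P.N₂ t y - P.N₂ t z‖ ≤ D) :
    ‖P.field t y - P.field t z‖ ≤ M * ((1 + P.c.α ^ 2) * ‖y - z‖ + A) + D := by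
  have hU : ‖y.1 - z.1‖ ≤ ‖y - z‖ := norm_fst_le (y - z)
  have hX : ‖y.2.1 - z.2.1‖ ≤ ‖y - z‖ := (norm_fst_le (y - z).2).trans (norm_snd_le (y - z))
  have hA0 := (norm_nonneg _).trans hA
  have hD0 := (norm_nonneg _).trans hD
  have hn := norm_nonneg (y - z)
  have hα := sq_nonneg P.c.α
  have hG : ‖P.G t y - P.G t z‖ ≤ D := by
    rw [G, G, ← map_sub]; exact (P.norm_up_le _).trans hD
  have hpos : 0 ≤ M * ((1 + P.c.α ^ 2) * ‖y - z‖ + A) := by positivity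
  have hαn := mul_nonneg hα hn
  refine max_le ?_ (max_le ?_ (max_le ?_ ?_))
  · change ‖mulOp P.m₁ y.2.1 - mulOp P.m₁ z.2.1‖ ≤ _
    rw [← map_sub]
    refine (norm_mulOp_le P.hm₁ h₁ _).trans ?_
    have : ‖y.2.1 - z.2.1‖ ≤ (1 + P.c.α ^ 2) * ‖y - z‖ + A := by linarith
    linarith [mul_le_mul_of_nonneg_left this hM]
  · change ‖mulOp P.m₂ _ - mulOp P.m₂ _‖ ≤ _
    rw [← map_sub]
    refine (norm_mulOp_le P.hm₂ h₂ _).trans ?_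
    have h3 : ‖((P.c.α ^ 2 : ℝ) : ℂ) • y.1 + P.N₁ t y
        - (((P.c.α ^ 2 : ℝ) : ℂ) • z.1 + P.N₁ t z)‖ ≤ (1 + P.c.α ^ 2) * ‖y - z‖ + A := by
      rw [add_sub_add_comm, ← smul_sub]
      refine (norm_add_le _ _).trans ?_
      rw [norm_smul, Complex.norm_real, Real.norm_of_nonneg hα]
      linarith [mul_le_mul_of_nonneg_left hU hα]
    linarith [mul_le_mul_of_nonneg_left h3 hM]
  · change ‖Complex.I • grp t (P.G t y) - Complex.I • grp t (P.G t z)‖ ≤ _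
    rw [← smul_sub, ← map_sub, norm_smul, Complex.norm_I, one_mul, norm_grp]; linarith
  · change ‖(-Complex.I) • grp (-t) (P.G t y) - (-Complex.I) • grp (-t) (P.G t z)‖ ≤ _
    rw [← smul_sub, ← map_sub, norm_smul, norm_neg, Complex.norm_I, one_mul, norm_grp]; linarith

theorem field_zero (t : ℝ) : P.field t 0 = 0 := by
  have hV : P.Vr t 0 = 0 := by simp [Vr, V]
  have h1 : P.N₁ t 0 = 0 := by simp [N₁, hV, quadHr]
  have h2 : P.G t 0 = 0 := by simp [G, N₂, hV, quadHr]
  simp [field, h1, h2]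

theorem isLocLipField : IsLocLipField P.field where
  cont := P.continuous_field
  lip R := by
    obtain ⟨M, hM, h₁, h₂⟩ := P.exists_mult_bound
    have hq₁ := quadConst_nonneg P.c.auu P.c.auv P.c.avv
    have hq₂ := quadConst_nonneg P.c.buu P.c.buv P.c.bvv
    have hR0 : 0 ≤ max R 0 := le_max_right _ _
    set K₁ := 2 * (‖prodHr P.hr‖ * quadConst P.c.auu P.c.auv P.c.avv * 2 * max R 0) with hK₁
    set K₂ := 2 * (‖prodHr P.hr‖ * quadConst P.c.buu P.c.buv P.c.bvv * 2 * max R 0) with hK₂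
    have hL : 0 ≤ M * ((1 + P.c.α ^ 2) + K₁) + K₂ := by positivity
    refine ⟨NNReal.mk _ hL, fun t => LipschitzOnWith.of_dist_le_mul fun y hy z hz => ?_⟩
    rw [mem_closedBall_zero_iff] at hy hz
    rw [dist_eq_norm, dist_eq_norm, NNReal.coe_mk]
    have hRy : ‖y‖ ≤ max R 0 := hy.trans (le_max_left _ _)
    have hRz : ‖z‖ ≤ max R 0 := hz.trans (le_max_left _ _)
    refine (P.norm_field_sub_le hM h₁ h₂ t y z (P.norm_quadHr_state_sub_le _ _ _ t hRy hRz)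
      (P.norm_quadHr_state_sub_le _ _ _ t hRy hRz)).trans_eq ?_
    rw [← hK₁, ← hK₂]
    ring
  zero := P.field_zero

/-- Complex conjugation of the unknown functions, on the level of the states. -/
def conjSt (y : St) : St := (refl y.1, refl y.2.1, refl y.2.2.2, refl y.2.2.1)

theorem V_conjSt (t : ℝ) (y : St) : V t (conjSt y) = refl (V t y) := by
  have : starRingEnd ℂ (1 / 2) = 1 / 2 := by
    rw [map_div₀, map_one, map_ofNat]
  rw [V, V, refl_smul, map_add, refl_grp, refl_grp, neg_neg, this, add_comm]
  rfl

theorem Vr_conjSt (t : ℝ) (y : St) : P.Vr t (conjSt y) = refl (P.Vr t y) := by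
  rw [Vr, Vr, V_conjSt, refl_mulOp P.isMult_down P.isMult_down]
  intro ξ; rw [wt_neg_arg, conj_wt]

theorem field_conjSt (t : ℝ) (y : St) : P.field t (conjSt y) = conjSt (P.field t y) := by
  have hN₁ : P.N₁ t (conjSt y) = refl (P.N₁ t y) := by
    rw [N₁, N₁, Vr_conjSt, refl_quadHr]; rfl
  have hN₂ : P.N₂ t (conjSt y) = refl (P.N₂ t y) := by
    rw [N₂, N₂, Vr_conjSt, refl_quadHr]; rfl
  have hG : P.G t (conjSt y) = refl (P.G t y) := by
    rw [G, G, hN₂, refl_mulOp P.isMult_up P.isMult_up]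
    intro ξ; rw [map_div₀, wt_neg_arg, conj_wt, om_neg, Complex.conj_ofReal]
  refine Prod.ext ?_ (Prod.ext ?_ (Prod.ext ?_ ?_))
  · exact (refl_mulOp P.hm₁ P.hm₁ P.symm₁ _).symm
  · change mulOp P.m₂ (_ + P.N₁ t (conjSt y)) = refl (mulOp P.m₂ _)
    rw [refl_mulOp P.hm₂ P.hm₂ P.symm₂, hN₁, map_add refl, refl_smul, Complex.conj_ofReal]
    rfl
  · change Complex.I • grp t (P.G t (conjSt y)) = refl ((-Complex.I) • grp (-t) (P.G t y))
    rw [refl_smul, refl_grp, hG, neg_neg, map_neg, Complex.conj_I, neg_neg]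
  · change (-Complex.I) • grp (-t) (P.G t (conjSt y)) = refl (Complex.I • grp t (P.G t y))
    rw [refl_smul, refl_grp, hG, Complex.conj_I]

theorem hasDerivWithinAt_conjSt {y : ℝ → St} {y' : St} {I : Set ℝ} {t : ℝ}
    (h : HasDerivWithinAt y y' I t) :
    HasDerivWithinAt (fun τ => conjSt (y τ)) (conjSt y') I t := by
  let L : St →L[ℝ] St := (refl ∘L .fst ℝ _ _).prod ((refl ∘L .fst ℝ _ _ ∘L .snd ℝ _ _).prod
    ((refl ∘L .snd ℝ _ _ ∘L .snd ℝ _ _ ∘L .snd ℝ _ _).prod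
      (refl ∘L .fst ℝ _ _ ∘L .snd ℝ _ _ ∘L .snd ℝ _ _)))
  exact (L.hasFDerivAt.comp_hasDerivWithinAt t h)

/-- A solution with real initial data is real: its complex conjugate solves the same problem. -/
theorem conjSt_eq_of_isODESol {T : ℝ} {y : ℝ → St} (hy : IsODESol P.field T y)
    (h0 : conjSt (y 0) = y 0) {t : ℝ} (ht : t ∈ Icc 0 T) : conjSt (y t) = y t := by
  refine IsODESol.unique P.isLocLipField (y := fun t => conjSt (y t)) ?_ hy h0 ht
  intro t ht
  have := hasDerivWithinAt_conjSt (hy t ht)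
  rwa [← P.field_conjSt] at this

theorem hasDerivWithinAt_U {y : ℝ → St} {I : Set ℝ} {t : ℝ}
    (h : HasDerivWithinAt y (P.field t (y t)) I t) :
    HasDerivWithinAt (fun τ => (y τ).1) (mulOp P.m₁ (y t).2.1) I t :=
  (ContinuousLinearMap.fst ℝ L2C (L2C × L2C × L2C)).hasFDerivAt.comp_hasDerivWithinAt t h

end Sys

end System

/-! ### Conservation of energy -/

section Energy

open Filter Topology

/-- The real part of the inner product of `L²`. -/
def rip (f g : L2C) : ℝ := (inner ℂ f g).re

theorem rip_comm (f g : L2C) : rip f g = rip g f := by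
  rw [rip, rip, ← inner_conj_symm, Complex.conj_re]

theorem rip_add_right (f g h : L2C) : rip f (g + h) = rip f g + rip f h := by
  rw [rip, inner_add_right, Complex.add_re]; rfl

theorem rip_smul_right (c : ℝ) (f g : L2C) : rip f ((c : ℂ) • g) = c * rip f g := by
  rw [rip, inner_smul_right, Complex.re_ofReal_mul]; rfl

theorem rip_self (f : L2C) : rip f f = ‖f‖ ^ 2 := by
  rw [rip, inner_self_eq_norm_sq_to_K]; norm_cast

theorem abs_rip_le (f g : L2C) : |rip f g| ≤ ‖f‖ * ‖g‖ :=
  (Complex.abs_re_le_norm _).trans (norm_inner_le_norm f g)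

theorem hasDerivWithinAt_rip {f g : ℝ → L2C} {f' g' : L2C} {I : Set ℝ} {t : ℝ}
    (hf : HasDerivWithinAt f f' I t) (hg : HasDerivWithinAt g g' I t) :
    HasDerivWithinAt (fun τ => rip (f τ) (g τ)) (rip (f t) g' + rip f' (g t)) I t := by
  have h := hf.inner ℂ hg
  exact (Complex.reCLM.hasFDerivAt.comp_hasDerivWithinAt t h)

theorem hasDerivWithinAt_norm_sq {f : ℝ → L2C} {f' : L2C} {I : Set ℝ} {t : ℝ}
    (hf : HasDerivWithinAt f f' I t) :
    HasDerivWithinAt (fun τ => ‖f τ‖ ^ 2) (2 * rip (f t) f') I t := by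
  have h := hasDerivWithinAt_rip hf hf
  simp_rw [rip_self] at h
  refine h.congr_deriv ?_
  rw [rip_comm f']; ring

variable {r : ℝ}

/-- Product rule for the product of two functions which are continuous with values in `H^r` and
differentiable with values in `L²`. -/
theorem hasDerivWithinAt_prodL2 (hr : 1 / 2 < r) {F G : ℝ → L2C} {f' g' : L2C} {I : Set ℝ} {t : ℝ}
    (hF : ContinuousWithinAt F I t)
    (hF' : HasDerivWithinAt (fun τ => low r (F τ)) f' I t)
    (hG' : HasDerivWithinAt (fun τ => low r (G τ)) g' I t) :
    HasDerivWithinAt (fun τ => prodL2 hr (F τ) (low r (G τ)))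
      (prodL2 hr (F t) g' + prodL2 hr (G t) f') I t := by
  rw [hasDerivWithinAt_iff_tendsto_slope] at hF' hG' ⊢
  have h1 : Tendsto F (𝓝[I \ {t}] t) (𝓝 (F t)) := hF.mono sdiff_subset
  have hc : Continuous fun p : L2C × L2C => prodL2 hr p.1 p.2 := by fun_prop
  have h2 := (hc.tendsto (F t, g')).comp (h1.prodMk_nhds hG')
  have h3 := ((prodL2 hr (G t)).continuous.tendsto f').comp hF'
  refine (h2.add h3).congr fun τ => ?_
  simp only [Function.comp_apply, slope_def_module]
  -- the second difference quotient is moved to the other factor by commutativity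
  rw [ContinuousLinearMap.map_smul_of_tower, ContinuousLinearMap.map_smul_of_tower, ← smul_add]
  congr 1
  rw [map_sub, map_sub, prodL2_low_comm hr (G t), prodL2_low_comm hr (G t)]
  abel

namespace Sys

variable (P : Sys)

theorem hasDerivWithinAt_snd {y : ℝ → St} {I : Set ℝ} {t : ℝ}
    (h : HasDerivWithinAt y (P.field t (y t)) I t) :
    HasDerivWithinAt (fun τ => (y τ).2.1)
      (mulOp P.m₂ (((P.c.α ^ 2 : ℝ) : ℂ) • (y t).1 + P.N₁ t (y t))) I t :=
  (ContinuousLinearMap.fst ℝ L2C (L2C × L2C) ∘L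
    ContinuousLinearMap.snd ℝ L2C (L2C × L2C × L2C)).hasFDerivAt.comp_hasDerivWithinAt t h

theorem hasDerivWithinAt_plus {y : ℝ → St} {I : Set ℝ} {t : ℝ}
    (h : HasDerivWithinAt y (P.field t (y t)) I t) :
    HasDerivWithinAt (fun τ => (y τ).2.2.1) (Complex.I • grp t (P.G t (y t))) I t :=
  (ContinuousLinearMap.fst ℝ L2C L2C ∘L ContinuousLinearMap.snd ℝ L2C (L2C × L2C) ∘L
    ContinuousLinearMap.snd ℝ L2C (L2C × L2C × L2C)).hasFDerivAt.comp_hasDerivWithinAt t h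

theorem hasDerivWithinAt_minus {y : ℝ → St} {I : Set ℝ} {t : ℝ}
    (h : HasDerivWithinAt y (P.field t (y t)) I t) :
    HasDerivWithinAt (fun τ => (y τ).2.2.2) ((-Complex.I) • grp (-t) (P.G t (y t))) I t :=
  (ContinuousLinearMap.snd ℝ L2C L2C ∘L ContinuousLinearMap.snd ℝ L2C (L2C × L2C) ∘L
    ContinuousLinearMap.snd ℝ L2C (L2C × L2C × L2C)).hasFDerivAt.comp_hasDerivWithinAt t h

theorem continuousWithinAt_V {y : ℝ → St} {I : Set ℝ} {t : ℝ} (h : ContinuousWithinAt y I t) :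
    ContinuousWithinAt (fun τ => V τ (y τ)) I t := by
  have hp : ContinuousWithinAt (fun τ => (y τ).2.2.1) I t := h.snd.snd.fst
  have hm : ContinuousWithinAt (fun τ => (y τ).2.2.2) I t := h.snd.snd.snd
  have h1 : ContinuousWithinAt (fun τ => grp (-τ) (y τ).2.2.1) I t :=
    tendsto_grp (continuous_neg.continuousWithinAt) hp
  have h2 : ContinuousWithinAt (fun τ => grp τ (y τ).2.2.2) I t :=
    tendsto_grp (continuous_id.continuousWithinAt) hm
  exact ContinuousWithinAt.const_smul (h1.add h2) (1 / 2 : ℂ)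

theorem continuousWithinAt_Q {y : ℝ → St} {I : Set ℝ} {t : ℝ} (h : ContinuousWithinAt y I t) :
    ContinuousWithinAt (fun τ => Q τ (y τ)) I t := by
  have hp : ContinuousWithinAt (fun τ => (y τ).2.2.1) I t := h.snd.snd.fst
  have hm : ContinuousWithinAt (fun τ => (y τ).2.2.2) I t := h.snd.snd.snd
  have h1 : ContinuousWithinAt (fun τ => grp (-τ) (y τ).2.2.1) I t :=
    tendsto_grp (continuous_neg.continuousWithinAt) hp
  have h2 : ContinuousWithinAt (fun τ => grp τ (y τ).2.2.2) I t :=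
    tendsto_grp (continuous_id.continuousWithinAt) hm
  exact ContinuousWithinAt.const_smul (h1.sub h2) (-Complex.I / 2)

theorem continuousWithinAt_Vr {y : ℝ → St} {I : Set ℝ} {t : ℝ} (h : ContinuousWithinAt y I t) :
    ContinuousWithinAt (fun τ => P.Vr τ (y τ)) I t :=
  (mulOp (wt (P.r - P.s))).continuous.continuousAt.comp_continuousWithinAt (continuousWithinAt_V h)

/-- The two half-waves, after application of a multiplier of order `-1`, are differentiable. -/
theorem hasDerivWithinAt_halfWaves {n : ℝ → ℂ} (hn : IsMult n)
    (hn' : IsMult fun ξ => om ξ * n ξ) {y : ℝ → St} {I : Set ℝ} {t : ℝ}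
    (h : HasDerivWithinAt y (P.field t (y t)) I t) :
    HasDerivWithinAt (fun τ => mulOp n (grp (-τ) (y τ).2.2.1))
      (Complex.I • mulOp n (P.G t (y t))
        - Complex.I • mulOp (fun ξ => om ξ * n ξ) (grp (-t) (y t).2.2.1)) I t ∧
    HasDerivWithinAt (fun τ => mulOp n (grp τ (y τ).2.2.2))
      (-(Complex.I • mulOp n (P.G t (y t)))
        + Complex.I • mulOp (fun ξ => om ξ * n ξ) (grp t (y t).2.2.2)) I t := by
  have hcomm : ∀ (θ : ℝ) (f : L2C), mulOp n (grp θ f) = grp θ (mulOp n f) := fun θ f =>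
    mulOp_comm hn (isMult_ph θ) f
  have hcomm' : ∀ (θ : ℝ) (f : L2C), mulOp (fun ξ => om ξ * n ξ) (grp θ f)
      = grp θ (mulOp (fun ξ => om ξ * n ξ) f) := fun θ f => mulOp_comm hn' (isMult_ph θ) f
  constructor
  · have h1 := hasDerivWithinAt_grp hn hn' (-1) (hasDerivWithinAt_mulOp n (P.hasDerivWithinAt_plus h))
      rfl
    have e : ∀ τ, mulOp n (grp (-τ) (y τ).2.2.1) = grp (-1 * τ) (mulOp n (y τ).2.2.1) := fun τ => by
      rw [hcomm, neg_one_mul]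
    simp_rw [e]
    refine h1.congr_deriv (Eq.symm ?_)
    rw [map_smul, map_smul, neg_one_mul, ← hcomm (-t), grp_neg_grp, hcomm', Complex.ofReal_neg,
      Complex.ofReal_one, neg_one_mul, neg_smul, sub_eq_add_neg]
  · have h1 := hasDerivWithinAt_grp hn hn' 1 (hasDerivWithinAt_mulOp n (P.hasDerivWithinAt_minus h))
      rfl
    have e : ∀ τ, mulOp n (grp τ (y τ).2.2.2) = grp (1 * τ) (mulOp n (y τ).2.2.2) := fun τ => by
      rw [hcomm, one_mul]
    simp_rw [e]
    refine h1.congr_deriv (Eq.symm ?_)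
    rw [map_smul, map_smul, one_mul, ← hcomm t, grp_grp_neg, hcomm',
      Complex.ofReal_one, one_mul, neg_smul]

theorem hasDerivWithinAt_V {n : ℝ → ℂ} (hn : IsMult n)
    (hn' : IsMult fun ξ => om ξ * n ξ) {y : ℝ → St} {I : Set ℝ} {t : ℝ}
    (h : HasDerivWithinAt y (P.field t (y t)) I t) :
    HasDerivWithinAt (fun τ => mulOp n (V τ (y τ)))
      (mulOp (fun ξ => om ξ * n ξ) (Q t (y t))) I t := by
  obtain ⟨h1, h2⟩ := P.hasDerivWithinAt_halfWaves hn hn' h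
  have h3 := HasDerivWithinAt.const_smul (1 / 2 : ℂ) (h1.add h2)
  have e : (fun τ => mulOp n (V τ (y τ))) = (1 / 2 : ℂ) •
      ((fun τ => mulOp n (grp (-τ) (y τ).2.2.1)) + fun τ => mulOp n (grp τ (y τ).2.2.2)) := by
    funext τ
    rw [V, map_smul, map_add]; rfl
  rw [e]
  refine h3.congr_deriv ?_
  rw [Q, map_smul, map_sub]
  module

theorem hasDerivWithinAt_Q {n : ℝ → ℂ} (hn : IsMult n)
    (hn' : IsMult fun ξ => om ξ * n ξ) {y : ℝ → St} {I : Set ℝ} {t : ℝ}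
    (h : HasDerivWithinAt y (P.field t (y t)) I t) :
    HasDerivWithinAt (fun τ => mulOp n (Q τ (y τ)))
      (-mulOp (fun ξ => om ξ * n ξ) (V t (y t)) + mulOp n (P.G t (y t))) I t := by
  obtain ⟨h1, h2⟩ := P.hasDerivWithinAt_halfWaves hn hn' h
  have h3 := HasDerivWithinAt.const_smul (-Complex.I / 2 : ℂ) (h1.sub h2)
  have e : (fun τ => mulOp n (Q τ (y τ))) = (-Complex.I / 2 : ℂ) •
      ((fun τ => mulOp n (grp (-τ) (y τ).2.2.1)) - fun τ => mulOp n (grp τ (y τ).2.2.2)) := by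
    funext τ
    rw [Q, map_smul, map_sub]; rfl
  rw [e]
  refine h3.congr_deriv ?_
  rw [V, map_smul, map_add]
  set A := mulOp n (P.G t (y t))
  set Z := mulOp (fun ξ => om ξ * n ξ) (grp (-t) (y t).2.2.1)
  set W := mulOp (fun ξ => om ξ * n ξ) (grp t (y t).2.2.2)
  have e : (-Complex.I / 2) • (Complex.I • A - Complex.I • Z - (-(Complex.I • A) + Complex.I • W))
      = (-(Complex.I * Complex.I)) • A + (Complex.I * Complex.I / 2) • (Z + W) := by module
  rw [e, Complex.I_mul_I]
  module

/-- The symbol `ω (1 + ξ²)^(-s/2)`, which maps `V` to `ω v̂` and `Q` to `∂ₜ v̂`. -/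
def kap (ξ : ℝ) : ℂ := om ξ * wt (-P.s) ξ

variable {P}

theorem isMult_kap (hs : 1 ≤ P.s) : IsMult P.kap := by
  have := isMult_wt_mul_om (σ := -P.s) (by linarith)
  unfold kap
  simpa only [mul_comm] using this

variable (P)

theorem isMult_wt_neg_s : IsMult (wt (-P.s)) := isMult_wt (by linarith [P.hr, P.hrs])

/-- `û`. -/
def uh (y : St) : L2C := low P.r y.1

/-- `(1 - ∂ₓ²)^(1/2) ∂ₓ⁻¹ uₜ` on the Fourier side. -/
def xh (y : St) : L2C := low P.r y.2.1

/-- `v̂`. -/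
def vh (t : ℝ) (y : St) : L2C := mulOp (wt (-P.s)) (V t y)

theorem low_Vr (t : ℝ) (y : St) : low P.r (P.Vr t y) = P.vh t y := by
  rw [low, Vr, mulOp_mulOp (isMult_low P.hr) P.isMult_down, vh]
  congr 2; funext ξ; rw [← wt_add]; congr 1; ring

theorem low_N₁ (t : ℝ) (y : St) : low P.r (P.N₁ t y)
    = (P.c.auu : ℂ) • prodL2 P.hr y.1 (P.uh y) + (2 * P.c.auv : ℂ) • prodL2 P.hr y.1 (P.vh t y)
      + (P.c.avv : ℂ) • prodL2 P.hr (P.Vr t y) (P.vh t y) := by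
  rw [N₁, quadHr, low_add, low_add, low_smul, low_smul, low_smul, low_prodHr, low_prodHr,
    low_prodHr, low_Vr]
  rfl

theorem low_N₂ (t : ℝ) (y : St) : low P.r (P.N₂ t y)
    = (P.c.buu : ℂ) • prodL2 P.hr y.1 (P.uh y) + (2 * P.c.buv : ℂ) • prodL2 P.hr y.1 (P.vh t y)
      + (P.c.bvv : ℂ) • prodL2 P.hr (P.Vr t y) (P.vh t y) := by
  rw [N₂, quadHr, low_add, low_add, low_smul, low_smul, low_smul, low_prodHr, low_prodHr,
    low_prodHr, low_Vr]
  rfl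

theorem kap_G (hs : 1 ≤ P.s) (t : ℝ) (y : St) : mulOp P.kap (P.G t y) = low P.r (P.N₂ t y) := by
  rw [G, mulOp_mulOp (isMult_kap hs) P.isMult_up, low]
  congr 2; funext ξ
  have : P.s - P.r = P.s + -P.r := by ring
  rw [kap, this, wt_add]
  have h1 := om_ne_zero ξ
  have h2 := wt_neg_mul P.s ξ
  field_simp
  linear_combination (wt (-P.r) ξ) * h2

/-- The cubic part `∫ 𝔉(u, v) dx` of the energy. -/
def cubic (t : ℝ) (y : St) : ℝ :=
  P.c.bvv / 3 * rip (P.vh t y) (prodL2 P.hr (P.Vr t y) (P.vh t y))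
    + P.c.buu * rip (P.uh y) (prodL2 P.hr (P.Vr t y) (P.uh y))
    + P.c.buv * rip (P.uh y) (prodL2 P.hr (P.Vr t y) (P.vh t y))

/-- The energy norm `α² ‖u‖² + ‖v‖²_{H¹} + ‖vₜ‖²`, by the parallelogram law. -/
def rho (y : St) : ℝ :=
  P.c.α ^ 2 * ‖P.uh y‖ ^ 2 + 1 / 2 * (‖mulOp P.kap y.2.2.1‖ ^ 2 + ‖mulOp P.kap y.2.2.2‖ ^ 2)

/-- The energy. -/
def en (t : ℝ) (y : St) : ℝ := 1 / 2 * (‖P.xh y‖ ^ 2 + P.rho y) - P.cubic t y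

variable {P}

theorem rip_mulOp_kap_halfWave {y : St} (hs : 1 ≤ P.s) (t : ℝ) (g : L2C) :
    rip (mulOp P.kap y.2.2.1) (mulOp P.kap (Complex.I • grp t g))
      + rip (mulOp P.kap y.2.2.2) (mulOp P.kap ((-Complex.I) • grp (-t) g))
      = 2 * rip (mulOp P.kap (Q t y)) (mulOp P.kap g) := by
  have hcomm : ∀ (θ : ℝ) (f : L2C), mulOp P.kap (grp θ f) = grp θ (mulOp P.kap f) := fun θ f =>
    mulOp_comm (isMult_kap hs) (isMult_ph θ) f
  have e : ∀ (f k : L2C) (θ : ℝ), inner ℂ f (grp θ k) = inner ℂ (grp (-θ) f) k := fun f k θ => by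
    rw [inner_grp, neg_neg]
  simp only [rip, map_smul, hcomm, inner_smul_right, e, Q, map_sub, inner_smul_left,
    inner_sub_left, neg_neg]
  have : starRingEnd ℂ (-Complex.I / 2) = Complex.I / 2 := by
    rw [map_div₀, map_neg, Complex.conj_I, map_ofNat, neg_neg]
  rw [this, ← Complex.add_re, ← Complex.re_ofReal_mul]
  congr 1
  push_cast
  ring

theorem hasDerivWithinAt_uh {y : ℝ → St} {I : Set ℝ} {t : ℝ} (h₁ : P.m₁ = rz)
    (h : HasDerivWithinAt y (P.field t (y t)) I t) :
    HasDerivWithinAt (fun τ => P.uh (y τ)) (mulOp rz (P.xh (y t))) I t := by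
  have := hasDerivWithinAt_mulOp (wt (-P.r)) (P.hasDerivWithinAt_U h)
  rwa [h₁, mulOp_comm (isMult_low P.hr) isMult_rz] at this

theorem hasDerivWithinAt_vh {y : ℝ → St} {I : Set ℝ} {t : ℝ} (hs : 1 ≤ P.s)
    (h : HasDerivWithinAt y (P.field t (y t)) I t) :
    HasDerivWithinAt (fun τ => P.vh τ (y τ)) (mulOp P.kap (Q t (y t))) I t :=
  P.hasDerivWithinAt_V P.isMult_wt_neg_s (isMult_kap hs) h

/-- Conservation of energy. Reality of the solution enters through the symmetry of the
multiplication operators `û * ·` and `v̂ * ·`, which makes the cubic part a function of `(u, v)` with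
gradient `(-f₁, f₂)`. -/
theorem hasDerivWithinAt_en {y : ℝ → St} {I : Set ℝ} {t : ℝ} (h₁ : P.m₁ = rz) (h₂ : P.m₂ = rz)
    (hs : 1 ≤ P.s) (hauu : P.c.auu = 0) (hB : P.c.buu = -P.c.auv) (hC : P.c.buv = -P.c.avv)
    (hreal : conjSt (y t) = y t) (h : HasDerivWithinAt y (P.field t (y t)) I t) :
    HasDerivWithinAt (fun τ => P.en τ (y τ)) 0 I t := by
  have hU : refl (y t).1 = (y t).1 := congrArg Prod.fst hreal
  have hV : refl (P.Vr t (y t)) = P.Vr t (y t) := by rw [← Vr_conjSt, hreal]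
  have dU := P.hasDerivWithinAt_U h
  have da := hasDerivWithinAt_uh h₁ h
  have dc := hasDerivWithinAt_vh hs h
  have db : HasDerivWithinAt (fun τ => P.xh (y τ)) (mulOp rz
      (((P.c.α ^ 2 : ℝ) : ℂ) • P.uh (y t) + low P.r (P.N₁ t (y t)))) I t := by
    have := hasDerivWithinAt_mulOp (wt (-P.r)) (P.hasDerivWithinAt_snd h)
    rwa [h₂, mulOp_comm (isMult_low P.hr) isMult_rz, map_add, map_smul] at this
  have dp := hasDerivWithinAt_norm_sq (hasDerivWithinAt_mulOp P.kap (P.hasDerivWithinAt_plus h))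
  have dm := hasDerivWithinAt_norm_sq (hasDerivWithinAt_mulOp P.kap (P.hasDerivWithinAt_minus h))
  have hVc := P.continuousWithinAt_Vr h.continuousWithinAt
  have dc' : HasDerivWithinAt (fun τ => low P.r (P.Vr τ (y τ))) (mulOp P.kap (Q t (y t))) I t := by
    simp_rw [low_Vr]; exact dc
  have dVc := hasDerivWithinAt_prodL2 P.hr hVc dc' dc'
  have dVa := hasDerivWithinAt_prodL2 P.hr hVc dc' da
  simp_rw [low_Vr] at dVc
  have key := ((hasDerivWithinAt_norm_sq db).add (((hasDerivWithinAt_norm_sq da).const_mul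
    (P.c.α ^ 2)).add ((dp.add dm).const_mul (1 / 2)))).const_mul (1 / 2) |>.sub
    ((((hasDerivWithinAt_rip dc dVc).const_mul (P.c.bvv / 3)).add
      ((hasDerivWithinAt_rip da dVa).const_mul P.c.buu)).add
      ((hasDerivWithinAt_rip da dVc).const_mul P.c.buv))
  refine key.congr_deriv ?_
  -- abbreviations for the components of the state and their time derivatives
  have hpm := rip_mulOp_kap_halfWave (y := y t) hs t (P.G t (y t))
  rw [kap_G P hs] at hpm
  have hn1 := P.low_N₁ t (y t)
  have hn2 := P.low_N₂ t (y t)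
  set a := P.uh (y t) with ha
  set c := P.vh t (y t) with hc
  set q := mulOp P.kap (Q t (y t)) with hq
  set b := P.xh (y t) with hb
  set a' := mulOp rz b with ha'
  set F := P.Vr t (y t) with hF
  set U := (y t).1 with hU'
  set K := prodL2 P.hr with hK
  have hUc : K U c = K F a := by
    rw [hc, ← P.low_Vr, hK, prodL2_low_comm]; rfl
  have sF : ∀ g k, rip g (K F k) = rip (K F g) k := fun g k => by
    rw [rip, rip, hK, inner_prodL2 P.hr hV]
  have sU : ∀ g k, rip g (K U k) = rip (K U g) k := fun g k => by
    rw [rip, rip, hK, inner_prodL2 P.hr hU]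
  have skew : ∀ k, rip b (mulOp rz k) = -rip a' k := fun k => by
    have e : mulOp (fun ξ => starRingEnd ℂ (rz ξ)) k = -mulOp rz k := by
      rw [mulOp_smul_symbol (m := fun ξ => starRingEnd ℂ (rz ξ)) isMult_rz (-1)
        (fun ξ => by rw [conj_rz, neg_one_mul]), neg_one_smul]
    rw [ha', rip, rip, inner_mulOp isMult_rz, e, inner_neg_right, Complex.neg_re, neg_neg]
  have hlowU : low P.r U = a := rfl
  have hlow2 : ∀ g : L2C, rip q g = rip g q := fun g => rip_comm _ _
  have two : ∀ x : ℝ, (2 * x : ℂ) = ((2 * x : ℝ) : ℂ) := fun x => by push_cast; ring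
  rw [skew, hn1, hlowU]
  rw [hn2] at hpm
  simp only [two, rip_add_right, rip_smul_right, hauu, hUc] at hpm ⊢
  have e1 : rip c (K F q) = rip q (K F c) := by rw [sF, rip_comm]
  have e2 : rip a (K F a') = rip a' (K F a) := by rw [sF, rip_comm]
  have e3 : rip a (K U q) = rip q (K U a) := by rw [sU, rip_comm]
  have e4 : rip a (K F q) = rip q (K F a) := by rw [sF, rip_comm]
  have e5 : rip a a' = rip a' a := rip_comm _ _
  rw [e1, e2, e3, e4, e5, hB, hC]
  rw [hB, hC] at hpm
  linear_combination ((1 : ℝ) / 2) * hpm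

theorem en_eq {T : ℝ} {y : ℝ → St} (h₁ : P.m₁ = rz) (h₂ : P.m₂ = rz)
    (hs : 1 ≤ P.s) (hauu : P.c.auu = 0) (hB : P.c.buu = -P.c.auv) (hC : P.c.buv = -P.c.avv)
    (hreal : conjSt (y 0) = y 0) (h : IsODESol P.field T y) {t : ℝ} (ht : t ∈ Icc 0 T) :
    P.en t (y t) = P.en 0 (y 0) := by
  have hd : ∀ t ∈ Icc 0 T, HasDerivWithinAt (fun τ => P.en τ (y τ)) 0 (Icc 0 T) t :=
    fun t ht => hasDerivWithinAt_en h₁ h₂ hs hauu hB hC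
      (P.conjSt_eq_of_isODESol h hreal ht) (h t ht)
  refine constant_of_has_deriv_right_zero (f := fun τ => P.en τ (y τ))
    (fun t ht => (hd t ht).continuousWithinAt)
    (fun t ht => hasDerivWithinAt_Ici_of_Icc ht (hd t (Ico_subset_Icc_self ht))) t ht

end Sys

end Energy

/-! ### A priori bounds and global solutions of the first-order system -/

section APriori

theorem norm_le_gronwallBound_of_Icc {E : Type*} [NormedAddCommGroup E] [NormedSpace ℝ E]
    {f f' : ℝ → E} {τ T L ε : ℝ} (hτ : τ ≤ T) (hL : 0 ≤ L) (hε : 0 ≤ ε)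
    (hd : ∀ t ∈ Icc 0 τ, HasDerivWithinAt f (f' t) (Icc 0 τ) t)
    (hb : ∀ t ∈ Icc 0 τ, ‖f' t‖ ≤ L * ‖f t‖ + ε) {t : ℝ} (ht : t ∈ Icc 0 τ) :
    ‖f t‖ ≤ gronwallBound ‖f 0‖ L ε T := by
  have h := norm_le_gronwallBound_of_norm_deriv_right_le (f := f) (f' := f') (δ := ‖f 0‖) (K := L)
    (ε := ε) (a := 0) (b := τ) (fun t ht => (hd t ht).continuousWithinAt)
    (fun t ht => hasDerivWithinAt_Ici_of_Icc ht (hd t (Ico_subset_Icc_self ht))) le_rfl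
    (fun t ht => hb t (Ico_subset_Icc_self ht)) t ht
  refine h.trans (gronwallBound_mono (norm_nonneg _) hε hL ?_)
  linarith [ht.2]

namespace Sys

variable {P : Sys}

theorem norm_kap_V_sq_le (hs : 1 ≤ P.s) (t : ℝ) (y : St) : ‖mulOp P.kap (V t y)‖ ^ 2
    ≤ 1 / 2 * (‖mulOp P.kap y.2.2.1‖ ^ 2 + ‖mulOp P.kap y.2.2.2‖ ^ 2) := by
  have hcomm : ∀ (θ : ℝ) (f : L2C), mulOp P.kap (grp θ f) = grp θ (mulOp P.kap f) := fun θ f =>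
    mulOp_comm (isMult_kap hs) (isMult_ph θ) f
  have h : ‖mulOp P.kap (V t y)‖ ≤ 1 / 2 * (‖mulOp P.kap y.2.2.1‖ + ‖mulOp P.kap y.2.2.2‖) := by
    rw [V, map_smul, map_add, hcomm, hcomm, norm_smul]
    have := norm_add_le (grp (-t) (mulOp P.kap y.2.2.1)) (grp t (mulOp P.kap y.2.2.2))
    rw [norm_grp, norm_grp] at this
    have e : ‖(1 / 2 : ℂ)‖ = 1 / 2 := by norm_num
    rw [e]
    linarith
  have h0 := norm_nonneg (mulOp P.kap (V t y))
  nlinarith [sq_nonneg (‖mulOp P.kap y.2.2.1‖ - ‖mulOp P.kap y.2.2.2‖)]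

theorem norm_vh_le (hs : 1 ≤ P.s) (t : ℝ) (y : St) : ‖P.vh t y‖ ≤ ‖mulOp P.kap (V t y)‖ := by
  have e : P.vh t y = mulOp (fun ξ => 1 / (om ξ : ℂ)) (mulOp P.kap (V t y)) := by
    rw [mulOp_mulOp isMult_inv_om (isMult_kap hs), vh]
    congr 2; funext ξ
    rw [kap]; field_simp [om_ne_zero ξ]
  rw [e]
  refine (norm_mulOp_le isMult_inv_om (C := 1) (fun ξ => ?_) _).trans_eq (one_mul _)
  rw [norm_div, norm_one, norm_om, div_le_one (om_pos ξ)]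
  exact one_le_om ξ

/-- The embedding of `H¹` into the space of functions with integrable Fourier transform. -/
theorem norm_l1Map_Vr_le (hs : 1 ≤ P.s) (t : ℝ) (y : St) :
    ‖l1Map P.hr (P.Vr t y)‖ ≤ wtNorm 1 * ‖mulOp P.kap (V t y)‖ := by
  have h1 : (1 : ℝ) / 2 < 1 := by norm_num
  have hm := isMult_wt_div_om (σ := 1) le_rfl
  have e : low P.r (P.Vr t y)
      = low 1 (mulOp (fun ξ => wt 1 ξ / (om ξ : ℂ)) (mulOp P.kap (V t y))) := by
    rw [low_Vr, vh, mulOp_mulOp hm (isMult_kap hs), low, mulOp_mulOp (isMult_low h1)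
      (hm.mul (isMult_kap hs))]
    congr 2; funext ξ
    have h2 := wt_neg_mul 1 ξ
    rw [kap]
    field_simp [om_ne_zero ξ]
    linear_combination (-wt (-P.s) ξ) * h2
  rw [norm_l1Map_eq_of_low_eq P.hr h1 e]
  refine (norm_l1Map_le h1 _).trans (mul_le_mul_of_nonneg_left ?_ (wtNorm_nonneg 1))
  refine (norm_mulOp_le hm (C := 1) (fun ξ => ?_) _).trans_eq (one_mul _)
  rw [norm_div, norm_om, div_le_one (om_pos ξ)]
  exact norm_wt_one_le_om ξ

theorem norm_kap_V_le (hs : 1 ≤ P.s) (t : ℝ) (y : St) :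
    ‖mulOp P.kap (V t y)‖ ≤ √(P.rho y) := by
  refine Real.le_sqrt_of_sq_le ((norm_kap_V_sq_le hs t y).trans ?_)
  unfold rho
  have : 0 ≤ P.c.α ^ 2 * ‖P.uh y‖ ^ 2 := by positivity
  linarith

theorem norm_uh_le (hα : P.c.α ≠ 0) (y : St) : ‖P.uh y‖ ≤ √(P.rho y) / |P.c.α| := by
  rw [le_div_iff₀ (abs_pos.2 hα)]
  refine Real.le_sqrt_of_sq_le ?_
  rw [mul_pow, sq_abs]
  unfold rho
  have : 0 ≤ 1 / 2 * (‖mulOp P.kap y.2.2.1‖ ^ 2 + ‖mulOp P.kap y.2.2.2‖ ^ 2) := by positivity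
  linarith

end Sys

/-- A constant in the estimate of the cubic part of the energy by the energy norm. -/
def cubeConst (c : Coeffs) : ℝ :=
  wtNorm 1 * (|c.bvv| + |c.buu| / |c.α| ^ 2 + |c.buv| / |c.α|) + 1

theorem cubeConst_pos (c : Coeffs) : 0 < cubeConst c := by
  have := wtNorm_nonneg 1
  unfold cubeConst; positivity

namespace Sys

variable {P : Sys}

theorem abs_cubic_le (hα : P.c.α ≠ 0) (hs : 1 ≤ P.s) (t : ℝ) (y : St) :
    |P.cubic t y| ≤ cubeConst P.c * √(P.rho y) ^ 3 := by
  set x := √(P.rho y) with hx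
  have hx0 : 0 ≤ x := Real.sqrt_nonneg _
  have hα' := abs_pos.2 hα
  have hw := wtNorm_nonneg 1
  have hv : ‖P.vh t y‖ ≤ x := (norm_vh_le hs t y).trans (norm_kap_V_le hs t y)
  have hu : ‖P.uh y‖ ≤ x / |P.c.α| := norm_uh_le hα y
  have hl : ‖l1Map P.hr (P.Vr t y)‖ ≤ wtNorm 1 * x :=
    (norm_l1Map_Vr_le hs t y).trans (mul_le_mul_of_nonneg_left (norm_kap_V_le hs t y) hw)
  have key : ∀ f g : L2C, |rip f (prodL2 P.hr (P.Vr t y) g)| ≤ ‖f‖ * (wtNorm 1 * x * ‖g‖) :=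
    fun f g => (abs_rip_le _ _).trans (mul_le_mul_of_nonneg_left ((norm_prodL2_le _ _ _).trans
      (mul_le_mul_of_nonneg_right hl (norm_nonneg _))) (norm_nonneg _))
  unfold cubic
  refine (abs_add_three _ _ _).trans ?_
  rw [abs_mul, abs_mul, abs_mul, abs_div, abs_of_pos (three_pos : (0 : ℝ) < 3)]
  calc _ ≤ |P.c.bvv| / 3 * (x * (wtNorm 1 * x * x))
        + |P.c.buu| * (x / |P.c.α| * (wtNorm 1 * x * (x / |P.c.α|)))
        + |P.c.buv| * (x / |P.c.α| * (wtNorm 1 * x * x)) := by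
        gcongr
        · exact (key _ _).trans (by gcongr)
        · exact (key _ _).trans (by gcongr)
        · exact (key _ _).trans (by gcongr)
    _ ≤ |P.c.bvv| * (x * (wtNorm 1 * x * x))
        + |P.c.buu| * (x / |P.c.α| * (wtNorm 1 * x * (x / |P.c.α|)))
        + |P.c.buv| * (x / |P.c.α| * (wtNorm 1 * x * x)) + x ^ 3 := by
        have h1 : 0 ≤ |P.c.bvv| * (x * (wtNorm 1 * x * x)) := by positivity
        have h2 : 0 ≤ x ^ 3 := by positivity
        linarith
    _ = cubeConst P.c * x ^ 3 := by
        unfold cubeConst; field_simp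

/-- The potential well: when the energy norm `rho` has its critical value, the energy is at least
one sixth of that value, so that by conservation of energy `rho` cannot reach it. -/
theorem rho_lt {T : ℝ} {y : ℝ → St} (h₁ : P.m₁ = rz) (h₂ : P.m₂ = rz) (hα : P.c.α ≠ 0)
    (hs : 1 ≤ P.s) (hauu : P.c.auu = 0) (hB : P.c.buu = -P.c.auv) (hC : P.c.buv = -P.c.avv)
    (hreal : conjSt (y 0) = y 0) (h : IsODESol P.field T y)
    (hE : P.en 0 (y 0) < 1 / 6 * (1 / (3 * cubeConst P.c)) ^ 2)
    (hρ : P.rho (y 0) < (1 / (3 * cubeConst P.c)) ^ 2) {t : ℝ} (ht : t ∈ Icc 0 T) :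
    P.rho (y t) < (1 / (3 * cubeConst P.c)) ^ 2 := by
  by_contra! hlt
  have hc : ContinuousOn (fun τ => P.rho (y τ)) (Icc 0 t) := by
    have hy : ContinuousOn y (Icc 0 t) := h.continuousOn.mono (Icc_subset_Icc_right ht.2)
    have h1 : Continuous fun z : St => P.rho z := by unfold rho uh; fun_prop
    exact h1.comp_continuousOn hy
  obtain ⟨τ, hτ, hτe⟩ := intermediate_value_Icc ht.1 hc ⟨hρ.le, hlt⟩
  have hK := cubeConst_pos P.c
  have e := en_eq h₁ h₂ hs hauu hB hC hreal h ⟨hτ.1, hτ.2.trans ht.2⟩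
  have hcub := abs_le.1 (abs_cubic_le hα hs τ (y τ))
  simp only at hτe
  rw [hτe, Real.sqrt_sq (by positivity)] at hcub
  rw [← e, en, hτe] at hE
  have e3 : cubeConst P.c * (1 / (3 * cubeConst P.c)) ^ 3
      = 1 / 3 * (1 / (3 * cubeConst P.c)) ^ 2 := by field_simp
  rw [e3] at hcub
  nlinarith [sq_nonneg ‖P.xh (y τ)‖]

/-- The equations for `u` and `x` are linear in `(u, x)` since `a_uu = 0`, so that a bound for `v`
gives a bound for `(u, x)` in the algebra of functions with integrable Fourier transform. -/
theorem exists_l1_bound (h₁ : P.m₁ = rz) (h₂ : P.m₂ = rz) (hauu : P.c.auu = 0) (x₀ : St)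
    {W : ℝ} (hW : 0 ≤ W) (T : ℝ) : ∃ A : ℝ, 0 ≤ A ∧ ∀ τ ≤ T, ∀ y : ℝ → St, y 0 = x₀ →
      IsODESol P.field τ y → (∀ t ∈ Icc 0 τ, ‖l1Map P.hr (P.Vr t (y t))‖ ≤ W) →
      ∀ t ∈ Icc 0 τ, ‖l1Map P.hr (y t).1‖ ≤ A := by
  set L := 1 + P.c.α ^ 2 + 2 * |P.c.auv| * W with hL
  set ε := |P.c.avv| * (W * W) with hε
  have hL0 : 0 ≤ L := by positivity
  have hε0 : 0 ≤ ε := by positivity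
  let Λ : L2C →L[ℝ] L1C := (l1Map P.hr).restrictScalars ℝ
  refine ⟨max 0 (gronwallBound ‖(Λ x₀.1, Λ x₀.2.1)‖ L ε T), le_max_left _ _,
    fun τ hτ y h0 h hV t ht => le_max_of_le_right ?_⟩
  rw [← h0]
  have hd : ∀ t ∈ Icc 0 τ, HasDerivWithinAt (fun t => (Λ (y t).1, Λ (y t).2.1))
      (Λ (mulOp P.m₁ (y t).2.1),
        Λ (mulOp P.m₂ (((P.c.α ^ 2 : ℝ) : ℂ) • (y t).1 + P.N₁ t (y t)))) (Icc 0 τ) t :=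
    fun t ht => (Λ.hasFDerivAt.comp_hasDerivWithinAt t (P.hasDerivWithinAt_U (h t ht))).prodMk
      (Λ.hasFDerivAt.comp_hasDerivWithinAt t (P.hasDerivWithinAt_snd (h t ht)))
  refine (norm_fst_le (Λ (y t).1, Λ (y t).2.1)).trans
    (norm_le_gronwallBound_of_Icc hτ hL0 hε0 hd (fun t ht => ?_) ht)
  have hU : ‖Λ (y t).1‖ ≤ ‖(Λ (y t).1, Λ (y t).2.1)‖ :=
    norm_fst_le (Λ (y t).1, Λ (y t).2.1)
  have hX : ‖Λ (y t).2.1‖ ≤ ‖(Λ (y t).1, Λ (y t).2.1)‖ :=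
    norm_snd_le (Λ (y t).1, Λ (y t).2.1)
  have hn := norm_nonneg (Λ (y t).1, Λ (y t).2.1)
  set n := ‖(Λ (y t).1, Λ (y t).2.1)‖
  have hα := sq_nonneg P.c.α
  have hp : 0 ≤ |P.c.auv| * W * n := by positivity
  rw [h₁, h₂]
  refine max_le ?_ ?_
  · refine (norm_l1Map_mulOp_le P.hr isMult_rz norm_rz_le _).trans ?_
    rw [one_mul]
    have : ‖l1Map P.hr (y t).2.1‖ ≤ n := hX
    nlinarith [mul_nonneg hα hn]
  · refine (norm_l1Map_mulOp_le P.hr isMult_rz norm_rz_le _).trans ?_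
    rw [one_mul, map_add, map_smul]
    refine (norm_add_le _ _).trans ?_
    rw [norm_smul, Complex.norm_real, Real.norm_of_nonneg hα]
    have hU' : ‖l1Map P.hr (y t).1‖ ≤ n := hU
    have hN := norm_l1Map_quadHr_le P.hr P.c.auu P.c.auv P.c.avv (y t).1 (P.Vr t (y t))
    rw [hauu, abs_zero, zero_mul, zero_add] at hN
    have hN' : ‖l1Map P.hr (P.N₁ t (y t))‖ ≤ 2 * |P.c.auv| * (n * W) + ε := by
      rw [N₁, hauu]
      refine hN.trans ?_
      rw [hε]
      have := hV t ht
      gcongr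
    have h3 := mul_le_mul_of_nonneg_left hU' hα
    rw [hL]
    nlinarith

/-- By the tame estimate the vector field grows at most linearly as long as `u` and `v` are bounded
in the algebra of functions with integrable Fourier transform. -/
theorem exists_bound_of_l1_bound (P : Sys) (x₀ : St) {A : ℝ} (hA : 0 ≤ A) (T : ℝ) :
    ∃ R : ℝ, ∀ τ ≤ T, ∀ y : ℝ → St, y 0 = x₀ → IsODESol P.field τ y →
      (∀ t ∈ Icc 0 τ, ‖l1Map P.hr (y t).1‖ + ‖l1Map P.hr (P.Vr t (y t))‖ ≤ A) →
      ∀ t ∈ Icc 0 τ, ‖y t‖ ≤ R := by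
  obtain ⟨M, hM, hm₁, hm₂⟩ := P.exists_mult_bound
  set k₁ := 2 ^ P.r * quadConst P.c.auu P.c.auv P.c.avv * 2 with hk₁
  set k₂ := 2 ^ P.r * quadConst P.c.buu P.c.buv P.c.bvv * 2 with hk₂
  have hq₁ := quadConst_nonneg P.c.auu P.c.auv P.c.avv
  have hq₂ := quadConst_nonneg P.c.buu P.c.buv P.c.bvv
  have hk₁0 : 0 ≤ k₁ := by positivity
  have hk₂0 : 0 ≤ k₂ := by positivity
  set L := M * ((1 + P.c.α ^ 2) + k₁ * (A * 2)) + k₂ * (A * 2) with hL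
  refine ⟨gronwallBound ‖x₀‖ L 0 T, fun τ hτ y h0 h hb t ht => ?_⟩
  rw [← h0]
  refine norm_le_gronwallBound_of_Icc hτ (by positivity) le_rfl h (fun t ht => ?_) ht
  have hsum : ‖(y t).1‖ + ‖P.Vr t (y t)‖ ≤ 2 * ‖y t‖ := by
    have h1 : ‖(y t).1‖ ≤ ‖y t‖ := norm_fst_le _
    linarith [P.norm_Vr_le t (y t)]
  have hq : ∀ k, 0 ≤ k → k * ((‖l1Map P.hr (y t).1‖ + ‖l1Map P.hr (P.Vr t (y t))‖)
      * (‖(y t).1‖ + ‖P.Vr t (y t)‖)) ≤ k * (A * (2 * ‖y t‖)) := fun k hk => by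
    have := hb t ht
    gcongr
  refine (P.norm_field_le hM hm₁ hm₂ t (y t) ((norm_quadHr_le _ _ _ _ _ _).trans (hq _ hk₁0))
    ((norm_quadHr_le _ _ _ _ _ _).trans (hq _ hk₂0))).trans_eq ?_
  rw [hL]; ring

/-- Global existence for the first-order system, for data in the potential well. -/
theorem exists_global {x₀ : St} (h₁ : P.m₁ = rz) (h₂ : P.m₂ = rz) (hα : P.c.α ≠ 0)
    (hs : 1 ≤ P.s) (hauu : P.c.auu = 0) (hB : P.c.buu = -P.c.auv) (hC : P.c.buv = -P.c.avv)
    (hreal : conjSt x₀ = x₀) (hE : P.en 0 x₀ < 1 / 6 * (1 / (3 * cubeConst P.c)) ^ 2)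
    (hρ : P.rho x₀ < (1 / (3 * cubeConst P.c)) ^ 2) :
    ∃ y : ℝ → St, y 0 = x₀ ∧ ∀ t ∈ Ici (0 : ℝ),
      HasDerivWithinAt y (P.field t (y t)) (Ici 0) t := by
  refine exists_global_ODESol P.isLocLipField x₀ fun T => ?_
  have hK := cubeConst_pos P.c
  have hw := wtNorm_nonneg 1
  set W := wtNorm 1 * (1 / (3 * cubeConst P.c)) with hW
  have hW0 : 0 ≤ W := by positivity
  obtain ⟨A, hA, hA'⟩ := exists_l1_bound h₁ h₂ hauu x₀ hW0 T
  obtain ⟨R, hR⟩ := P.exists_bound_of_l1_bound x₀ (add_nonneg hA hW0) T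
  refine ⟨R, fun τ hτ y h0 h => ?_⟩
  have hV : ∀ t ∈ Icc 0 τ, ‖l1Map P.hr (P.Vr t (y t))‖ ≤ W := fun t ht => by
    subst h0
    have hlt := rho_lt h₁ h₂ hα hs hauu hB hC hreal h hE hρ ht
    refine (norm_l1Map_Vr_le hs t (y t)).trans (mul_le_mul_of_nonneg_left ?_ hw)
    refine (norm_kap_V_le hs t (y t)).trans (Real.sqrt_le_iff.2 ⟨by positivity, hlt.le⟩)
  exact hR τ hτ.2 y h0 h fun t ht => add_le_add (hA' τ hτ.2 y h0 h hV t ht) (hV t ht)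

end Sys

end APriori

/-! ### Tempered distributions with square integrable Fourier representatives -/

section Distributions

open scoped LineDeriv

theorem hasTemperateGrowth_wt (σ : ℝ) : (wt σ).HasTemperateGrowth := by
  unfold wt; fun_prop

theorem injective_toTemperedDistribution :
    Function.Injective (fun G : L2C => (Lp.toTemperedDistribution G : 𝓢'(ℝ, ℂ))) := by
  have h := Lp.ker_toTemperedDistributionCLM_eq_bot (F := ℂ) (μ := (volume : Measure ℝ)) (p := 2)
  exact LinearMap.ker_eq_bot.1 h

theorem smulLeftCLM_toTemperedDistribution {m : ℝ → ℂ} (hm : IsMult m) (ht : m.HasTemperateGrowth)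
    (G : L2C) : TemperedDistribution.smulLeftCLM ℂ m (Lp.toTemperedDistribution G)
      = Lp.toTemperedDistribution (mulOp m G) := by
  ext φ
  rw [TemperedDistribution.smulLeftCLM_apply_apply, Lp.toTemperedDistribution_apply,
    Lp.toTemperedDistribution_apply]
  refine integral_congr_ae ?_
  filter_upwards [coeFn_mulOp hm G] with ξ h
  rw [h, SchwartzMap.smulLeftCLM_apply_apply ht]
  simp only [smul_eq_mul]; ring

/-- The distribution `f` belongs to `H^σ`, and `G = (1 + ξ²)^(σ/2) f̂`. -/
def Rep (σ : ℝ) (f : 𝓢'(ℝ, ℂ)) (G : L2C) : Prop :=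
  TemperedDistribution.smulLeftCLM ℂ (wt σ) (𝓕 f) = Lp.toTemperedDistribution G

variable {σ τ : ℝ} {f g : 𝓢'(ℝ, ℂ)} {F G : L2C}

theorem sobolevRep_iff {k : L2C} : SobolevRep σ f k ↔ Rep σ f (𝓕 k) := by
  rw [SobolevRep, Rep, ← Lp.fourier_toTemperedDistribution_eq]
  have h := TemperedDistribution.fourier_besselPotential_eq_smulLeftCLM_fourier_apply σ f
  change _ = TemperedDistribution.smulLeftCLM ℂ (wt σ) (𝓕 f) at h
  rw [← h]
  constructor
  · intro h; rw [h]
  · intro h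
    have := congrArg (fun k : 𝓢'(ℝ, ℂ) => 𝓕⁻ k) h
    simpa only [FourierTransform.fourierInv_fourier_eq] using this

theorem rep_iff : Rep σ f G ↔ SobolevRep σ f (𝓕⁻ G) := by
  rw [sobolevRep_iff, FourierTransform.fourier_fourierInv_eq]

theorem smulLeftCLM_wt_wt (σ τ : ℝ) (f : 𝓢'(ℝ, ℂ)) :
    TemperedDistribution.smulLeftCLM ℂ (wt τ) (TemperedDistribution.smulLeftCLM ℂ (wt σ) f)
      = TemperedDistribution.smulLeftCLM ℂ (wt (σ + τ)) f := by
  rw [TemperedDistribution.smulLeftCLM_smulLeftCLM_apply (hasTemperateGrowth_wt σ)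
    (hasTemperateGrowth_wt τ)]
  congr 2; funext ξ; rw [wt_add]; rfl

theorem smulLeftCLM_wt_zero (f : 𝓢'(ℝ, ℂ)) :
    TemperedDistribution.smulLeftCLM ℂ (wt 0) f = f := by
  have : wt 0 = fun _ => 1 := funext wt_zero
  rw [this, TemperedDistribution.smulLeftCLM_const, one_smul]

theorem Rep.fourier_eq (h : Rep σ f G) :
    𝓕 f = TemperedDistribution.smulLeftCLM ℂ (wt (-σ)) (Lp.toTemperedDistribution G) := by
  rw [← h, smulLeftCLM_wt_wt, add_neg_cancel, smulLeftCLM_wt_zero]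

theorem Rep.ext (hf : Rep σ f G) (hg : Rep σ g G) : f = g := by
  have h : 𝓕 f = 𝓕 g := by rw [hf.fourier_eq, hg.fourier_eq]
  have := congrArg (fun k : 𝓢'(ℝ, ℂ) => 𝓕⁻ k) h
  simpa only [FourierTransform.fourierInv_fourier_eq] using this

theorem Rep.unique (hF : Rep σ f F) (hG : Rep σ f G) : F = G :=
  injective_toTemperedDistribution (hF.symm.trans hG)

theorem Rep.add (hf : Rep σ f F) (hg : Rep σ g G) : Rep σ (f + g) (F + G) := by
  unfold Rep at *
  rw [FourierTransform.fourier_add, map_add, hf, hg]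
  exact (map_add (Lp.toTemperedDistributionCLM ℂ volume 2) F G).symm

theorem Rep.smul (c : ℂ) (hf : Rep σ f F) : Rep σ (c • f) (c • F) := by
  unfold Rep at *
  rw [FourierTransform.fourier_smul, map_smul, hf]
  exact (map_smul (Lp.toTemperedDistributionCLM ℂ volume 2) c F).symm

theorem Rep.sub (hf : Rep σ f F) (hg : Rep σ g G) : Rep σ (f - g) (F - G) := by
  have h := hf.add (hg.smul (-1))
  have e : f - g = f + (-1 : ℂ) • g := by
    ext φ
    change f φ - g φ = f φ + (-1 : ℂ) * g φ
    ring
  rwa [neg_one_smul, ← sub_eq_add_neg, ← e] at h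

/-- Evaluation of the Fourier transform on test functions. -/
theorem Rep.fourier_apply (h : Rep σ f G) (φ : 𝓢(ℝ, ℂ)) :
    Integrable (fun ξ => φ ξ * (wt (-σ) ξ * G ξ)) volume ∧
      𝓕 f φ = ∫ ξ, φ ξ * (wt (-σ) ξ * G ξ) := by
  have e : ∀ ξ, SchwartzMap.smulLeftCLM ℂ (wt (-σ)) φ ξ * G ξ = φ ξ * (wt (-σ) ξ * G ξ) :=
    fun ξ => by
      rw [SchwartzMap.smulLeftCLM_apply_apply (hasTemperateGrowth_wt _), smul_eq_mul]; ring
  constructor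
  · have := ((SchwartzMap.smulLeftCLM ℂ (wt (-σ)) φ).memLp 2 volume).integrable_mul (Lp.memLp G)
    exact this.congr (Filter.Eventually.of_forall e)
  · rw [h.fourier_eq, TemperedDistribution.smulLeftCLM_apply_apply,
      Lp.toTemperedDistribution_apply]
    exact integral_congr_ae (Filter.Eventually.of_forall e)

/-- Fourier multipliers act on the representatives. -/
theorem Rep.multiplier (h : Rep σ f G) {n : ℝ → ℂ} (hn : n.HasTemperateGrowth)
    (hm : IsMult fun ξ => wt (τ - σ) ξ * n ξ)
    (hg : 𝓕 g = TemperedDistribution.smulLeftCLM ℂ n (𝓕 f)) :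
    Rep τ g (mulOp (fun ξ => wt (τ - σ) ξ * n ξ) G) := by
  have hτ := hasTemperateGrowth_wt τ
  have hσ := hasTemperateGrowth_wt (τ - σ)
  have ht : (fun ξ => wt (τ - σ) ξ * n ξ).HasTemperateGrowth := by fun_prop
  rw [Rep, hg, ← smulLeftCLM_toTemperedDistribution hm ht, ← h,
    TemperedDistribution.smulLeftCLM_smulLeftCLM_apply hn hτ,
    TemperedDistribution.smulLeftCLM_smulLeftCLM_apply (hasTemperateGrowth_wt σ) ht]
  congr 2; funext ξ
  have : wt τ ξ = wt σ ξ * wt (τ - σ) ξ := by rw [← wt_add]; congr 1; ring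
  simp only [Pi.mul_apply, this]; ring

theorem Rep.mono (h : Rep σ f G) (hτ : τ ≤ σ) : Rep τ f (mulOp (wt (τ - σ)) G) := by
  have e : (fun ξ => wt (τ - σ) ξ * 1) = wt (τ - σ) := funext fun ξ => mul_one _
  have := h.multiplier (τ := τ) (g := f) (n := fun _ => 1) (by fun_prop)
    (by rw [e]; exact isMult_wt (by linarith))
    (by rw [TemperedDistribution.smulLeftCLM_const, one_smul])
  rwa [e] at this

/-- A distribution of lower order whose representative decays accordingly has higher order. -/
theorem Rep.raise (hτ : τ ≤ σ) (h : Rep τ f (mulOp (wt (τ - σ)) G)) : Rep σ f G := by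
  rw [Rep, h.fourier_eq, ← smulLeftCLM_toTemperedDistribution (isMult_wt (by linarith))
    (hasTemperateGrowth_wt _), smulLeftCLM_wt_wt, smulLeftCLM_wt_wt]
  have : τ - σ + (-τ + σ) = 0 := by ring
  rw [this, smulLeftCLM_wt_zero]

theorem Rep.zero_iff : Rep 0 f G ↔ 𝓕 f = Lp.toTemperedDistribution G := by
  rw [Rep, smulLeftCLM_wt_zero]

/-- The symbol `2πiξ (1 + ξ²)^(-1/2)` of `∂ₓ`, as an operator of order zero. -/
def dz (ξ : ℝ) : ℂ := wt (-1) ξ * ((2 * Real.pi * ξ : ℝ) * Complex.I)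

theorem dz_eq (ξ : ℝ) : dz ξ = wt (-1) ξ * om ξ * rz ξ := by
  have := om_ne_zero ξ
  rw [dz, rz]; field_simp

theorem isMult_dz : IsMult dz := by
  have := (isMult_wt_mul_om (σ := -1) le_rfl).mul isMult_rz
  have e : dz = fun ξ => wt (-1) ξ * om ξ * rz ξ := funext dz_eq
  rwa [e]

theorem fourier_Dx (f : 𝓢'(ℝ, ℂ)) : 𝓕 (Dx f) = TemperedDistribution.smulLeftCLM ℂ
    (fun ξ => ((2 * Real.pi * ξ : ℝ) * Complex.I : ℂ)) (𝓕 f) := by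
  have e : Dx f = ∂_{(1 : ℝ)} f := by
    ext φ
    rw [TemperedDistribution.derivCLM_apply_apply, TemperedDistribution.lineDerivOp_apply_apply]
    congr 2
  rw [e, TemperedDistribution.fourier_lineDerivOp_eq]
  have ht : (fun ξ : ℝ => ((inner ℝ ξ 1 : ℝ) : ℂ)).HasTemperateGrowth := by fun_prop
  rw [← smul_apply, ← TemperedDistribution.smulLeftCLM_smul ht]
  have : (2 * Real.pi * Complex.I : ℂ) • (fun ξ : ℝ => ((inner ℝ ξ 1 : ℝ) : ℂ))
      = fun ξ => ((2 * Real.pi * ξ : ℝ) * Complex.I : ℂ) := by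
    funext ξ
    simp only [Pi.smul_apply, smul_eq_mul, RCLike.inner_apply, conj_trivial, one_mul]
    push_cast; ring
  rw [this]

theorem Rep.deriv (h : Rep σ f G) (hτ : τ = σ - 1) : Rep τ (Dx f) (mulOp dz G) := by
  have e : (fun ξ => wt (τ - σ) ξ * ((2 * Real.pi * ξ : ℝ) * Complex.I : ℂ)) = dz := by
    funext ξ; rw [dz, hτ]; congr 2; ring
  have := h.multiplier (τ := τ) (g := Dx f)
    (n := fun ξ => ((2 * Real.pi * ξ : ℝ) * Complex.I : ℂ)) (by fun_prop)
    (by rw [e]; exact isMult_dz) (fourier_Dx f)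
  rwa [e] at this

end Distributions

/-! ### Products and complex conjugates on the Fourier side -/

section Products

open scoped ContDiff

variable {r : ℝ}

/-- Fubini's theorem for Schwartz functions: the Fourier transform turns products into
convolutions. -/
theorem integral_fourier_mul_conv_schwartz (φ f g : 𝓢(ℝ, ℂ)) :
    ∫ x, 𝓕 φ x * (f x * g x) = ∫ ξ, φ ξ * conv (𝓕 f : 𝓢(ℝ, ℂ)) (𝓕 g : 𝓢(ℝ, ℂ)) ξ := by
  set h := SchwartzMap.convolution (ContinuousLinearMap.mul ℂ ℂ) (𝓕 f) (𝓕 g) with hh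
  have h1 : ∀ ξ, h ξ = conv (𝓕 f : 𝓢(ℝ, ℂ)) (𝓕 g : 𝓢(ℝ, ℂ)) ξ := fun ξ => by
    rw [hh, SchwartzMap.convolution_apply, conv_comm]
    simp [convolution, conv, mul_comm]
  have hneg : ∀ (ψ : 𝓢(ℝ, ℂ)) x, 𝓕⁻ ψ x = 𝓕 ψ (-x) := fun ψ x => rfl
  have hneg' : ∀ (ψ : 𝓢(ℝ, ℂ)) x, 𝓕 (𝓕 ψ) x = ψ (-x) := fun ψ x => by
    have := hneg (𝓕 ψ) (-x)
    rw [FourierTransform.fourierInv_fourier_eq, neg_neg] at this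
    exact this.symm
  have h2 : ∀ x, 𝓕 h x = f (-x) * g (-x) := fun x => by
    rw [hh, SchwartzMap.fourier_convolution, SchwartzMap.pairing_apply_apply, hneg', hneg']
    rfl
  have h3 : ∫ ξ, 𝓕 (𝓕⁻ φ) ξ * h ξ = ∫ x, 𝓕⁻ φ x * 𝓕 h x := SchwartzMap.integral_fourier_mul_eq _ _
  rw [FourierTransform.fourier_fourierInv_eq] at h3
  simp_rw [← h1]
  rw [h3, ← integral_neg_eq_self]
  simp_rw [h2, hneg]

/-- Complex conjugation on `L²`. -/
def conjL : L2C →L[ℝ] L2C := ContinuousLinearMap.compLpL 2 volume (Complex.conjCLE : ℂ →L[ℝ] ℂ)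

theorem coeFn_conjL (f : L2C) : conjL f =ᵐ[volume] fun x => starRingEnd ℂ (f x) :=
  ContinuousLinearMap.coeFn_compLpL (Complex.conjCLE : ℂ →L[ℝ] ℂ) f

theorem inner_conjL (f g : L2C) : inner ℂ (conjL f) g = ∫ x, f x * g x := by
  rw [L2.inner_def]
  refine integral_congr_ae ?_
  filter_upwards [coeFn_conjL f] with x h
  rw [RCLike.inner_apply, h, Complex.conj_conj, mul_comm]

theorem integrable_mul_conv (φ : 𝓢(ℝ, ℂ)) (F G : L2C) :
    Integrable (fun ξ => φ ξ * conv F G ξ) volume :=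
  φ.integrable.mul_bdd (c := ‖F‖ * ‖G‖) (stronglyMeasurable_conv F G).aestronglyMeasurable
    (Filter.Eventually.of_forall (norm_conv_le F G))

/-- The bilinear form `(F, G) ↦ ∫ φ (F * G)`. -/
def convForm (φ : 𝓢(ℝ, ℂ)) : L2C →L[ℂ] L2C →L[ℂ] ℂ :=
  LinearMap.mkContinuous₂ (LinearMap.mk₂ ℂ (fun F G : L2C => ∫ ξ, φ ξ * conv F G ξ)
    (fun F F' G => by
      rw [← integral_add (integrable_mul_conv φ F G) (integrable_mul_conv φ F' G)]
      simp_rw [conv_add_left, mul_add])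
    (fun c F G => by
      rw [smul_eq_mul, ← integral_const_mul]
      simp_rw [conv_smul_left, mul_left_comm])
    (fun F G G' => by
      rw [← integral_add (integrable_mul_conv φ F G) (integrable_mul_conv φ F G')]
      simp_rw [conv_add_right, mul_add])
    (fun c F G => by
      rw [smul_eq_mul, ← integral_const_mul]
      simp_rw [conv_smul_right, mul_left_comm])) (∫ ξ, ‖φ ξ‖) (fun F G => by
      rw [LinearMap.mk₂_apply]
      refine (norm_integral_le_integral_norm _).trans ?_
      rw [mul_assoc, ← integral_mul_const]
      refine integral_mono (integrable_mul_conv φ F G).norm (φ.integrable.norm.mul_const _)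
        fun ξ => ?_
      simp only [norm_mul]
      exact mul_le_mul_of_nonneg_left (norm_conv_le F G ξ) (norm_nonneg _))

theorem convForm_apply (φ : 𝓢(ℝ, ℂ)) (F G : L2C) :
    convForm φ F G = ∫ ξ, φ ξ * conv F G ξ := rfl

theorem isMult_schwartz (φ : 𝓢(ℝ, ℂ)) : IsMult φ :=
  ⟨φ.continuous.measurable, _, fun ξ => SchwartzMap.norm_le_seminorm ℝ φ ξ⟩

theorem integral_fourier_mul_conv (φ : 𝓢(ℝ, ℂ)) (f g : L2C) :
    ∫ x, 𝓕 φ x * (f x * g x) = ∫ ξ, φ ξ * conv (𝓕 f : L2C) (𝓕 g : L2C) ξ := by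
  have e : ∀ f g : L2C, ∫ x, 𝓕 φ x * (f x * g x) = inner ℂ (conjL (mulOp (𝓕 φ : 𝓢(ℝ, ℂ)) f)) g := by
    intro f g
    rw [inner_conjL]
    refine integral_congr_ae ?_
    filter_upwards [coeFn_mulOp (isMult_schwartz (𝓕 φ)) f] with x h
    rw [h, mul_assoc]
  rw [e, ← convForm_apply]
  have hF : Continuous fun f : L2C => (𝓕 f : L2C) := (Lp.fourierTransformₗᵢ ℝ ℂ).continuous
  have hd := SchwartzMap.denseRange_toLpCLM (E := ℝ) (F := ℂ) (p := 2) (μ := volume)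
    ENNReal.ofNat_ne_top
  -- both sides are continuous in `f` and `g`
  refine hd.induction_on (p := fun f => inner ℂ (conjL (mulOp (𝓕 φ : 𝓢(ℝ, ℂ)) f)) g
    = convForm φ (𝓕 f) (𝓕 g)) f (isClosed_eq (by fun_prop) (by fun_prop)) fun f' => ?_
  refine hd.induction_on (p := fun g => inner ℂ (conjL (mulOp (𝓕 φ : 𝓢(ℝ, ℂ)) (SchwartzMap.toLpCLM ℝ ℂ 2
    volume f'))) g = convForm φ (𝓕 (SchwartzMap.toLpCLM ℝ ℂ 2 volume f')) (𝓕 g)) g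
    (isClosed_eq (by fun_prop) (by fun_prop)) fun g' => ?_
  rw [SchwartzMap.toLpCLM_apply, SchwartzMap.toLpCLM_apply, SchwartzMap.toLp_fourier_eq,
    SchwartzMap.toLp_fourier_eq, convForm_apply, conv_congr ((𝓕 f').coeFn_toLp 2 volume)
    ((𝓕 g').coeFn_toLp 2 volume), ← integral_fourier_mul_conv_schwartz, ← e]
  refine integral_congr_ae ?_
  filter_upwards [f'.coeFn_toLp 2 volume, g'.coeFn_toLp 2 volume] with x h1 h2
  rw [h1, h2]

theorem ae_eq_of_integral_fourier_mul {f g : ℝ → ℂ} (hf : LocallyIntegrable f volume)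
    (hg : LocallyIntegrable g volume)
    (h : ∀ φ : 𝓢(ℝ, ℂ), ∫ x, 𝓕 φ x * f x = ∫ x, 𝓕 φ x * g x) : f =ᵐ[volume] g := by
  refine ae_eq_of_integral_contDiff_smul_eq hf hg fun ψ hψ hc => ?_
  have h1 : HasCompactSupport (Complex.ofRealCLM ∘ ψ) := hc.comp_left rfl
  have h2 : ContDiff ℝ ∞ (Complex.ofRealCLM ∘ ψ) := by fun_prop
  have := h (𝓕⁻ (h1.toSchwartzMap h2))
  rw [FourierTransform.fourier_fourierInv_eq] at this
  simpa using this

/-- The product of `u` with `û ∈ L¹` and `v ∈ L²`. -/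
theorem coeFn_fourierInv_prodL2 (hr : 1 / 2 < r) {U u v : L2C} (hU : low r U = 𝓕 u) :
    (𝓕⁻ (prodL2 hr U (𝓕 v)) : L2C) =ᵐ[volume] fun x => u x * v x := by
  set w : L2C := 𝓕⁻ (prodL2 hr U (𝓕 v)) with hw
  have hw' : (𝓕 w : L2C) = prodL2 hr U (𝓕 v) := FourierTransform.fourier_fourierInv_eq _
  refine ae_eq_of_integral_fourier_mul ((Lp.memLp w).locallyIntegrable one_le_two)
    ((Lp.memLp u).integrable_mul (Lp.memLp v)).locallyIntegrable fun φ => ?_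
  rw [integral_fourier_mul_conv]
  have h1 : (𝓕 (Lp.toTemperedDistribution w) : 𝓢'(ℝ, ℂ)) φ = ∫ x, 𝓕 φ x * w x := by
    rw [TemperedDistribution.fourier_apply, Lp.toTemperedDistribution_apply]; rfl
  rw [← h1, Lp.fourier_toTemperedDistribution_eq, Lp.toTemperedDistribution_apply, hw', ← hU]
  refine integral_congr_ae ?_
  filter_upwards [coeFn_prodL2 hr U (𝓕 v)] with ξ h
  rw [h, smul_eq_mul]

end Products

/-! ### Real-valued functions and the nonlinearities -/

section RealFunctions

variable {r σ : ℝ}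

theorem fourier_conj_schwartz (f : 𝓢(ℝ, ℂ)) (ξ : ℝ) :
    𝓕 (f.postcompCLM (Complex.conjCLE : ℂ →L[ℝ] ℂ)) ξ = starRingEnd ℂ (𝓕 f (-ξ)) := by
  rw [SchwartzMap.fourier_coe, SchwartzMap.fourier_coe, Real.fourier_eq, Real.fourier_eq,
    ← integral_conj]
  refine integral_congr_ae (Filter.Eventually.of_forall fun x => ?_)
  simp only [SchwartzMap.postcompCLM_apply, Circle.smul_def, smul_eq_mul, map_mul]
  congr 1
  rw [inner_neg_right, neg_neg, ← Circle.coe_inv_eq_conj, ← AddChar.map_neg_eq_inv]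

/-- Complex conjugation on the Fourier side. -/
theorem fourier_conjL (f : L2C) : (𝓕 (conjL f) : L2C) = refl (𝓕 f) := by
  have hF : Continuous fun f : L2C => (𝓕 f : L2C) := (Lp.fourierTransformₗᵢ ℝ ℂ).continuous
  have hd := SchwartzMap.denseRange_toLpCLM (E := ℝ) (F := ℂ) (p := 2) (μ := volume)
    ENNReal.ofNat_ne_top
  refine hd.induction_on (p := fun f => (𝓕 (conjL f) : L2C) = refl (𝓕 f)) f
    (isClosed_eq (hF.comp conjL.continuous) (refl.continuous.comp hF)) fun g => ?_
  have e : conjL (SchwartzMap.toLpCLM ℝ ℂ 2 volume g)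
      = (g.postcompCLM (Complex.conjCLE : ℂ →L[ℝ] ℂ)).toLp 2 volume := by
    refine Lp.ext ?_
    filter_upwards [coeFn_conjL (SchwartzMap.toLpCLM ℝ ℂ 2 volume g), g.coeFn_toLp 2 volume,
      (g.postcompCLM (Complex.conjCLE : ℂ →L[ℝ] ℂ)).coeFn_toLp 2 volume] with x h1 h2 h3
    rw [h1, h3, SchwartzMap.toLpCLM_apply, h2]; rfl
  rw [e, SchwartzMap.toLpCLM_apply, SchwartzMap.toLp_fourier_eq, SchwartzMap.toLp_fourier_eq]
  refine Lp.ext ?_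
  filter_upwards [coeFn_refl ((𝓕 g).toLp 2 volume), ae_neg ((𝓕 g).coeFn_toLp 2 volume),
    (𝓕 (g.postcompCLM (Complex.conjCLE : ℂ →L[ℝ] ℂ))).coeFn_toLp 2 volume] with ξ h1 h2 h3
  rw [h1, h2, h3, fourier_conj_schwartz]

/-- A real-valued function as a complex-valued function. -/
def ofRealL : L2 →L[ℝ] L2C := ContinuousLinearMap.compLpL 2 volume Complex.ofRealCLM

theorem coeFn_ofRealL (u : L2) : ofRealL u =ᵐ[volume] fun x => (u x : ℂ) :=
  ContinuousLinearMap.coeFn_compLpL Complex.ofRealCLM u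

theorem toDist_eq (u : L2) : toDist u = Lp.toTemperedDistribution (ofRealL u) := rfl

theorem conjL_ofRealL (u : L2) : conjL (ofRealL u) = ofRealL u := by
  refine Lp.ext ?_
  filter_upwards [coeFn_conjL (ofRealL u), coeFn_ofRealL u] with x h1 h2
  rw [h1, h2, Complex.conj_ofReal]

theorem ofRealL_injective : Function.Injective ofRealL := fun u v h => by
  refine Lp.ext ?_
  have hu := coeFn_ofRealL u
  rw [h] at hu
  filter_upwards [hu, coeFn_ofRealL v] with x h1 h2
  exact Complex.ofReal_injective (h1.symm.trans h2)

/-- The Fourier transform of a real-valued function. -/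
def ft (u : L2) : L2C := 𝓕 (ofRealL u)

theorem rep_toDist (u : L2) : Rep 0 (toDist u) (ft u) := by
  rw [Rep.zero_iff, toDist_eq, Lp.fourier_toTemperedDistribution_eq]; rfl

theorem ft_injective : Function.Injective ft := fun u v h => by
  have := congrArg (fun k : L2C => (𝓕⁻ k : L2C)) h
  simp only [ft, FourierTransform.fourierInv_fourier_eq] at this
  exact ofRealL_injective this

theorem toDist_injective : Function.Injective (toDist : L2 → 𝓢'(ℝ, ℂ)) := fun u v h =>
  ft_injective ((rep_toDist u).unique (h ▸ rep_toDist v))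

theorem refl_ft (u : L2) : refl (ft u) = ft u := by
  rw [ft, ← fourier_conjL, conjL_ofRealL]

theorem exists_ft_eq {F : L2C} (h : refl F = F) : ∃ u : L2, ft u = F := by
  set g : L2C := 𝓕⁻ F with hg
  have hF : F = 𝓕 g := (FourierTransform.fourier_fourierInv_eq F).symm
  have hc : conjL g = g := by
    have := congrArg (fun k : L2C => (𝓕⁻ k : L2C)) (fourier_conjL g)
    simpa only [← hF, h, FourierTransform.fourierInv_fourier_eq] using this
  refine ⟨ContinuousLinearMap.compLpL 2 volume Complex.reCLM g, ?_⟩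
  have e : ofRealL (ContinuousLinearMap.compLpL 2 volume Complex.reCLM g) = g := by
    refine Lp.ext ?_
    have h1 := coeFn_conjL g
    rw [hc] at h1
    filter_upwards [coeFn_ofRealL (ContinuousLinearMap.compLpL 2 volume Complex.reCLM g),
      ContinuousLinearMap.coeFn_compLpL (p := 2) (μ := volume) Complex.reCLM g, h1] with x h1 h2 h3
    rw [h1, h2]
    exact (Complex.conj_eq_iff_re.1 h3.symm)
  rw [ft, e, hF]

theorem refl_of_rep {u : L2} {U : L2C} (hσ : 0 ≤ σ) (h : Rep σ (toDist u) U) : refl U = U := by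
  have hm : IsMult (wt (0 - σ)) := isMult_wt (by linarith)
  have e := (rep_toDist u).unique (h.mono hσ)
  refine mulOp_injective hm (wt_ne_zero _) ?_
  rw [← refl_mulOp hm hm (fun ξ => by rw [wt_neg_arg, conj_wt]), ← e, refl_ft]

/-- `û` in terms of the representative of `u` in `H^r`. -/
theorem low_of_rep {u : L2} {U : L2C} (hr : 1 / 2 < r) (h : Rep r (toDist u) U) :
    low r U = ft u := by
  have e := (h.mono (τ := 0) (by linarith)).unique (rep_toDist u)
  rwa [zero_sub] at e

theorem rep_of_low {u : L2} {U : L2C} (hr : 0 ≤ r) (h : low r U = ft u) : Rep r (toDist u) U := by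
  refine Rep.raise hr ?_
  rw [zero_sub]
  change Rep 0 _ (low r U)
  rw [h]; exact rep_toDist u

theorem inner_ft (u v : L2) : inner ℂ (ft u) (ft v) = ((∫ x, u x * v x : ℝ) : ℂ) := by
  rw [ft, ft, Lp.inner_fourier_eq, L2.inner_def, ← integral_complex_ofReal]
  refine integral_congr_ae ?_
  filter_upwards [coeFn_ofRealL u, coeFn_ofRealL v] with x h1 h2
  rw [RCLike.inner_apply, h1, h2, Complex.conj_ofReal, Complex.ofReal_mul, mul_comm]

theorem rip_ft (u v : L2) : rip (ft u) (ft v) = ∫ x, u x * v x := by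
  rw [rip, inner_ft, Complex.ofReal_re]

theorem norm_ft_sq (u : L2) : ‖ft u‖ ^ 2 = ∫ x, u x ^ 2 := by
  rw [← rip_self, rip_ft]; simp_rw [sq]

theorem norm_ft (u : L2) : ‖ft u‖ = ‖u‖ := by
  rw [ft, Lp.norm_fourier_eq]
  refine le_antisymm (Lp.norm_le_norm_of_ae_le ?_) (Lp.norm_le_norm_of_ae_le ?_) <;>
  filter_upwards [coeFn_ofRealL u] with x h <;> rw [h, Complex.norm_real]

/-- The product of two real-valued functions, one of which has an integrable Fourier transform. -/
theorem exists_mul (hr : 1 / 2 < r) {u : L2} {U : L2C} (hU : Rep r (toDist u) U) (v : L2) :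
    ∃ w : L2, ft w = prodL2 hr U (ft v) ∧ w =ᵐ[volume] fun x => u x * v x := by
  obtain ⟨w, hw⟩ := exists_ft_eq (F := prodL2 hr U (ft v)) (by
    rw [refl_prodL2, refl_of_rep (by linarith) hU, refl_ft])
  refine ⟨w, hw, ?_⟩
  have h := coeFn_fourierInv_prodL2 hr (u := ofRealL u) (v := ofRealL v) (low_of_rep hr hU)
  have e : (𝓕⁻ (prodL2 hr U (𝓕 (ofRealL v))) : L2C) = ofRealL w := by
    change 𝓕⁻ (prodL2 hr U (ft v)) = _
    rw [← hw, ft, FourierTransform.fourierInv_fourier_eq]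
  rw [e] at h
  filter_upwards [h, coeFn_ofRealL w, coeFn_ofRealL u, coeFn_ofRealL v] with x h1 h2 h3 h4
  rw [h2, h3, h4] at h1
  exact_mod_cast h1

/-- The Fourier transform of the nonlinearities: `H^r` is an algebra for `r > 1/2`. -/
theorem rep_quad (hr : 1 / 2 < r) (a b c : ℝ) {u v : L2} {U V : L2C}
    (hU : Rep r (toDist u) U) (hV : Rep r (toDist v) V) :
    Rep r (toDist (quad a b c u v)) (quadHr hr a b c U V) := by
  obtain ⟨uu, huu, huu'⟩ := exists_mul hr hU u
  obtain ⟨uv, huv, huv'⟩ := exists_mul hr hU v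
  obtain ⟨vv, hvv, hvv'⟩ := exists_mul hr hV v
  set w : L2 := a • uu + (2 * b) • uv + c • vv with hw
  have hft : ∀ (k l : ℝ) (f g : L2), ft (k • f + l • g) = (k : ℂ) • ft f + (l : ℂ) • ft g :=
    fun k l f g => by
      rw [ft, map_add, map_smul, map_smul, FourierTransform.fourier_add, ← coe_smul_eq,
        ← coe_smul_eq, FourierTransform.fourier_smul, FourierTransform.fourier_smul]; rfl
  have hft3 : ft w = (a : ℂ) • ft uu + (2 * b : ℂ) • ft uv + (c : ℂ) • ft vv := by
    have h1 := hft 1 c (a • uu + (2 * b) • uv) vv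
    rw [one_smul, hft, Complex.ofReal_one, one_smul] at h1
    rw [hw, h1]; push_cast; rfl
  have e : toDist (quad a b c u v) = toDist w := by
    ext φ
    rw [toDist, toDist, Lp.toTemperedDistribution_apply, Lp.toTemperedDistribution_apply]
    refine integral_congr_ae ?_
    filter_upwards [ContinuousLinearMap.coeFn_compLp Complex.ofRealCLM (quad a b c u v),
      ContinuousLinearMap.coeFn_compLp Complex.ofRealCLM w,
      (integrable_quad a b c u v).coeFn_toL1, huu', huv', hvv',
      Lp.coeFn_add (a • uu + (2 * b) • uv) (c • vv), Lp.coeFn_add (a • uu) ((2 * b) • uv),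
      Lp.coeFn_smul a uu, Lp.coeFn_smul (2 * b) uv, Lp.coeFn_smul c vv]
      with x h1 h2 h3 h4 h5 h6 h7 h8 h9 h10 h11
    have h3' : quad a b c u v x = a * u x ^ 2 + 2 * b * (u x * v x) + c * v x ^ 2 := h3
    rw [h1, h2, h3', hw, h7, Pi.add_apply, h8, Pi.add_apply, h9, h10, h11]
    simp only [Pi.smul_apply, smul_eq_mul, h4, h5, h6]
    congr 2; ring
  rw [e]
  refine rep_of_low (by linarith) ?_
  rw [hft3, quadHr, low_add, low_add, low_smul, low_smul, low_smul, low_prodHr, low_prodHr,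
    low_prodHr, low_of_rep hr hU, low_of_rep hr hV, huu, huv, hvv]

end RealFunctions

/-! ### From the first-order system to the original equations -/

section Curves

variable {r σ τ : ℝ} {I : Set ℝ}

theorem mulOp_add_symbol {m n : ℝ → ℂ} (hm : IsMult m) (hn : IsMult n) (f : L2C) :
    mulOp m f + mulOp n f = mulOp (fun ξ => m ξ + n ξ) f := by
  have h : IsMult fun ξ => m ξ + n ξ := by
    obtain ⟨h1, C, hC⟩ := hm
    obtain ⟨h2, D, hD⟩ := hn
    exact ⟨h1.add h2, C + D, fun ξ => (norm_add_le _ _).trans (add_le_add (hC ξ) (hD ξ))⟩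
  rw [eq_comm, mulOp_eq_iff h]
  filter_upwards [Lp.coeFn_add (mulOp m f) (mulOp n f), coeFn_mulOp hm f, coeFn_mulOp hn f]
    with ξ h1 h2 h3
  rw [h1, Pi.add_apply, h2, h3, add_mul]

theorem om_sq_coe (ξ : ℝ) : (om ξ : ℂ) ^ 2 = 1 + (2 * Real.pi * ξ) ^ 2 := by
  have := om_sq ξ
  exact_mod_cast this

theorem wt_neg_two (ξ : ℝ) : wt (-2) ξ = wt (-1) ξ * wt (-1) ξ := by
  rw [← wt_add]; norm_num

theorem dz_sq (ξ : ℝ) : dz ξ * dz ξ = wt (-2) ξ * (1 - (om ξ : ℂ) ^ 2) := by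
  rw [om_sq_coe, wt_neg_two, dz]
  push_cast
  linear_combination (wt (-1) ξ * (2 * Real.pi * ξ)) ^ 2 * Complex.I_mul_I

theorem rz_sq (ξ : ℝ) : rz ξ * rz ξ = (1 - (om ξ : ℂ) ^ 2) / (om ξ : ℂ) ^ 2 := by
  rw [om_sq_coe, rz, div_mul_div_comm, ← sq (om ξ : ℂ), om_sq_coe]
  congr 1
  push_cast
  linear_combination (2 * Real.pi * ξ : ℂ) ^ 2 * Complex.I_mul_I

/-- Every element of `L²` represents an element of `H^σ`. -/
theorem exists_rep (σ : ℝ) (G : L2C) : ∃ f, Rep σ f G := by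
  refine ⟨𝓕⁻ (TemperedDistribution.smulLeftCLM ℂ (wt (-σ)) (Lp.toTemperedDistribution G)), ?_⟩
  rw [Rep, FourierTransform.fourier_fourierInv_eq, smulLeftCLM_wt_wt, neg_add_cancel,
    smulLeftCLM_wt_zero]

/-- The inverse Fourier transform of `L²`, over the real numbers. -/
def invL : L2C →L[ℝ] L2C :=
  (Lp.fourierTransformₗᵢ ℝ ℂ).symm.toContinuousLinearEquiv.toContinuousLinearMap.restrictScalars ℝ

theorem contDiffOn_one_of_deriv {E : Type*} [NormedAddCommGroup E] [NormedSpace ℝ E]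
    (hI : UniqueDiffOn ℝ I) {G G' : ℝ → E} (hd : ∀ t ∈ I, HasDerivWithinAt G (G' t) I t)
    (hc : ContinuousOn G' I) : ContDiffOn ℝ 1 G I := by
  rw [contDiffOn_one_iff_derivWithin hI]
  exact ⟨fun t ht => (hd t ht).differentiableWithinAt,
    hc.congr fun t ht => (hd t ht).derivWithin (hI t ht)⟩

theorem cmSobolev_one {f : ℝ → 𝓢'(ℝ, ℂ)} {G G' : ℝ → L2C} (hI : UniqueDiffOn ℝ I)
    (hf : ∀ t ∈ I, Rep σ (f t) (G t)) (hd : ∀ t ∈ I, HasDerivWithinAt G (G' t) I t)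
    (hc : ContinuousOn G' I) : CmSobolev 1 σ I f := by
  refine ⟨fun t => invL (G t), ?_, fun t ht => rep_iff.1 (hf t ht)⟩
  exact contDiffOn_one_of_deriv hI
    (fun t ht => invL.hasFDerivAt.comp_hasDerivWithinAt t (hd t ht))
    (invL.continuous.comp_continuousOn hc)

theorem cmSobolev_zero {f : ℝ → 𝓢'(ℝ, ℂ)} {G : ℝ → L2C}
    (hf : ∀ t ∈ I, Rep σ (f t) (G t)) (hc : ContinuousOn G I) : CmSobolev 0 σ I f := by
  refine ⟨fun t => invL (G t), ?_, fun t ht => rep_iff.1 (hf t ht)⟩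
  exact contDiffOn_zero.2 (invL.continuous.comp_continuousOn hc)

theorem hasTimeDeriv_of_rep {f f' : ℝ → 𝓢'(ℝ, ℂ)} {G G' : ℝ → L2C}
    (hf : ∀ t ∈ I, Rep σ (f t) (G t)) (hf' : ∀ t ∈ I, Rep σ (f' t) (G' t))
    (hd : ∀ t ∈ I, HasDerivWithinAt G (G' t) I t) : HasTimeDeriv σ I f f' :=
  ⟨fun t => invL (G t), fun t => invL (G' t), fun t ht =>
    ⟨rep_iff.1 (hf t ht), rep_iff.1 (hf' t ht),
      invL.hasFDerivAt.comp_hasDerivWithinAt t (hd t ht)⟩⟩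

/-- The symbol `|2πξ|^(r-1) (1 + ξ²)^(-r/2) 2πiξ / ω(ξ)`, which maps the representative of `x ∈ H^r`
to that of `∂ₓ (1 - ∂ₓ²)^(-1/2) x` in `Ḣ^(r-1)`. -/
def hz (r ξ : ℝ) : ℂ := ((|2 * Real.pi * ξ| ^ (r - 1) : ℝ) : ℂ) * (wt (-r) ξ * rz ξ)

theorem isMult_hz (hr : 0 ≤ r) : IsMult (hz r) := by
  refine ⟨?_, (2 * Real.pi) ^ r, fun ξ => ?_⟩
  · have h1 : Measurable fun ξ : ℝ => ((|2 * Real.pi * ξ| ^ (r - 1) : ℝ) : ℂ) := by fun_prop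
    exact h1.mul ((measurable_wt _).mul isMult_rz.1)
  · have hpi : (0 : ℝ) ≤ 2 * Real.pi := by positivity
    rcases eq_or_ne ξ 0 with rfl | h0
    · have : rz 0 = 0 := by simp [rz]
      rw [hz, this]; simp only [mul_zero, norm_zero]; positivity
    · have hx : 0 < |2 * Real.pi * ξ| := by
        have := Real.pi_pos
        exact abs_pos.2 (by positivity)
      have hrz : ‖rz ξ‖ ≤ |2 * Real.pi * ξ| := by
        rw [rz, norm_div, norm_mul, Complex.norm_real, Complex.norm_I, mul_one, norm_om,
          Real.norm_eq_abs]
        exact div_le_self hx.le (one_le_om ξ)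
      have hw : |ξ| ^ r * ‖wt (-r) ξ‖ ≤ 1 := by
        have h1 : |ξ| ^ r ≤ ‖wt r ξ‖ := by
          rw [norm_wt, Real.norm_eq_abs, sq_abs]
          have : |ξ| = (ξ ^ 2) ^ (1 / 2 : ℝ) := by
            rw [← Real.sqrt_eq_rpow, Real.sqrt_sq_eq_abs]
          rw [this, ← Real.rpow_mul (by positivity)]
          have e : 1 / 2 * r = r / 2 := by ring
          rw [e]
          exact Real.rpow_le_rpow (by positivity) (by linarith) (by linarith)
        calc _ ≤ ‖wt r ξ‖ * ‖wt (-r) ξ‖ := by gcongr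
          _ = 1 := by rw [← norm_mul, wt_mul_neg, norm_one]
      rw [hz, norm_mul, norm_mul, Complex.norm_real, Real.norm_of_nonneg (by positivity)]
      calc _ ≤ |2 * Real.pi * ξ| ^ (r - 1) * (‖wt (-r) ξ‖ * |2 * Real.pi * ξ|) := by gcongr
        _ = |2 * Real.pi * ξ| ^ r * ‖wt (-r) ξ‖ := by
          have : |2 * Real.pi * ξ| ^ r = |2 * Real.pi * ξ| ^ (r - 1) * |2 * Real.pi * ξ| := by
            rw [← Real.rpow_add_one hx.ne']; congr 1; ring
          rw [this]; ring
        _ = (2 * Real.pi) ^ r * (|ξ| ^ r * ‖wt (-r) ξ‖) := by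
          rw [abs_mul, abs_of_nonneg hpi, Real.mul_rpow hpi (abs_nonneg _)]; ring
        _ ≤ _ := mul_le_of_le_one_right (by positivity) hw

/-- If `f = ∂ₓ (1 - ∂ₓ²)^(-1/2) x` with `x ∈ H^r`, then `f ∈ Ḣ^(r - 1)`. The factor `∂ₓ` is needed for
`r < 1` only, where the weight of `Ḣ^(r - 1)` is singular at frequency zero. -/
theorem homSobolevRep_of_rep (hr : 1 / 2 < r) {f : 𝓢'(ℝ, ℂ)} {X : L2C}
    (h : Rep r f (mulOp rz X)) : HomSobolevRep (r - 1) f (mulOp (hz r) X) := by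
  have hk := coeFn_low hr (mulOp rz X)
  refine ⟨fun ξ => wt (-r) ξ * mulOp rz X ξ, ?_, h.fourier_apply, ?_⟩
  · exact ((Lp.memLp (low r (mulOp rz X))).locallyIntegrable one_le_two).congr hk
  · filter_upwards [coeFn_mulOp (isMult_hz (by linarith)) X, coeFn_mulOp isMult_rz X] with ξ h1 h2
    rw [h1, h2, hz]; ring

end Curves

section Forward

namespace Sys

variable {P : Sys} {s : ℝ} {I : Set ℝ} {y : ℝ → St}

theorem isMult_om_wt {σ : ℝ} (h : σ ≤ -1) : IsMult fun ξ => om ξ * wt σ ξ := by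
  have := isMult_wt_mul_om h
  simpa only [mul_comm] using this

theorem isMult_om_om_wt {σ : ℝ} (h : σ ≤ -2) : IsMult fun ξ => om ξ * (om ξ * wt σ ξ) := by
  have := (isMult_om_wt (le_refl (-1 : ℝ))).mul (isMult_om_wt (σ := σ + 1) (by linarith))
  have e : (fun ξ => (om ξ * (om ξ * wt σ ξ) : ℂ))
      = fun ξ => (om ξ * wt (-1) ξ) * (om ξ * wt (σ + 1) ξ) := funext fun ξ => by
    have : σ = -1 + (σ + 1) := by ring
    rw [this, wt_add]; ring_nf
  rwa [e]

/-- The equation for `u` on the Fourier side: `(1 - ∂ₓ²)⁻¹ ∂ₓ² z` solves `h = ∂ₓ² (z + h)`. -/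
theorem mulOp_rz_rz_eq (Z : L2C) : mulOp (wt (-2)) (mulOp rz (mulOp rz Z))
    = mulOp dz (mulOp dz Z) + mulOp dz (mulOp dz (mulOp rz (mulOp rz Z))) := by
  have hw : IsMult (wt (-2)) := isMult_wt (by norm_num)
  rw [mulOp_mulOp isMult_rz isMult_rz, mulOp_mulOp hw (isMult_rz.mul isMult_rz),
    mulOp_mulOp isMult_dz isMult_dz, mulOp_mulOp isMult_dz (isMult_rz.mul isMult_rz),
    mulOp_mulOp isMult_dz (isMult_dz.mul (isMult_rz.mul isMult_rz)),
    mulOp_add_symbol (isMult_dz.mul isMult_dz)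
      (isMult_dz.mul (isMult_dz.mul (isMult_rz.mul isMult_rz)))]
  congr 2; funext ξ
  have e : dz ξ * (dz ξ * (rz ξ * rz ξ)) = (dz ξ * dz ξ) * (rz ξ * rz ξ) := by ring
  have := om_ne_zero ξ
  rw [e, dz_sq, rz_sq]
  field_simp
  ring

/-- A solution of the first-order system gives a solution of the original equations. -/
theorem isSolution_of_hasDeriv (hs : s ≤ P.s) (h₁ : P.m₁ = rz) (h₂ : P.m₂ = rz)
    (hI : UniqueDiffOn ℝ I) (hy : ∀ t ∈ I, HasDerivWithinAt y (P.field t (y t)) I t)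
    {u v : ℝ → L2} {ut vt : ℝ → 𝓢'(ℝ, ℂ)}
    (hu : ∀ t ∈ I, Rep P.r (toDist (u t)) (y t).1)
    (hv : ∀ t ∈ I, Rep P.s (toDist (v t)) (V t (y t)))
    (hut : ∀ t ∈ I, Rep P.r (ut t) (mulOp rz (y t).2.1))
    (hvt : ∀ t ∈ I, Rep (P.s - 1) (vt t) (mulOp (fun ξ => om ξ * wt (-1) ξ) (Q t (y t)))) :
    IsSolution P.c P.r s I u v ut vt := by
  have hc : ∀ t ∈ I, ContinuousWithinAt y I t := fun t ht => (hy t ht).continuousWithinAt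
  have hX : ContinuousOn (fun t => (y t).2.1) I := fun t ht => (hc t ht).snd.fst
  have hVc : ContinuousOn (fun t => P.Vr t (y t)) I := fun t ht => P.continuousWithinAt_Vr (hc t ht)
  set Z : ℝ → L2C := fun t => ((P.c.α ^ 2 : ℝ) : ℂ) • (y t).1 + P.N₁ t (y t) with hZ
  have hU : ContinuousOn (fun t => (y t).1) I := fun t ht => (hc t ht).fst
  have hN : ContinuousOn (fun t => P.N₁ t (y t)) I :=
    (continuous_quadHr P.hr P.c.auu P.c.auv P.c.avv).comp_continuousOn
      (f := fun t => ((y t).1, P.Vr t (y t))) (hU.prodMk hVc)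
  have hZc : ContinuousOn Z I := (ContinuousOn.const_smul hU (_ : ℂ)).add hN
  have dU : ∀ t ∈ I, HasDerivWithinAt (fun τ => (y τ).1) (mulOp rz (y t).2.1) I t :=
    fun t ht => h₁ ▸ P.hasDerivWithinAt_U (hy t ht)
  have dX : ∀ t ∈ I, HasDerivWithinAt (fun τ => (y τ).2.1) (mulOp rz (Z t)) I t :=
    fun t ht => h₂ ▸ P.hasDerivWithinAt_snd (hy t ht)
  have cmul : ∀ (m : ℝ → ℂ) {f : ℝ → L2C}, ContinuousOn f I →
      ContinuousOn (fun t => mulOp m (f t)) I := fun m f hf => (mulOp m).continuous.comp_continuousOn hf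
  have hVr : ∀ t ∈ I, Rep P.r (toDist (v t)) (P.Vr t (y t)) := fun t ht => (hv t ht).mono P.hrs
  -- the representative of `vₜ` in `H^(s - 1)`
  have hvt' : ∀ t ∈ I, Rep (s - 1) (vt t)
      (mulOp (fun ξ => om ξ * wt (s - 1 - P.s) ξ) (Q t (y t))) := fun t ht => by
    have h := (hvt t ht).mono (τ := s - 1) (by linarith)
    rw [mulOp_mulOp (isMult_wt (by linarith)) (isMult_om_wt le_rfl)] at h
    have e : ∀ ξ, wt (s - 1 - P.s) ξ = wt (s - 1 - (P.s - 1)) ξ * wt (-1) ξ := fun ξ => by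
      rw [← wt_add]; congr 1; ring
    simp_rw [e]
    convert h using 4
    ring
  obtain ⟨utt, hutt⟩ : ∃ utt : ℝ → 𝓢'(ℝ, ℂ), ∀ t, Rep P.r (utt t) (mulOp rz (mulOp rz (Z t))) :=
    ⟨_, fun t => (exists_rep P.r (mulOp rz (mulOp rz (Z t)))).choose_spec⟩
  have hm2 := isMult_om_wt (σ := s - 2 - P.s) (by linarith)
  have hm2' := isMult_om_om_wt (σ := s - 2 - P.s) (by linarith)
  obtain ⟨vtt, hvtt⟩ : ∃ vtt : ℝ → 𝓢'(ℝ, ℂ), ∀ t, Rep (s - 2) (vtt t)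
      (-mulOp (fun ξ => om ξ * (om ξ * wt (s - 2 - P.s) ξ)) (V t (y t))
        + mulOp (fun ξ => om ξ * wt (s - 2 - P.s) ξ) (P.G t (y t))) :=
    ⟨_, fun t => (exists_rep (s - 2) _).choose_spec⟩
  refine ⟨?_, ?_, ?_, ?_, ?_, ?_, ?_, ⟨utt, ?_, fun t ht => ?_⟩, ⟨vtt, ?_, fun t ht => ?_⟩⟩
  · exact cmSobolev_one hI hu dU (cmul rz hX)
  · exact cmSobolev_one hI hut (fun t ht => hasDerivWithinAt_mulOp rz (dX t ht))
      (cmul rz (cmul rz hZc))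
  · refine ⟨fun t => mulOp (hz P.r) (y t).2.1, ?_, fun t ht => homSobolevRep_of_rep P.hr (hut t ht)⟩
    exact contDiffOn_one_of_deriv hI (fun t ht => hasDerivWithinAt_mulOp (hz P.r) (dX t ht))
      (cmul _ (cmul rz hZc))
  · exact cmSobolev_zero (fun t ht => (hv t ht).mono hs)
      (cmul _ fun t ht => continuousWithinAt_V (hc t ht))
  · exact cmSobolev_zero hvt' (cmul _ fun t ht => continuousWithinAt_Q (hc t ht))
  · exact hasTimeDeriv_of_rep hu hut dU
  · exact hasTimeDeriv_of_rep (fun t ht => (hv t ht).mono (by linarith)) hvt' fun t ht =>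
      P.hasDerivWithinAt_V (isMult_wt (by linarith)) (isMult_om_wt (by linarith)) (hy t ht)
  · exact hasTimeDeriv_of_rep hut (fun t _ => hutt t) fun t ht =>
      hasDerivWithinAt_mulOp rz (dX t ht)
  · have hτ : P.r - 1 - 1 = P.r - 2 := by ring
    have r1 := ((hu t ht).deriv rfl).deriv hτ.symm
    have r2 := ((hutt t).deriv rfl).deriv hτ.symm
    have r3 : Rep P.r (f₁ P.c (u t) (v t)) (P.N₁ t (y t)) :=
      rep_quad P.hr _ _ _ (hu t ht) (hVr t ht)
    have r4 := (r3.deriv rfl).deriv hτ.symm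
    have r5 := (hutt t).mono (τ := P.r - 2) (by linarith)
    refine Rep.ext r5 ?_
    have e : P.r - 2 - P.r = -2 := by ring
    rw [e, mulOp_rz_rz_eq]
    have := ((r1.smul ((P.c.α ^ 2 : ℝ) : ℂ)).add r2).add r4
    convert this using 1
    rw [hZ]
    simp only [map_add, map_smul]
    abel
  · refine hasTimeDeriv_of_rep (G := fun t => mulOp (fun ξ => om ξ * wt (s - 2 - P.s) ξ) (Q t (y t)))
      (fun t ht => ?_) (fun t _ => hvtt t) fun t ht => P.hasDerivWithinAt_Q hm2 hm2' (hy t ht)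
    have h := (hvt' t ht).mono (τ := s - 2) (by linarith)
    rw [mulOp_mulOp (isMult_wt (by linarith)) (isMult_om_wt (by linarith))] at h
    have e : ∀ ξ, wt (s - 2 - P.s) ξ = wt (s - 2 - (s - 1)) ξ * wt (s - 1 - P.s) ξ := fun ξ => by
      rw [← wt_add]; congr 1; ring
    simp_rw [e]
    convert h using 4
    ring
  · have hs2 : s - 1 - 1 = s - 2 := by ring
    have r0 := (hv t ht).mono hs
    have r1 := (r0.deriv rfl).deriv hs2.symm
    have r2 := (hv t ht).mono (τ := s - 2) (by linarith)
    have r3 : Rep P.r (f₂ P.c (u t) (v t)) (P.N₂ t (y t)) :=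
      rep_quad P.hr _ _ _ (hu t ht) (hVr t ht)
    have r4 := r3.mono (τ := s - 2) (by linarith [P.hsr])
    refine Rep.ext (hvtt t) ?_
    have := (r1.sub r2).add r4
    convert this using 1
    have hd := isMult_dz.mul (isMult_dz.mul (isMult_wt (σ := s - P.s) (by linarith)))
    have hw := isMult_wt (σ := s - 2 - P.s) (by linarith)
    congr 1
    · rw [mulOp_mulOp isMult_dz (isMult_wt (by linarith)), mulOp_mulOp isMult_dz
        (isMult_dz.mul (isMult_wt (by linarith))), neg_eq_iff_add_eq_zero, ← add_sub_assoc,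
        mulOp_add_symbol hm2' hd, sub_eq_zero]
      congr 2; funext ξ
      have e1 : dz ξ * (dz ξ * wt (s - P.s) ξ) = dz ξ * dz ξ * wt (s - P.s) ξ := by ring
      have e2 : wt (s - 2 - P.s) ξ = wt (-2) ξ * wt (s - P.s) ξ := by
        rw [← wt_add]; congr 1; ring
      rw [e1, dz_sq, e2]; ring
    · rw [G, mulOp_mulOp hm2 P.isMult_up]
      congr 2; funext ξ
      have e2 : wt (s - 2 - P.r) ξ = wt (s - 2 - P.s) ξ * wt (P.s - P.r) ξ := by
        rw [← wt_add]; congr 1; ring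
      have := om_ne_zero ξ
      rw [e2]; field_simp

end Sys

end Forward

/-! ### The initial data -/

section InitialData

variable {r s : ℝ}

theorem exists_rep_of_memSobolev {σ : ℝ} {f : 𝓢'(ℝ, ℂ)}
    (h : TemperedDistribution.MemSobolev σ 2 f) : ∃ G, Rep σ f G := by
  obtain ⟨g, hg⟩ := h
  exact ⟨_, sobolevRep_iff.1 hg⟩

theorem memLp_of_le {F G : L2C} {k : ℝ → ℂ} (hk : AEStronglyMeasurable k volume) {C D : ℝ}
    (h : ∀ᵐ ξ, ‖k ξ‖ ≤ C * ‖F ξ‖ + D * ‖G ξ‖) : MemLp k 2 volume := by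
  refine MemLp.of_le (((Lp.memLp F).norm.const_mul C).add ((Lp.memLp G).norm.const_mul D)) hk ?_
  filter_upwards [h] with ξ h
  exact h.trans (Real.le_norm_self _)

/-- Square integrability of a function and its derivative gives membership in `H¹`. -/
theorem exists_rep_one {v vx : L2} (h : Dx (toDist v) = toDist vx) :
    ∃ V, Rep 1 (toDist v) V := by
  have e := ((rep_toDist v).deriv (τ := 0 - 1) rfl).unique
    (h ▸ (rep_toDist vx).mono (τ := 0 - 1) (by norm_num))
  have hw : IsMult (wt (0 - 1 - 0)) := isMult_wt (by norm_num)
  have hk : MemLp (fun ξ => wt 1 ξ * ft v ξ) 2 volume := by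
    refine memLp_of_le (F := ft v) (G := ft vx) (C := 1) (D := 1)
      ((measurable_wt 1).aestronglyMeasurable.mul (Lp.aestronglyMeasurable _)) ?_
    have h1 := coeFn_mulOp isMult_dz (ft v)
    rw [e] at h1
    filter_upwards [h1, coeFn_mulOp hw (ft vx)] with ξ h1 h2
    rw [h2] at h1
    have e1 : ft vx ξ = ((2 * Real.pi * ξ : ℝ) * Complex.I : ℂ) * ft v ξ := by
      refine mul_left_cancel₀ (wt_ne_zero (0 - 1 - 0) ξ) (h1.trans ?_)
      rw [dz]; ring_nf
    rw [e1, norm_mul, norm_mul, norm_mul, Complex.norm_real, Complex.norm_I, mul_one,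
      Real.norm_eq_abs, one_mul, one_mul, ← one_add_mul]
    refine mul_le_mul_of_nonneg_right ((norm_wt_one_le_om ξ).trans ?_) (norm_nonneg _)
    rw [om]
    refine Real.sqrt_le_iff.2 ⟨by positivity, ?_⟩
    nlinarith [abs_nonneg (2 * Real.pi * ξ), sq_abs (2 * Real.pi * ξ)]
  refine ⟨hk.toLp _, rep_of_low zero_le_one ?_⟩
  rw [low, mulOp_eq_iff (isMult_wt (by norm_num))]
  filter_upwards [hk.coeFn_toLp] with ξ h
  rw [h, ← mul_assoc, wt_neg_mul, one_mul]

/-- The representative of `(1 - ∂ₓ²)^(1/2) w` for `w ∈ L²` with `∂ₓ w ∈ H^r`. -/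
theorem exists_rep_primitive (hr : 1 / 2 < r) {w u : L2} {U : L2C}
    (h : Dx (toDist w) = toDist u) (hU : Rep r (toDist u) U) :
    ∃ X : L2C, mulOp rz X = U ∧ mulOp (fun ξ => 1 / (om ξ : ℂ)) (low r X) = ft w := by
  have e := ((rep_toDist w).deriv (τ := 0 - 1) rfl).unique
    (h ▸ hU.mono (τ := 0 - 1) (by linarith))
  have hw : IsMult (wt (0 - 1 - r)) := isMult_wt (by linarith)
  have hUw : ∀ᵐ ξ, U ξ = wt r ξ * ((2 * Real.pi * ξ : ℝ) * Complex.I : ℂ) * ft w ξ := by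
    have h1 := coeFn_mulOp isMult_dz (ft w)
    rw [e] at h1
    filter_upwards [h1, coeFn_mulOp hw U] with ξ h1 h2
    rw [h2] at h1
    refine mul_left_cancel₀ (wt_ne_zero (0 - 1 - r) ξ) (h1.trans ?_)
    have e2 : wt (-1) ξ = wt (0 - 1 - r) ξ * wt r ξ := by rw [← wt_add]; congr 1; ring
    rw [dz, e2]; ring
  have hk : MemLp (fun ξ => wt r ξ * om ξ * ft w ξ) 2 volume := by
    refine memLp_of_le (F := ft w) (G := U) (C := ‖wt r 1‖ * (1 + 2 * Real.pi)) (D := 2)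
      (((measurable_wt r).mul measurable_om).aestronglyMeasurable.mul
        (Lp.aestronglyMeasurable _)) ?_
    filter_upwards [hUw] with ξ h1
    rw [h1, norm_mul, norm_mul, norm_mul, norm_mul, norm_mul, norm_om, Complex.norm_real,
      Complex.norm_I, mul_one, Real.norm_eq_abs, ← mul_assoc, ← add_mul]
    refine mul_le_mul_of_nonneg_right ?_ (norm_nonneg _)
    have hom : om ξ ≤ 1 + |2 * Real.pi * ξ| := by
      rw [om]
      refine Real.sqrt_le_iff.2 ⟨by positivity, ?_⟩
      nlinarith [abs_nonneg (2 * Real.pi * ξ), sq_abs (2 * Real.pi * ξ)]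
    have hpi := Real.pi_gt_three
    have ha : |2 * Real.pi * ξ| = 2 * Real.pi * |ξ| := by
      rw [abs_mul, abs_of_pos (by positivity)]
    have hn := norm_nonneg (wt r ξ)
    have hn1 := norm_nonneg (wt r 1)
    -- low frequencies are controlled by `w`, high frequencies by `u`
    rcases le_total |ξ| 1 with hξ | hξ
    · have h2 : ‖wt r ξ‖ ≤ ‖wt r 1‖ := by
        rw [norm_wt, norm_wt, Real.norm_eq_abs, norm_one]
        exact Real.rpow_le_rpow (by positivity) (by nlinarith [abs_nonneg ξ]) (by linarith)
      have h3 : om ξ ≤ 1 + 2 * Real.pi := by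
        rw [ha] at hom; nlinarith
      have := mul_le_mul h2 h3 (om_pos ξ).le hn1
      have h4 : 0 ≤ 2 * (‖wt r ξ‖ * |2 * Real.pi * ξ|) := by positivity
      linarith
    · have h3 : om ξ ≤ 2 * |2 * Real.pi * ξ| := by
        rw [ha] at hom ⊢; nlinarith
      have := mul_le_mul_of_nonneg_left h3 hn
      have h4 : 0 ≤ ‖wt r 1‖ * (1 + 2 * Real.pi) := by positivity
      linarith
  refine ⟨hk.toLp _, ?_, ?_⟩
  · rw [mulOp_eq_iff isMult_rz]
    filter_upwards [hk.coeFn_toLp, hUw] with ξ h1 h2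
    have := om_ne_zero ξ
    rw [h1, h2, rz]; field_simp
  · rw [mulOp_mulOp isMult_inv_om (isMult_low hr), mulOp_eq_iff (isMult_inv_om.mul (isMult_low hr))]
    filter_upwards [hk.coeFn_toLp] with ξ h1
    have h2 := om_ne_zero ξ
    have h3 := wt_neg_mul r ξ
    rw [h1]; field_simp
    linear_combination (-ft w ξ) * h3

/-- The identity `‖h‖² = ‖(1 - ∂ₓ²)^(-1/2) h‖² + ‖∂ₓ (1 - ∂ₓ²)^(-1/2) h‖²`. -/
theorem norm_sq_mulOp_add (h : L2C) :
    ‖mulOp (fun ξ => 1 / (om ξ : ℂ)) h‖ ^ 2 + ‖mulOp rz h‖ ^ 2 = ‖h‖ ^ 2 := by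
  have h1 := isMult_inv_om
  have e1 : inner ℂ (mulOp (fun ξ => 1 / (om ξ : ℂ)) h) (mulOp (fun ξ => 1 / (om ξ : ℂ)) h)
      + inner ℂ (mulOp rz h) (mulOp rz h) = inner ℂ h h := by
    rw [inner_mulOp h1, inner_mulOp isMult_rz, mulOp_mulOp h1.star h1,
      mulOp_mulOp isMult_rz.star isMult_rz, ← inner_add_right,
      mulOp_add_symbol (h1.star.mul h1) (isMult_rz.star.mul isMult_rz), mulOp_eq_smul 1, one_smul]
    intro ξ
    have h2 := om_ne_zero ξ
    rw [map_div₀, map_one, Complex.conj_ofReal, conj_rz, neg_mul, rz_sq]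
    field_simp
    ring
  have e2 := congrArg Complex.re e1
  rw [Complex.add_re] at e2
  rw [← rip_self, ← rip_self, ← rip_self]
  exact e2

theorem energy_eq (c : Coeffs) (u p w v vx q : L2) : energy c u p w v vx q
    = 1 / 2 * (‖w‖ ^ 2 + ‖p‖ ^ 2 + (c.α ^ 2 * ‖u‖ ^ 2 + (‖v‖ ^ 2 + ‖vx‖ ^ 2 + ‖q‖ ^ 2)))
      - ∫ x, potential c (u x) (v x) := by
  have hi : ∀ f : L2, Integrable (fun x => f x ^ 2) volume := fun f => (Lp.memLp f).integrable_sq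
  have hn : ∀ f : L2, ∫ x, f x ^ 2 = ‖f‖ ^ 2 := fun f => by rw [← norm_ft_sq, norm_ft]
  have ia : ∀ {f g : ℝ → ℝ}, Integrable f volume → Integrable g volume →
      Integrable (fun x => f x + g x) volume := fun hf hg => hf.add hg
  have i1 := ia (hi p) ((hi u).const_mul (c.α ^ 2))
  have i2 := ia i1 (hi w)
  have i3 := ia i2 (hi v)
  have i4 := ia i3 (hi vx)
  rw [energy]
  congr 2
  rw [integral_add i4 (hi q), integral_add i3 (hi vx), integral_add i2 (hi v),
    integral_add i1 (hi w), integral_add (hi p) ((hi u).const_mul _), integral_const_mul,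
    hn, hn, hn, hn, hn, hn]
  ring

theorem integral_potential (hr : 1 / 2 < r) (c : Coeffs) (hauu : c.auu = 0) {u v : L2}
    {V : L2C} (hV : Rep r (toDist v) V) : ∫ x, potential c (u x) (v x)
      = c.bvv / 3 * rip (ft v) (prodL2 hr V (ft v)) + c.buu * rip (ft u) (prodL2 hr V (ft u))
        + c.buv * rip (ft u) (prodL2 hr V (ft v)) := by
  obtain ⟨vu, hvu, hvu'⟩ := exists_mul hr hV u
  obtain ⟨vv, hvv, hvv'⟩ := exists_mul hr hV v
  rw [← hvu, ← hvv, rip_ft, rip_ft, rip_ft, ← integral_const_mul, ← integral_const_mul,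
    ← integral_const_mul]
  have hi : ∀ f g : L2, ∀ a : ℝ, Integrable (fun x => a * (f x * g x)) volume := fun f g a =>
    ((Lp.memLp f).integrable_mul (Lp.memLp g)).const_mul a
  have hi2 : Integrable (fun x => c.bvv / 3 * (v x * vv x) + c.buu * (u x * vu x)) volume :=
    (hi v vv _).add (hi u vu _)
  rw [← integral_add (hi v vv _) (hi u vu _), ← integral_add hi2 (hi u vv _)]
  refine integral_congr_ae ?_
  filter_upwards [hvu', hvv'] with x h1 h2
  rw [h1, h2, potential, hauu]; ring

end InitialData

/-! ### Energy and energy norm of the initial state -/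

section States

namespace Sys

/-- The state at time `t` with components `U`, `X`, `V`, `Q`. -/
def st (t : ℝ) (U X V Q : L2C) : St :=
  (U, X, grp t (V + Complex.I • Q), grp (-t) (V - Complex.I • Q))

theorem V_st (t : ℝ) (U X V₀ Q₀ : L2C) : V t (st t U X V₀ Q₀) = V₀ := by
  rw [V, st, grp_neg_grp, grp_grp_neg]; module

theorem Q_st (t : ℝ) (U X V₀ Q₀ : L2C) : Q t (st t U X V₀ Q₀) = Q₀ := by
  rw [Q, st, grp_neg_grp, grp_grp_neg]
  have e : (-Complex.I / 2) • (V₀ + Complex.I • Q₀ - (V₀ - Complex.I • Q₀))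
      = (-(Complex.I * Complex.I)) • Q₀ := by module
  rw [e, Complex.I_mul_I, neg_neg, one_smul]

theorem conjSt_st_zero {U X V₀ Q₀ : L2C} (hU : refl U = U) (hX : refl X = X) (hV : refl V₀ = V₀)
    (hQ : refl Q₀ = Q₀) : conjSt (st 0 U X V₀ Q₀) = st 0 U X V₀ Q₀ := by
  have h1 : refl (V₀ - Complex.I • Q₀) = V₀ + Complex.I • Q₀ := by
    rw [map_sub, refl_smul, hV, hQ, Complex.conj_I, neg_smul, sub_neg_eq_add]
  have h2 : refl (V₀ + Complex.I • Q₀) = V₀ - Complex.I • Q₀ := by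
    rw [map_add, refl_smul, hV, hQ, Complex.conj_I, neg_smul, sub_eq_add_neg]
  simp only [conjSt, st, refl_grp, neg_zero, hU, hX, h1, h2]

variable {P : Sys} {u₀ u₁ v₀ v₁ w₁ v₀x : L2} {U X V₀ R : L2C}

theorem mulOp_om_wt_div (R : L2C) : mulOp (fun ξ => om ξ * wt (-1) ξ)
    (mulOp (fun ξ => wt 1 ξ / (om ξ : ℂ)) R) = R := by
  rw [mulOp_mulOp (isMult_om_wt le_rfl) (isMult_wt_div_om le_rfl), mulOp_eq_smul 1, one_smul]
  intro ξ
  have h1 := om_ne_zero ξ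
  have h2 := wt_neg_mul 1 ξ
  field_simp
  linear_combination h2

theorem mulOp_wt_div_om (Q : L2C) : mulOp (fun ξ => wt 1 ξ / (om ξ : ℂ))
    (mulOp (fun ξ => om ξ * wt (-1) ξ) Q) = Q := by
  rw [mulOp_comm (isMult_wt_div_om le_rfl) (isMult_om_wt le_rfl), mulOp_om_wt_div]

theorem refl_primitive (hr : 1 / 2 < P.r)
    (hX : mulOp (fun ξ => 1 / (om ξ : ℂ)) (low P.r X) = ft w₁) : refl X = X := by
  have hm := isMult_inv_om.mul (isMult_low hr)
  rw [mulOp_mulOp isMult_inv_om (isMult_low hr)] at hX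
  refine mulOp_injective hm (fun ξ => mul_ne_zero (one_div_ne_zero (om_ne_zero ξ))
    (wt_ne_zero _ ξ)) ?_
  rw [← refl_mulOp hm hm (fun ξ => ?_), hX, refl_ft]
  rw [map_mul, map_div₀, map_one, wt_neg_arg, conj_wt, om_neg, Complex.conj_ofReal]

theorem conjSt_data (hs : 1 ≤ P.s) (hU : Rep P.r (toDist u₀) U)
    (hX : mulOp (fun ξ => 1 / (om ξ : ℂ)) (low P.r X) = ft w₁)
    (hV : Rep P.s (toDist v₀) V₀) (hR : Rep (P.s - 1) (toDist v₁) R) :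
    conjSt (st 0 U X V₀ (mulOp (fun ξ => wt 1 ξ / (om ξ : ℂ)) R))
      = st 0 U X V₀ (mulOp (fun ξ => wt 1 ξ / (om ξ : ℂ)) R) := by
  have hr := P.hr
  have hm := isMult_wt_div_om (σ := 1) le_rfl
  refine conjSt_st_zero (refl_of_rep (by linarith) hU) (refl_primitive hr hX)
    (refl_of_rep (by linarith) hV) ?_
  rw [refl_mulOp hm hm, refl_of_rep (by linarith) hR]
  intro ξ
  rw [map_div₀, wt_neg_arg, conj_wt, om_neg, Complex.conj_ofReal]

/-- The energy norm of the initial data. -/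
theorem rho_data (hs : 1 ≤ P.s) (hU : Rep P.r (toDist u₀) U) (hV : Rep P.s (toDist v₀) V₀)
    (hR : Rep (P.s - 1) (toDist v₁) R) (hvx : Dx (toDist v₀) = toDist v₀x) :
    P.rho (st 0 U X V₀ (mulOp (fun ξ => wt 1 ξ / (om ξ : ℂ)) R))
      = P.c.α ^ 2 * ‖u₀‖ ^ 2 + (‖v₀‖ ^ 2 + ‖v₀x‖ ^ 2 + ‖v₁‖ ^ 2) := by
  have hk := isMult_kap hs
  have hm := isMult_wt_div_om (σ := 1) le_rfl
  set Q₀ := mulOp (fun ξ => wt 1 ξ / (om ξ : ℂ)) R with hQ₀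
  have e1 : mulOp P.kap Q₀ = ft v₁ := by
    have h := (hR.mono (τ := 0) (by linarith)).unique (rep_toDist v₁)
    rw [← h, hQ₀, mulOp_mulOp hk hm]
    congr 2; funext ξ
    have : wt (0 - (P.s - 1)) ξ = wt (-P.s) ξ * wt 1 ξ := by rw [← wt_add]; congr 1; ring
    have := om_ne_zero ξ
    rw [kap, ‹wt (0 - (P.s - 1)) ξ = _›]; field_simp
  have hv := (hV.mono (τ := 0) (by linarith)).unique (rep_toDist v₀)
  have hw : IsMult (wt (0 - P.s)) := isMult_wt (by linarith)
  have e2 : ‖mulOp P.kap V₀‖ ^ 2 = ‖v₀‖ ^ 2 + ‖v₀x‖ ^ 2 := by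
    rw [← norm_sq_mulOp_add, ← norm_ft v₀, ← norm_ft v₀x]
    congr 3
    · rw [← hv, mulOp_mulOp isMult_inv_om hk]
      congr 2; funext ξ
      have := om_ne_zero ξ
      rw [kap, zero_sub]; field_simp
    · have h := ((rep_toDist v₀).deriv (τ := 0 - 1) rfl).unique
        (hvx ▸ (rep_toDist v₀x).mono (τ := 0 - 1) (by norm_num))
      have hw1 : IsMult (wt (0 - 1 - 0)) := isMult_wt (by norm_num)
      refine mulOp_injective hw1 (wt_ne_zero _) ?_
      rw [← h, ← hv, mulOp_mulOp isMult_rz hk, mulOp_mulOp hw1 (isMult_rz.mul hk),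
        mulOp_mulOp isMult_dz hw]
      congr 2; funext ξ
      rw [dz_eq, kap, zero_sub]
      ring_nf
  rw [rho, st]
  simp only [neg_zero, grp_zero, map_add, map_sub, map_smul, e1]
  have hp := parallelogram_law_with_norm ℂ (mulOp P.kap V₀) (Complex.I • ft v₁)
  rw [norm_smul, Complex.norm_I, one_mul, norm_ft] at hp
  rw [uh, low_of_rep P.hr hU, norm_ft]
  nlinarith [hp, e2]

theorem en_data (hs : 1 ≤ P.s) (hauu : P.c.auu = 0) (hU : Rep P.r (toDist u₀) U)
    (hu₁ : Rep P.r (toDist u₁) (mulOp rz X))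
    (hX : mulOp (fun ξ => 1 / (om ξ : ℂ)) (low P.r X) = ft w₁)
    (hV : Rep P.s (toDist v₀) V₀)
    (hR : Rep (P.s - 1) (toDist v₁) R) (hvx : Dx (toDist v₀) = toDist v₀x) :
    P.en 0 (st 0 U X V₀ (mulOp (fun ξ => wt 1 ξ / (om ξ : ℂ)) R))
      = energy P.c u₀ u₁ w₁ v₀ v₀x v₁ := by
  rw [en, rho_data hs hU hV hR hvx, energy_eq]
  have hVr : Rep P.r (toDist v₀) (mulOp (wt (P.r - P.s)) V₀) := hV.mono P.hrs
  congr 1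
  · congr 2
    rw [xh, ← norm_sq_mulOp_add, ← norm_ft w₁, ← norm_ft u₁, ← low_of_rep P.hr hu₁]
    congr 3
    exact (mulOp_comm isMult_rz (isMult_low P.hr) X)
  · rw [integral_potential P.hr P.c hauu hVr]
    have e1 : P.vh 0 (st 0 U X V₀ (mulOp (fun ξ => wt 1 ξ / (om ξ : ℂ)) R)) = ft v₀ := by
      rw [← low_Vr, Vr, V_st]; exact low_of_rep P.hr hVr
    have e2 : P.uh (st 0 U X V₀ (mulOp (fun ξ => wt 1 ξ / (om ξ : ℂ)) R)) = ft u₀ :=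
      low_of_rep P.hr hU
    rw [cubic, e1, e2, Vr, V_st]

end Sys

end States

/-! ### Uniqueness -/

section Uniqueness

/-- A curve which solves `Y' = H` in a weaker norm, with `H` continuous in the stronger norm, solves
it in the stronger norm: it differs from the integral of `H` by a constant. -/
theorem hasDerivWithinAt_of_mulOp {n : ℝ → ℂ} (hn : IsMult n) (h0 : ∀ ξ, n ξ ≠ 0) {Y H : ℝ → L2C}
    {T : ℝ} (hH : ContinuousOn H (Icc 0 T))
    (hd : ∀ t ∈ Icc 0 T, HasDerivWithinAt (fun τ => mulOp n (Y τ)) (mulOp n (H t)) (Icc 0 T) t)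
    {t : ℝ} (ht : t ∈ Icc 0 T) : HasDerivWithinAt Y (H t) (Icc 0 T) t := by
  have hT : 0 ≤ T := ht.1.trans ht.2
  set K : ℝ → L2C := IccExtend hT ((Icc 0 T).domRestrict H) with hK
  have hKc : Continuous K := (continuousOn_iff_continuous_domRestrict.1 hH).Icc_extend'
  have hKH : ∀ t ∈ Icc 0 T, K t = H t := fun t ht => by
    rw [hK, IccExtend_of_mem hT _ ht]; rfl
  set Z : ℝ → L2C := fun t => ∫ x in (0)..t, K x with hZ
  have hZd : ∀ t ∈ Icc 0 T, HasDerivWithinAt Z (H t) (Icc 0 T) t := fun t ht => by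
    rw [← hKH t ht]
    exact (hKc.integral_hasStrictDerivAt 0 t).hasDerivAt.hasDerivWithinAt
  have hdiff : ∀ t ∈ Icc 0 T,
      HasDerivWithinAt (fun τ => mulOp n (Y τ) - mulOp n (Z τ)) 0 (Icc 0 T) t := fun t ht => by
    have := (hd t ht).sub (hasDerivWithinAt_mulOp n (hZd t ht))
    rwa [sub_self] at this
  have hconst : ∀ t ∈ Icc 0 T, Y t = Y 0 + Z t := fun t ht => by
    have h := constant_of_has_deriv_right_zero
      (f := fun τ => mulOp n (Y τ) - mulOp n (Z τ))
      (fun t ht => (hdiff t ht).continuousWithinAt)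
      (fun t ht => hasDerivWithinAt_Ici_of_Icc ht (hdiff t (Ico_subset_Icc_self ht))) t ht
    have hZ0 : Z 0 = 0 := by simp [hZ]
    simp only [← map_sub] at h
    have h1 := mulOp_injective hn h0 h
    rw [hZ0, sub_zero] at h1
    rw [← h1]; abel
  exact ((hZd t ht).const_add (Y 0)).congr hconst (hconst t ht)

theorem IsSolution.mono {c : Coeffs} {r s : ℝ} {I J : Set ℝ} {u v : ℝ → L2}
    {ut vt : ℝ → 𝓢'(ℝ, ℂ)} (h : IsSolution c r s I u v ut vt) (hJ : J ⊆ I) :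
    IsSolution c r s J u v ut vt := by
  have h1 : ∀ {m σ} {f : ℝ → 𝓢'(ℝ, ℂ)}, CmSobolev m σ I f → CmSobolev m σ J f :=
    fun ⟨g, hg, hr⟩ => ⟨g, hg.mono hJ, fun t ht => hr t (hJ ht)⟩
  have h2 : ∀ {m σ} {f : ℝ → 𝓢'(ℝ, ℂ)}, CmHomSobolev m σ I f → CmHomSobolev m σ J f :=
    fun ⟨g, hg, hr⟩ => ⟨g, hg.mono hJ, fun t ht => hr t (hJ ht)⟩
  have h3 : ∀ {σ} {f f' : ℝ → 𝓢'(ℝ, ℂ)}, HasTimeDeriv σ I f f' → HasTimeDeriv σ J f f' :=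
    fun ⟨g, g', hg⟩ => ⟨g, g', fun t ht => ⟨(hg t (hJ ht)).1, (hg t (hJ ht)).2.1,
      (hg t (hJ ht)).2.2.mono hJ⟩⟩
  obtain ⟨utt, hutt, hu⟩ := h.eq_u
  obtain ⟨vtt, hvtt, hv⟩ := h.eq_v
  exact ⟨h1 h.u_mem, h1 h.ut_mem, h2 h.ut_mem_hom, h1 h.v_mem, h1 h.vt_mem, h3 h.u_deriv,
    h3 h.v_deriv, ⟨utt, h3 hutt, fun t ht => hu t (hJ ht)⟩,
    ⟨vtt, h3 hvtt, fun t ht => hv t (hJ ht)⟩⟩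

/-- The Fourier transform of `L²`, over the real numbers. -/
def fwdL : L2C →L[ℝ] L2C :=
  (Lp.fourierTransformₗᵢ ℝ ℂ).toContinuousLinearEquiv.toContinuousLinearMap.restrictScalars ℝ

theorem HasTimeDeriv.exists_rep {σ : ℝ} {I : Set ℝ} {f f' : ℝ → 𝓢'(ℝ, ℂ)}
    (h : HasTimeDeriv σ I f f') : ∃ G G' : ℝ → L2C, ∀ t ∈ I,
      Rep σ (f t) (G t) ∧ Rep σ (f' t) (G' t) ∧ HasDerivWithinAt G (G' t) I t := by
  obtain ⟨g, g', h⟩ := h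
  exact ⟨fun t => fwdL (g t), fun t => fwdL (g' t), fun t ht =>
    ⟨sobolevRep_iff.1 (h t ht).1, sobolevRep_iff.1 (h t ht).2.1,
      fwdL.hasFDerivAt.comp_hasDerivWithinAt t (h t ht).2.2⟩⟩

theorem CmSobolev.exists_rep {m : ℕ} {σ : ℝ} {I : Set ℝ} {f : ℝ → 𝓢'(ℝ, ℂ)}
    (h : CmSobolev m σ I f) : ∃ G : ℝ → L2C, ContinuousOn G I ∧ ∀ t ∈ I, Rep σ (f t) (G t) := by
  obtain ⟨g, hg, hr⟩ := h
  exact ⟨fun t => fwdL (g t), fwdL.continuous.comp_continuousOn hg.continuousOn,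
    fun t ht => sobolevRep_iff.1 (hr t ht)⟩

/-- The only solution of `h = ∂ₓ² (z + h)`. -/
theorem eq_mulOp_rz_rz {Z H : L2C}
    (h : mulOp (wt (-2)) H = mulOp dz (mulOp dz (Z + H))) : H = mulOp rz (mulOp rz Z) := by
  have h1 := Sys.mulOp_rz_rz_eq Z
  rw [← map_add, ← map_add] at h1
  have hw : IsMult (wt (-2)) := isMult_wt (by norm_num)
  set D := H - mulOp rz (mulOp rz Z) with hD
  have h2 : mulOp (wt (-2)) D = mulOp dz (mulOp dz D) := by
    rw [hD, map_sub, h, h1, ← map_sub, ← map_sub]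
    congr 2; abel
  have hm := Sys.isMult_om_om_wt (le_refl (-2 : ℝ))
  have h3 : mulOp (fun ξ => om ξ * (om ξ * wt (-2) ξ)) D = 0 := by
    have e : mulOp (fun ξ => om ξ * (om ξ * wt (-2) ξ)) D + mulOp (fun ξ => dz ξ * dz ξ) D
        = mulOp (wt (-2)) D := by
      rw [mulOp_add_symbol hm (isMult_dz.mul isMult_dz)]
      congr 2; funext ξ
      rw [dz_sq]; ring
    rw [h2, mulOp_mulOp isMult_dz isMult_dz] at e
    simpa using e
  have h4 : D = 0 := mulOp_injective hm
    (fun ξ => mul_ne_zero (om_ne_zero ξ) (mul_ne_zero (om_ne_zero ξ) (wt_ne_zero _ ξ)))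
    (h3.trans (map_zero _).symm)
  exact sub_eq_zero.1 h4

namespace Sys

variable {P : Sys} {T : ℝ} {u v : ℝ → L2} {ut vt : ℝ → 𝓢'(ℝ, ℂ)}

/-- A solution of the original equations gives a solution of the first-order system with the
auxiliary unknown `x = uₜ`. -/
theorem exists_isODESol_of_isSolution (h₁ : P.m₁ = fun _ => 1) (h₂ : P.m₂ = fun ξ => rz ξ * rz ξ)
    (h : IsSolution P.c P.r P.s (Ico 0 T) u v ut vt) : ∃ U X W Q : ℝ → L2C,
      (∀ t ∈ Ico 0 T, Rep P.r (toDist (u t)) (U t) ∧ Rep P.r (ut t) (X t) ∧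
        Rep P.s (toDist (v t)) (W t) ∧
        Rep (P.s - 1) (vt t) (mulOp (fun ξ => om ξ * wt (-1) ξ) (Q t))) ∧
      ∀ T' < T, IsODESol P.field T' fun t => st t (U t) (X t) (W t) (Q t) := by
  obtain ⟨U, U', hU⟩ := h.u_deriv.exists_rep
  obtain ⟨utt, hutt, hequ⟩ := h.eq_u
  obtain ⟨vtt, hvtt, heqv⟩ := h.eq_v
  obtain ⟨X, X', hX⟩ := hutt.exists_rep
  obtain ⟨W, hWc, hW⟩ := h.v_mem.exists_rep
  obtain ⟨R, hRc, hR⟩ := h.vt_mem.exists_rep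
  obtain ⟨A, A', hA⟩ := h.v_deriv.exists_rep
  obtain ⟨B, B', hB⟩ := hvtt.exists_rep
  set Q : ℝ → L2C := fun t => mulOp (fun ξ => wt 1 ξ / (om ξ : ℂ)) (R t) with hQ
  have hRQ : ∀ t, mulOp (fun ξ => om ξ * wt (-1) ξ) (Q t) = R t := fun t => mulOp_om_wt_div (R t)
  have hQc : ContinuousOn Q (Ico 0 T) := (mulOp _).continuous.comp_continuousOn hRc
  set y : ℝ → St := fun t => st t (U t) (X t) (W t) (Q t) with hy
  have hVy : ∀ t, V t (y t) = W t := fun t => V_st t _ _ _ _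
  have hWr : ∀ t ∈ Ico 0 T, Rep P.r (toDist (v t)) (P.Vr t (y t)) := fun t ht => by
    have := (hW t ht).mono P.hrs
    rwa [Vr, hVy]
  have hN₁ : ∀ t ∈ Ico 0 T, Rep P.r (f₁ P.c (u t) (v t)) (P.N₁ t (y t)) := fun t ht =>
    rep_quad P.hr _ _ _ (hU t ht).1 (hWr t ht)
  have hN₂ : ∀ t ∈ Ico 0 T, Rep P.r (f₂ P.c (u t) (v t)) (P.N₂ t (y t)) := fun t ht =>
    rep_quad P.hr _ _ _ (hU t ht).1 (hWr t ht)
  have hUc : ContinuousOn U (Ico 0 T) := fun t ht => (hU t ht).2.2.continuousWithinAt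
  have hGc : ContinuousOn (fun t => P.G t (y t)) (Ico 0 T) := by
    have hVr : ContinuousOn (fun t => P.Vr t (y t)) (Ico 0 T) := by
      simp only [Vr, hVy]
      exact (mulOp _).continuous.comp_continuousOn hWc
    exact (mulOp _).continuous.comp_continuousOn
      ((continuous_quadHr P.hr P.c.buu P.c.buv P.c.bvv).comp_continuousOn
        (f := fun t => (U t, P.Vr t (y t))) (hUc.prodMk hVr))
  -- the equation for `u`
  have dU : ∀ t ∈ Ico 0 T, HasDerivWithinAt U (mulOp P.m₁ (X t)) (Ico 0 T) t := fun t ht => by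
    rw [h₁, mulOp_eq_smul 1 fun _ => rfl, one_smul, (hX t ht).1.unique (hU t ht).2.1]
    exact (hU t ht).2.2
  have dX : ∀ t ∈ Ico 0 T, HasDerivWithinAt X
      (mulOp P.m₂ (((P.c.α ^ 2 : ℝ) : ℂ) • U t + P.N₁ t (y t))) (Ico 0 T) t := fun t ht => by
    have hτ : P.r - 1 - 1 = P.r - 2 := by ring
    have r1 := (((hU t ht).1.deriv rfl).deriv hτ.symm).smul ((P.c.α ^ 2 : ℝ) : ℂ)
    have r2 := (((hX t ht).2.1.deriv rfl).deriv hτ.symm)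
    have r3 := ((hN₁ t ht).deriv rfl).deriv hτ.symm
    have r5 := (hX t ht).2.1.mono (τ := P.r - 2) (by linarith)
    have e := (r1.add r2).add r3
    rw [← hequ t ht] at e
    have e' := r5.unique e
    have e2 : P.r - 2 - P.r = -2 := by ring
    rw [e2] at e'
    rw [h₂, ← mulOp_mulOp isMult_rz isMult_rz, ← eq_mulOp_rz_rz (H := X' t)]
    · exact (hX t ht).2.2
    · rw [e']
      simp only [map_add, map_smul]
      abel
  -- the equation for `v`, in a weaker topology
  have dV : ∀ t ∈ Ico 0 T, HasDerivWithinAt (fun τ => mulOp (fun ξ => 1 / (om ξ : ℂ)) (W τ))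
      (Q t) (Ico 0 T) t := fun t ht => by
    have h1 := hasDerivWithinAt_mulOp (fun ξ => wt 1 ξ / (om ξ : ℂ)) (hA t ht).2.2
    rw [(hA t ht).2.1.unique (hR t ht)] at h1
    refine h1.congr_of_mem (fun τ hτ => ?_) ht
    have e := (hA τ hτ).1.unique ((hW τ hτ).mono (τ := P.s - 1) (by linarith))
    rw [e, mulOp_mulOp (isMult_wt_div_om le_rfl) (isMult_wt (by linarith))]
    congr 2; funext ξ
    have e2 : P.s - 1 - P.s = -1 := by ring
    rw [e2, div_mul_eq_mul_div, wt_mul_neg]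
  have hm2 : IsMult fun ξ => wt 1 ξ / (om ξ : ℂ) * (wt 1 ξ / (om ξ : ℂ)) :=
    (isMult_wt_div_om le_rfl).mul (isMult_wt_div_om le_rfl)
  have dQ : ∀ t ∈ Ico 0 T, HasDerivWithinAt (fun τ => mulOp (fun ξ => 1 / (om ξ : ℂ)) (Q τ))
      (-W t + mulOp (fun ξ => 1 / (om ξ : ℂ)) (P.G t (y t))) (Ico 0 T) t := fun t ht => by
    have h1 := hasDerivWithinAt_mulOp (fun ξ => wt 1 ξ / (om ξ : ℂ) * (wt 1 ξ / (om ξ : ℂ)))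
      (hB t ht).2.2
    have hs2 : P.s - 1 - 1 = P.s - 2 := by ring
    have r1 := ((hW t ht).deriv rfl).deriv hs2.symm
    have r2 := (hW t ht).mono (τ := P.s - 2) (by linarith)
    have r4 := (hN₂ t ht).mono (τ := P.s - 2) (by linarith [P.hsr])
    have r5 := (r1.sub r2).add r4
    rw [← heqv t ht] at r5
    have eB := (hB t ht).2.1.unique r5
    have eB' : mulOp (fun ξ => wt 1 ξ / (om ξ : ℂ) * (wt 1 ξ / (om ξ : ℂ))) (B' t)
        = -W t + mulOp (fun ξ => 1 / (om ξ : ℂ)) (P.G t (y t)) := by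
      have hw2 : IsMult (wt (P.s - 2 - P.s)) := isMult_wt (by linarith)
      have hw3 : IsMult (wt (P.s - 2 - P.r)) := isMult_wt (by linarith [P.hsr])
      have hww : ∀ ξ, wt 1 ξ * wt 1 ξ * wt (-2) ξ = 1 := fun ξ => by
        rw [wt_neg_two]
        have := wt_mul_neg 1 ξ
        linear_combination (wt 1 ξ * wt (-1) ξ + 1) * this
      rw [eB, map_add, map_sub]
      congr 1
      · have e3 : mulOp (fun ξ => wt 1 ξ / (om ξ : ℂ) * (wt 1 ξ / (om ξ : ℂ)) * (dz ξ * dz ξ)) (W t)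
            + mulOp (fun _ => 1) (W t) = mulOp (fun ξ => wt 1 ξ / (om ξ : ℂ)
              * (wt 1 ξ / (om ξ : ℂ)) * wt (P.s - 2 - P.s) ξ) (W t) := by
          rw [mulOp_add_symbol (hm2.mul (isMult_dz.mul isMult_dz)) (IsMult.const 1)]
          congr 2; funext ξ
          have h2 := om_ne_zero ξ
          have e2 : P.s - 2 - P.s = -2 := by ring
          rw [e2, dz_sq]
          field_simp
          linear_combination (-(om ξ : ℂ) ^ 2) * hww ξ
        rw [mulOp_eq_smul 1 fun _ => rfl, one_smul] at e3
        rw [mulOp_mulOp isMult_dz isMult_dz, mulOp_mulOp hm2 (isMult_dz.mul isMult_dz),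
          mulOp_mulOp hm2 hw2, ← e3]
        abel
      · rw [G, mulOp_mulOp isMult_inv_om P.isMult_up, mulOp_mulOp hm2 hw3]
        congr 2; funext ξ
        have h2 := om_ne_zero ξ
        have e2 : wt (P.s - 2 - P.r) ξ = wt (-2) ξ * wt (P.s - P.r) ξ := by
          rw [← wt_add]; congr 1; ring
        rw [e2]
        field_simp
        linear_combination (wt (P.s - P.r) ξ) * hww ξ
    rw [eB'] at h1
    refine h1.congr_of_mem (fun τ hτ => ?_) ht
    have e := (hB τ hτ).1.unique ((hR τ hτ).mono (τ := P.s - 2) (by linarith))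
    rw [e, hQ, mulOp_mulOp isMult_inv_om (isMult_wt_div_om le_rfl),
      mulOp_mulOp hm2 (isMult_wt (by linarith))]
    congr 2; funext ξ
    have e2 : P.s - 2 - (P.s - 1) = -1 := by ring
    have h2 := om_ne_zero ξ
    have h3 := wt_mul_neg 1 ξ
    rw [e2]
    field_simp
    linear_combination (-wt 1 ξ) * h3
  -- the half-waves
  have hom : ∀ f : L2C, mulOp (fun ξ => om ξ * (1 / (om ξ : ℂ))) f = f := fun f => by
    rw [mulOp_eq_smul 1 fun ξ => ?_, one_smul]
    rw [mul_one_div, div_self (om_ne_zero ξ)]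
  have hom' : IsMult fun ξ => om ξ * (1 / (om ξ : ℂ)) := by
    have e : (fun ξ => om ξ * (1 / (om ξ : ℂ))) = fun _ => 1 := funext fun ξ => by
      rw [mul_one_div, div_self (om_ne_zero ξ)]
    rw [e]; exact IsMult.const 1
  have hsub : ∀ T' < T, Icc 0 T' ⊆ Ico 0 T := fun T' hT' t ht => ⟨ht.1, ht.2.trans_lt hT'⟩
  have half : ∀ ε : ℝ, ε * ε = 1 → ∀ T' < T, ∀ t ∈ Icc 0 T',
      HasDerivWithinAt (fun τ => grp (ε * τ) (W τ + (ε * Complex.I : ℂ) • Q τ))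
        ((ε * Complex.I : ℂ) • grp (ε * t) (P.G t (y t))) (Icc 0 T') t := by
    intro ε hε T' hT' t ht
    refine hasDerivWithinAt_of_mulOp isMult_inv_om (fun ξ => one_div_ne_zero (om_ne_zero ξ))
      (H := fun t => (ε * Complex.I : ℂ) • grp (ε * t) (P.G t (y t))) ?_ (fun t ht => ?_) ht
    · exact ContinuousOn.const_smul (continuousOn_grp (θ := fun t => ε * t) (by fun_prop)
        (hGc.mono (hsub T' hT'))) (ε * Complex.I : ℂ)
    · have ht' := hsub T' hT' ht
      have h1 : HasDerivWithinAt
          (fun τ => mulOp (fun ξ => 1 / (om ξ : ℂ)) (W τ + (ε * Complex.I : ℂ) • Q τ))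
          (Q t + (ε * Complex.I : ℂ) • (-W t + mulOp (fun ξ => 1 / (om ξ : ℂ)) (P.G t (y t))))
          (Icc 0 T') t := by
        have := ((dV t ht').add ((dQ t ht').const_smul (ε * Complex.I : ℂ))).mono (hsub T' hT')
        simp only [map_add, map_smul]
        exact this
      have h2 := hasDerivWithinAt_grp isMult_inv_om hom' ε h1 rfl
      have e : ∀ τ, mulOp (fun ξ => 1 / (om ξ : ℂ)) (grp (ε * τ) (W τ + (ε * Complex.I : ℂ) • Q τ))
          = grp (ε * τ) (mulOp (fun ξ => 1 / (om ξ : ℂ)) (W τ + (ε * Complex.I : ℂ) • Q τ)) :=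
        fun τ => mulOp_comm isMult_inv_om (isMult_ph _) _
      simp_rw [e]
      refine h2.congr_deriv ?_
      rw [hom, ← map_smul, ← map_add, map_smul]
      have e3 : Q t + (ε * Complex.I : ℂ) • (-W t + mulOp (fun ξ => 1 / (om ξ : ℂ)) (P.G t (y t)))
          + (ε * Complex.I : ℂ) • (W t + (ε * Complex.I : ℂ) • Q t)
          = (ε * Complex.I : ℂ) • mulOp (fun ξ => 1 / (om ξ : ℂ)) (P.G t (y t))
            + (1 + (ε * ε) * (Complex.I * Complex.I) : ℂ) • Q t := by module
      have e4 : (ε * ε : ℂ) = 1 := by exact_mod_cast hε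
      rw [e3, e4, Complex.I_mul_I, one_mul, add_neg_cancel, zero_smul, add_zero, map_smul]
      congr 1
      exact (mulOp_comm isMult_inv_om (isMult_ph _) _).symm
  refine ⟨U, X, W, Q, fun t ht => ⟨(hU t ht).1, (hX t ht).1, hW t ht, ?_⟩, fun T' hT' t ht => ?_⟩
  · rw [hRQ]; exact hR t ht
  · have ht' := hsub T' hT' ht
    have hp := half 1 (one_mul 1) T' hT' t ht
    have hm := half (-1) (by norm_num) T' hT' t ht
    simp only [Complex.ofReal_one, Complex.ofReal_neg, one_mul, neg_one_mul, neg_smul,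
      ← sub_eq_add_neg] at hp hm
    have := ((dU t ht').mono (hsub T' hT')).prodMk
      (((dX t ht').mono (hsub T' hT')).prodMk (hp.prodMk hm))
    refine this.congr_deriv ?_
    rw [field, neg_smul]
    rfl

end Sys

/-- The first-order system with the auxiliary unknown `x = uₜ`, which makes sense for all solutions:
it requires no primitive of `uₜ`. -/
def velSys (c : Coeffs) {r s : ℝ} (hr : 1 / 2 < r) (hrs : r ≤ s) (hsr : s ≤ r + 1) : Sys where
  c := c
  r := r
  s := s
  hr := hr
  hrs := hrs
  hsr := hsr
  m₁ := fun _ => 1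
  m₂ := fun ξ => rz ξ * rz ξ
  hm₁ := IsMult.const 1
  hm₂ := isMult_rz.mul isMult_rz
  symm₁ := fun _ => map_one _
  symm₂ := fun ξ => by rw [map_mul, conj_rz, rz_neg, neg_neg]

/-- Uniqueness, by comparison of the associated solutions of the first-order system. -/
theorem IsSolution.unique {c : Coeffs} {r s T : ℝ} (hr : 1 / 2 < r) (hrs : r ≤ s)
    (hsr : s ≤ r + 1) {u₀ u₁ v₀ v₁ : L2} {u v u' v' : ℝ → L2} {ut vt ut' vt' : ℝ → 𝓢'(ℝ, ℂ)}
    (h : IsSolution c r s (Ico 0 T) u v ut vt) (h' : IsSolution c r s (Ico 0 T) u' v' ut' vt')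
    (hd : HasData u₀ u₁ v₀ v₁ u v ut vt) (hd' : HasData u₀ u₁ v₀ v₁ u' v' ut' vt')
    {t : ℝ} (ht : t ∈ Ico 0 T) : u t = u' t ∧ v t = v' t ∧ ut t = ut' t ∧ vt t = vt' t := by
  obtain ⟨U, X, W, Q, hrep, hode⟩ :=
    Sys.exists_isODESol_of_isSolution (P := velSys c hr hrs hsr) rfl rfl h
  obtain ⟨U', X', W', Q', hrep', hode'⟩ :=
    Sys.exists_isODESol_of_isSolution (P := velSys c hr hrs hsr) rfl rfl h'
  have h0 : (0 : ℝ) ∈ Ico 0 T := ⟨le_rfl, ht.1.trans_lt ht.2⟩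
  obtain ⟨a1, a2, a3, a4⟩ := hrep 0 h0
  obtain ⟨b1, b2, b3, b4⟩ := hrep' 0 h0
  rw [hd.1, ← hd'.1] at a1
  rw [hd.2.1, ← hd'.2.1] at a2
  rw [hd.2.2.1, ← hd'.2.2.1] at a3
  rw [hd.2.2.2, ← hd'.2.2.2] at a4
  have eQ : Q 0 = Q' 0 := by
    rw [← Sys.mulOp_wt_div_om (Q 0), a4.unique b4, Sys.mulOp_wt_div_om]
  have e := IsODESol.unique (velSys c hr hrs hsr).isLocLipField (hode t ht.2) (hode' t ht.2)
    (by simp only [a1.unique b1, a2.unique b2, a3.unique b3, eQ]) (right_mem_Icc.2 ht.1)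
  simp only at e
  have eU : U t = U' t := congrArg Prod.fst e
  have eX : X t = X' t := congrArg (fun y : St => y.2.1) e
  have eW : W t = W' t := by
    rw [← Sys.V_st t (U t) (X t) (W t) (Q t), e, Sys.V_st]
  have eQt : Q t = Q' t := by
    rw [← Sys.Q_st t (U t) (X t) (W t) (Q t), e, Sys.Q_st]
  obtain ⟨a1, a2, a3, a4⟩ := hrep t ht
  obtain ⟨b1, b2, b3, b4⟩ := hrep' t ht
  rw [eU] at a1
  rw [eX] at a2
  rw [eW] at a3
  rw [eQt] at a4
  exact ⟨toDist_injective (a1.ext b1), toDist_injective (a3.ext b3), a2.ext b2, a4.ext b4⟩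

end Uniqueness

/-! ### Existence -/

section Existence

/-- The first-order system in which the energy is controlled: the auxiliary unknown is
`x = (1 - ∂ₓ²)^(1/2) ∂ₓ⁻¹ uₜ`, and `(v, vₜ)` is considered in `H¹ × L²` at least. -/
def energySys (c : Coeffs) {r s : ℝ} (hr : 1 / 2 < r) (hrs : r ≤ s) (hsr : s ≤ r + 1) : Sys where
  c := c
  r := r
  s := max s 1
  hr := hr
  hrs := hrs.trans (le_max_left _ _)
  hsr := max_le hsr (by linarith)
  m₁ := rz
  m₂ := rz
  hm₁ := isMult_rz
  hm₂ := isMult_rz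
  symm₁ := fun ξ => by rw [conj_rz, rz_neg, neg_neg]
  symm₂ := fun ξ => by rw [conj_rz, rz_neg, neg_neg]

/-- Global existence for data in the potential well. -/
theorem exists_isSolution {c : Coeffs} (hα : c.α ≠ 0) (hauu : c.auu = 0) (hB : c.buu = -c.auv)
    (hC : c.buv = -c.avv) {r s : ℝ} (hr : 1 / 2 < r) (hrs : r ≤ s) (hsr : s ≤ r + 1)
    {u₀ u₁ v₀ v₁ w₁ v₀x : L2} (hu₀ : TemperedDistribution.MemSobolev r 2 (toDist u₀))
    (hu₁ : TemperedDistribution.MemSobolev r 2 (toDist u₁))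
    (hv₀ : TemperedDistribution.MemSobolev s 2 (toDist v₀))
    (hv₁ : TemperedDistribution.MemSobolev (s - 1) 2 (toDist v₁))
    (hw₁ : Dx (toDist w₁) = toDist u₁) (hvx : Dx (toDist v₀) = toDist v₀x)
    (hE : energy c u₀ u₁ w₁ v₀ v₀x v₁ < 1 / 6 * (1 / (3 * cubeConst c)) ^ 2)
    (hρ : c.α ^ 2 * ‖u₀‖ ^ 2 + (‖v₀‖ ^ 2 + ‖v₀x‖ ^ 2 + ‖v₁‖ ^ 2)
      < (1 / (3 * cubeConst c)) ^ 2) :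
    ∃ (U V : ℝ → L2) (Ut Vt : ℝ → 𝓢'(ℝ, ℂ)),
      IsSolution c r s (Ici 0) U V Ut Vt ∧ HasData u₀ u₁ v₀ v₁ U V Ut Vt := by
  set P := energySys c hr hrs hsr with hP
  have hs1 : 1 ≤ P.s := le_max_right _ _
  obtain ⟨U₀, hU₀⟩ := exists_rep_of_memSobolev hu₀
  obtain ⟨U₁, hU₁⟩ := exists_rep_of_memSobolev hu₁
  obtain ⟨X₀, hX₀, hX₀'⟩ := exists_rep_primitive hr hw₁ hU₁
  rw [← hX₀] at hU₁
  obtain ⟨V₀, hV₀⟩ : ∃ V₀, Rep P.s (toDist v₀) V₀ := by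
    rcases le_total s 1 with h | h
    · have e : P.s = 1 := max_eq_right h
      rw [e]; exact exists_rep_one hvx
    · have e : P.s = s := max_eq_left h
      rw [e]; exact exists_rep_of_memSobolev hv₀
  obtain ⟨R₀, hR₀⟩ : ∃ R₀, Rep (P.s - 1) (toDist v₁) R₀ := by
    rcases le_total s 1 with h | h
    · have e : P.s = 1 := max_eq_right h
      rw [e, sub_self]; exact ⟨_, rep_toDist v₁⟩
    · have e : P.s = s := max_eq_left h
      rw [e]; exact exists_rep_of_memSobolev hv₁
  set x₀ := Sys.st 0 U₀ X₀ V₀ (mulOp (fun ξ => wt 1 ξ / (om ξ : ℂ)) R₀) with hx₀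
  have hreal : Sys.conjSt x₀ = x₀ := Sys.conjSt_data (P := P) hs1 hU₀ hX₀' hV₀ hR₀
  have hen := Sys.en_data (P := P) hs1 hauu hU₀ hU₁ hX₀' hV₀ hR₀ hvx
  have hrho := Sys.rho_data (P := P) (X := X₀) hs1 hU₀ hV₀ hR₀ hvx
  obtain ⟨y, hy0, hy⟩ := Sys.exists_global (P := P) rfl rfl hα hs1 hauu hB hC hreal
    (hen.trans_lt hE) (hrho.trans_lt hρ)
  have hyreal : ∀ t ∈ Ici (0 : ℝ), Sys.conjSt (y t) = y t := fun t ht =>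
    P.conjSt_eq_of_isODESol (T := t)
      (fun τ hτ => (hy τ hτ.1).mono Icc_subset_Ici_self) (by rw [hy0, hreal]) (right_mem_Icc.2 ht)
  have hs0 : (0 : ℝ) ≤ P.s := zero_le_one.trans hs1
  have hr0 : (0 : ℝ) ≤ P.r := by have := P.hr; linarith
  have hu : ∀ t, ∃ u : L2, 0 ≤ t → Rep P.r (toDist u) (y t).1 := fun t => by
    by_cases ht : 0 ≤ t
    · obtain ⟨u, hu⟩ := exists_ft_eq (F := low P.r (y t).1) (by
        rw [refl_low P.hr]; exact congrArg _ (congrArg Prod.fst (hyreal t ht)))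
      exact ⟨u, fun _ => rep_of_low hr0 hu.symm⟩
    · exact ⟨0, fun h => absurd h ht⟩
  have hv : ∀ t, ∃ v : L2, 0 ≤ t → Rep P.s (toDist v) (Sys.V t (y t)) := fun t => by
    by_cases ht : 0 ≤ t
    · obtain ⟨v, hv⟩ := exists_ft_eq (F := low P.s (Sys.V t (y t))) (by
        rw [refl_low (P.hr.trans_le P.hrs), ← Sys.V_conjSt, hyreal t ht])
      exact ⟨v, fun _ => rep_of_low hs0 hv.symm⟩
    · exact ⟨0, fun h => absurd h ht⟩
  choose U hU using hu
  choose V hV using hv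
  choose Ut hUt using fun t => exists_rep P.r (mulOp rz (y t).2.1)
  choose Vt hVt using fun t =>
    exists_rep (P.s - 1) (mulOp (fun ξ => om ξ * wt (-1) ξ) (Sys.Q t (y t)))
  refine ⟨U, V, Ut, Vt, Sys.isSolution_of_hasDeriv (P := P) (le_max_left _ _) rfl rfl
    (uniqueDiffOn_Ici 0) hy hU hV (fun t _ => hUt t) (fun t _ => hVt t), ?_, ?_, ?_, ?_⟩
  · have := hU 0 le_rfl
    rw [hy0] at this
    exact toDist_injective (this.ext hU₀)
  · have := hUt 0
    rw [hy0] at this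
    exact this.ext hU₁
  · have := hV 0 le_rfl
    rw [hy0, hx₀, Sys.V_st] at this
    exact toDist_injective (this.ext hV₀)
  · have := hVt 0
    rw [hy0, hx₀, Sys.Q_st, Sys.mulOp_om_wt_div] at this
    exact this.ext hR₀

end Existence

end KGB

end

theorem theorem2p4 (c : KGB.Coeffs) (hα : c.α ≠ 0) (hauu : c.auu = 0)
    (hB : c.buu = -c.auv) (hC : c.buv = -c.avv) :
    ∃ K₀ : ℝ, 0 < K₀ ∧
      ∀ r s : ℝ, 1 / 2 < r → r ≤ s → s ≤ r + 1 →
      ∀ u₀ u₁ v₀ v₁ : KGB.L2,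
        TemperedDistribution.MemSobolev r 2 (KGB.toDist u₀) →
        TemperedDistribution.MemSobolev r 2 (KGB.toDist u₁) →
        KGB.MemHomSobolev (r - 1) (KGB.toDist u₁) →
        TemperedDistribution.MemSobolev s 2 (KGB.toDist v₀) →
        TemperedDistribution.MemSobolev (s - 1) 2 (KGB.toDist v₁) →
      ∀ w₁ v₀x : KGB.L2,
        KGB.Dx (KGB.toDist w₁) = KGB.toDist u₁ →
        KGB.Dx (KGB.toDist v₀) = KGB.toDist v₀x →
        KGB.energy c u₀ u₁ w₁ v₀ v₀x v₁ < (1 / 6) * K₀ ^ (-6 : ℤ) →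
        ‖u₁‖ ^ 2 + c.α ^ 2 * ‖u₀‖ ^ 2 + ‖v₀‖ ^ 2 + ‖v₁‖ ^ 2 + ‖v₀x‖ ^ 2 < K₀ ^ (-3 : ℤ) →
      ∃ (U V : ℝ → KGB.L2) (Ut Vt : ℝ → 𝓢'(ℝ, ℂ)),
        KGB.IsSolution c r s (Ici 0) U V Ut Vt ∧ KGB.HasData u₀ u₁ v₀ v₁ U V Ut Vt ∧
        ∀ T : ℝ, 0 < T → ∀ (u v : ℝ → KGB.L2) (ut vt : ℝ → 𝓢'(ℝ, ℂ)),
          KGB.IsSolution c r s (Ico 0 T) u v ut vt → KGB.HasData u₀ u₁ v₀ v₁ u v ut vt →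
          ∀ t ∈ Ico 0 T, u t = U t ∧ v t = V t ∧ ut t = Ut t ∧ vt t = Vt t := by
  have hK := KGB.cubeConst_pos c
  set ρ := (1 / (3 * KGB.cubeConst c)) ^ 2 with hρ
  have hρ0 : 0 < ρ := by positivity
  -- with this choice both thresholds are below those of the potential well
  set K₀ := max 1 (1 / ρ) with hK₀
  have h1 : 1 ≤ K₀ := le_max_left _ _
  have h2 : 0 < K₀ := zero_lt_one.trans_le h1
  have h3 : K₀ ^ (-1 : ℤ) ≤ ρ := by
    rw [zpow_neg_one]
    exact inv_le_of_inv_le₀ hρ0 (by rw [← one_div]; exact le_max_right _ _)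
  have h4 : K₀ ^ (-3 : ℤ) ≤ ρ := (zpow_le_zpow_right₀ h1 (by norm_num)).trans h3
  have h5 : K₀ ^ (-6 : ℤ) ≤ ρ := (zpow_le_zpow_right₀ h1 (by norm_num)).trans h3
  refine ⟨K₀, h2, fun r s hr hrs hsr u₀ u₁ v₀ v₁ hu₀ hu₁ _ hv₀ hv₁ w₁ v₀x hw₁ hvx hE hn => ?_⟩
  obtain ⟨U, V, Ut, Vt, hsol, hdata⟩ := KGB.exists_isSolution hα hauu hB hC hr hrs hsr hu₀ hu₁ hv₀
    hv₁ hw₁ hvx (hE.trans_le (by linarith)) (by nlinarith [sq_nonneg ‖u₁‖])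
  exact ⟨U, V, Ut, Vt, hsol, hdata, fun T _ u v ut vt h hd t ht =>
    h.unique hr hrs hsr (hsol.mono Ico_subset_Ici_self) hd hdata ht⟩
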